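/- Let $N\ge 3$ be an integer, $0<\alpha<N$, $p,q>1$ real, and let $K\in C^1(\mathbb R^N)$ with $K\ge 0$. Let $$I_\alpha(x)=\frac{A_\alpha}{|x|^{N-\alpha}},\qquad A_\alpha=\frac{\Gamma\big(\frac{N-\alpha}{2}\big)}{\Gamma\big(\frac{\alpha}{2}\big)\pi^{N/2}2^\alpha},$$ be the Riesz potential of order $\alpha$, and consider the system $$\left\{\begin{aligned}-\Delta u+u+K(x)\,\phi\,|u|^{q-2}u&=(I_\alpha*|u|^p)|u|^{p-2}u&&\text{in }\mathbb R^N,\\ -\Delta\phi&=K(x)|u|^q&&\text{in }\mathbb R^N,\end{aligned}\right.\tag{1}$$ for real-valued $u,\phi$, understood in the weak sense (tested against functions in $C_c^\infty(\mathbb R^N)$). Suppose that one of the following holds: (i) $x\cdot\nabla K(x)+\gamma K(x)\ge 0$ for all $x\in\mathbb R^N$, for some $\gamma\in(-\infty,\frac{N+2}{2})$, and $$p\ge\frac{N+\alpha}{N-2}\quad\text{and}\quad\frac{N+\alpha}{p}\le\frac{N+2-2\gamma}{q};$$ (ii) $x\cdot\nabla K(x)+\gamma K(x)\le 0$ for all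 $x\in\mathbb R^N$, for some $\gamma\in\mathbb R$, and $$p\le\frac{N+\alpha}{N}\quad\text{and}\quad\frac{N+\alpha}{p}\ge\frac{N+2-2\gamma}{q}.$$ Then the only solution $(u,\phi)$ of (1) satisfying $$u\in H^1(\mathbb R^N)\cap L^{\frac{2Np}{N+\alpha}}(\mathbb R^N),\qquad \phi\in H^1(\mathbb R^N),$$ $$K|u|^q\in L^{\frac{2N}{N+2}}(\mathbb R^N),\qquad \nabla u\in H^1_{loc}(\mathbb R^N)\cap L^{\frac{2Np}{N+\alpha}}_{loc}(\mathbb R^N)$$ (where $\nabla u\in H^1_{loc}$ means that each weak partial derivative of $u$ is in $H^1_{loc}$, so that $u\in W^{2,2}_{loc}(\mathbb R^N)$) is $u=\phi=0$ almost everywhere. -/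

import Mathlib

open MeasureTheory

open scoped ENNReal ContDiff Gradient RealInnerProductSpace

namespace ChoquardSP

noncomputable section

/-- `G` is the weak (distributional) gradient of `f` on `ℝᴺ`. -/
def HasWeakGradient {N : ℕ} (f : EuclideanSpace ℝ (Fin N) → ℝ)
    (G : EuclideanSpace ℝ (Fin N) → EuclideanSpace ℝ (Fin N)) : Prop :=
  LocallyIntegrable f ∧ LocallyIntegrable G ∧
    ∀ η : EuclideanSpace ℝ (Fin N) → ℝ, ContDiff ℝ ∞ η → HasCompactSupport η →
      ∫ x, f x • ∇ η x = -∫ x, η x • G x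

/-- The space `L^s_loc(ℝᴺ)`. -/
def MemLpLoc {N : ℕ} {F : Type*} [NormedAddCommGroup F]
    (f : EuclideanSpace ℝ (Fin N) → F) (s : ℝ≥0∞) : Prop :=
  ∀ C : Set (EuclideanSpace ℝ (Fin N)), IsCompact C → MemLp f s (volume.restrict C)

/-- The Sobolev space `H¹(ℝᴺ)`. -/
def MemH1 {N : ℕ} (f : EuclideanSpace ℝ (Fin N) → ℝ) : Prop :=
  MemLp f 2 ∧ ∃ G, HasWeakGradient f G ∧ MemLp G 2

/-- The local Sobolev space `H¹_loc(ℝᴺ)`. -/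
def MemH1Loc {N : ℕ} (f : EuclideanSpace ℝ (Fin N) → ℝ) : Prop :=
  MemLpLoc f 2 ∧ ∃ G, HasWeakGradient f G ∧ MemLpLoc G 2

/-- The normalizing constant `A_α` of the Riesz potential on `ℝᴺ`. -/
def rieszConst (N : ℕ) (α : ℝ) : ℝ :=
  Real.Gamma ((N - α) / 2) / (Real.Gamma (α / 2) * Real.pi ^ ((N : ℝ) / 2) * 2 ^ α)

/-- The Riesz kernel `I_α(x) = A_α / |x|^(N-α)`. -/
def rieszKernel {N : ℕ} (α : ℝ) (x : EuclideanSpace ℝ (Fin N)) : ℝ :=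
  rieszConst N α / ‖x‖ ^ ((N : ℝ) - α)

/-- The convolution `I_α * f`. -/
def rieszPotential {N : ℕ} (α : ℝ) (f : EuclideanSpace ℝ (Fin N) → ℝ)
    (x : EuclideanSpace ℝ (Fin N)) : ℝ :=
  ∫ y, rieszKernel α (x - y) * f y

/-- `(u, φ)` is a weak solution on `ℝᴺ` of
`-Δu + u + K φ |u|^(q-2) u = (I_α * |u|^p) |u|^(p-2) u`, `-Δφ = K |u|^q`. -/
def IsWeakSolution {N : ℕ} (α p q : ℝ) (K u φ : EuclideanSpace ℝ (Fin N) → ℝ) : Prop :=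
  ∃ Du Dφ : EuclideanSpace ℝ (Fin N) → EuclideanSpace ℝ (Fin N),
    HasWeakGradient u Du ∧ HasWeakGradient φ Dφ ∧
    ∀ η : EuclideanSpace ℝ (Fin N) → ℝ, ContDiff ℝ ∞ η → HasCompactSupport η →
      ((∫ x, ⟪Du x, ∇ η x⟫) + (∫ x, u x * η x)
          + (∫ x, K x * φ x * (|u x| ^ (q - 2) * u x) * η x)
        = ∫ x, rieszPotential α (fun y => |u y| ^ p) x * (|u x| ^ (p - 2) * u x) * η x) ∧
      (∫ x, ⟪Dφ x, ∇ η x⟫) = ∫ x, K x * |u x| ^ q * η x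

/-- The regularity class for the pair `(u, φ)`: `u ∈ H¹ ∩ L^{2Np/(N+α)}`, `φ ∈ H¹`,
`K |u|^q ∈ L^{2N/(N+2)}`, and `∇u ∈ H¹_loc ∩ L^{2Np/(N+α)}_loc` (so `u ∈ W^{2,2}_loc`). -/
def IsRegular {N : ℕ} (α p q : ℝ) (K u φ : EuclideanSpace ℝ (Fin N) → ℝ) : Prop :=
  MemH1 u ∧ MemLp u (ENNReal.ofReal (2 * N * p / (N + α))) ∧ MemH1 φ ∧
  MemLp (fun x => K x * |u x| ^ q) (ENNReal.ofReal (2 * N / (N + 2))) ∧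
  ∃ Du : EuclideanSpace ℝ (Fin N) → EuclideanSpace ℝ (Fin N), HasWeakGradient u Du ∧
    (∀ i, MemH1Loc (fun x => Du x i)) ∧
    MemLpLoc Du (ENNReal.ofReal (2 * N * p / (N + α)))

end

end ChoquardSP

/-! Write `A = ∫ |∇u|²`, `B = ∫ u²`, `P = ∫ |∇φ|²` and `D = ∫ (I_α * |u|^p) |u|^p`. Testing the
Poisson equation with `φ` gives `∫ K φ |u|^q = P`, and testing the first equation with `u` then
gives the Nehari identity `A + B + P = D`. Dilations give a Pohozaev inequality comparing `(N +
α)/(2p) D` with `N/2 B + (N - 2)/2 A + (N + 2 - 2γ)/(2q) P`; its direction is decided by the sign of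
`x · ∇K + γ K`. Eliminating `D` leaves a combination of `A`, `B`, `P` whose coefficients all have
the same sign, with that of `B` (case i) or of `A` (case ii) at least one in absolute value. So `u =
0`, hence `P = 0` and `φ = 0`.

The Pohozaev inequality is not obtained by multiplying with `x · ∇u`, but from finite dilations. The
first equation is tested with `χ(x) (u(tx) - u(x))` for a cutoff `χ`, and convexity of `|s|^q` and
of squares bounds the resulting terms by differences of energies. The hypothesis on `K` enters only
as `K(x) ≤ t^γ K(tx)`, valid for `t ≥ 1` or for `t ≤ 1`. Convexity may be multiplied by `K φ χ`
because `φ ≥ 0`, which is a maximum principle for finite energy supersolutions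
(`IsDistribSol.nonneg`). The remaining integral of `χ φ K(tx) |u(tx)|^q` is, after rescaling, the
Poisson equation tested with a dilate of `χ φ`, and Cauchy's inequality bounds it by integrals of
`φ` and `∇φ` alone (`coupling_dilate_le`). What results is a function of `t`, the `gap`, which
vanishes at `t = 1` and is nonnegative on one side of it, so its derivative at `1` has a sign.
Letting the cutoffs tend to one yields the inequality (`pohozaev_le`, `le_pohozaev`).

The nonlocal term contributes `∫ (I_α * F) χ x · ∇F` with `F = |u|^p`, up to the factor `1/p`.
Regularising the kernel, integrating by parts and symmetrising in the two variables gives the limit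
`-(N + α)/2 D` (`tendsto_integral_rieszPotential_dilation`). Absolute convergence rests on the
diagonal Hardy–Littlewood–Sobolev inequality, proved by splitting the kernel at a radius depending
on the height of the function. Tests with unbounded Sobolev functions are reached by mollification
and smooth truncation (`test_bdd`, `test_le`, `test_nonneg`). -/

namespace ChoquardSP

open Filter Topology Function
open scoped Pointwise

/-- Euclidean space `ℝᴺ`. -/
abbrev Space (N : ℕ) := EuclideanSpace ℝ (Fin N)

/-! ### Calculus of classical gradients. -/

section Gradient

variable {N : ℕ}

theorem gradient_eq_comp (η : Space N → ℝ) :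
    ∇ η = fun x => (InnerProductSpace.toDual ℝ (Space N)).symm (fderiv ℝ η x) := rfl

theorem ContDiff.gradient_space {η : Space N → ℝ} (hη : ContDiff ℝ ∞ η) : ContDiff ℝ ∞ (∇ η) := by
  rw [gradient_eq_comp]
  exact (InnerProductSpace.toDual ℝ (Space N)).symm.contDiff.comp
    (hη.fderiv_right (m := ∞) (by simp))

theorem ContDiff.continuous_gradient {η : Space N → ℝ} (hη : ContDiff ℝ 1 η) :
    Continuous (∇ η) := by
  rw [gradient_eq_comp]
  exact (InnerProductSpace.toDual ℝ (Space N)).symm.continuous.comp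
    (hη.continuous_fderiv one_ne_zero)

theorem HasCompactSupport.gradient {η : Space N → ℝ} (hη : HasCompactSupport η) :
    HasCompactSupport (∇ η) := by
  rw [gradient_eq_comp]
  exact (hη.fderiv ℝ).comp_left (g := (InnerProductSpace.toDual ℝ (Space N)).symm) (map_zero _)

theorem inner_gradient (η : Space N → ℝ) (x v : Space N) : ⟪v, ∇ η x⟫ = fderiv ℝ η x v := by
  rw [real_inner_comm]; exact inner_gradient_left

theorem gradient_mul {η χ : Space N → ℝ} {x : Space N} (hη : DifferentiableAt ℝ η x)
    (hχ : DifferentiableAt ℝ χ x) :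
    ∇ (fun y => χ y * η y) x = χ x • ∇ η x + η x • ∇ χ x := by
  refine ext_inner_left ℝ fun v => ?_
  rw [inner_gradient, inner_add_right, inner_smul_right, inner_smul_right, inner_gradient,
    inner_gradient, fderiv_fun_mul hχ hη]
  simp

theorem gradient_comp_smul (η : Space N → ℝ) (t : ℝ) (x : Space N) :
    ∇ (fun y => η (t • y)) x = t • ∇ η (t • x) := by
  refine ext_inner_left ℝ fun v => ?_
  rw [inner_gradient, inner_smul_right, inner_gradient]
  rw [fderiv_comp_smul]; simp

theorem tsupport_comp_smul_isCompact {F : Type*} [Zero F] {g : Space N → F}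
    (hg : HasCompactSupport g) {t : ℝ} (ht : t ≠ 0) : HasCompactSupport (fun x => g (t • x)) :=
  hg.comp_homeomorph (Homeomorph.smulOfNeZero t ht)

end Gradient

/-! ### Weak gradients: uniqueness, products, dilations and limits. -/

section WeakGradient

variable {N : ℕ} {f g : Space N → ℝ} {G H : Space N → Space N}

theorem LocallyIntegrable.test_smul {F : Type*} [NormedAddCommGroup F] [NormedSpace ℝ F]
    {w : Space N → F} (hw : LocallyIntegrable w) {η : Space N → ℝ} (hη : Continuous η)
    (hc : HasCompactSupport η) : Integrable (fun x => η x • w x) :=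
  hw.integrable_smul_left_of_hasCompactSupport hη hc

theorem LocallyIntegrable.smul_test {F : Type*} [NormedAddCommGroup F] [NormedSpace ℝ F]
    {w : Space N → ℝ} (hw : LocallyIntegrable w) {η : Space N → F} (hη : Continuous η)
    (hc : HasCompactSupport η) : Integrable (fun x => w x • η x) :=
  hw.integrable_smul_right_of_hasCompactSupport hη hc

theorem LocallyIntegrable.congr_ae {F : Type*} [NormedAddCommGroup F] {v w : Space N → F}
    (hv : LocallyIntegrable v) (h : v =ᵐ[volume] w) : LocallyIntegrable w :=
  hv.congr h

theorem HasWeakGradient.congr (hf : HasWeakGradient f G) (h1 : f =ᵐ[volume] g)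
    (h2 : G =ᵐ[volume] H) : HasWeakGradient g H := by
  refine ⟨LocallyIntegrable.congr_ae hf.1 h1, LocallyIntegrable.congr_ae hf.2.1 h2, fun η hη hc => ?_⟩
  have e1 : ∫ x, f x • ∇ η x = ∫ x, g x • ∇ η x :=
    integral_congr_ae (h1.mono fun x hx => by simp only [hx])
  have e2 : ∫ x, η x • G x = ∫ x, η x • H x :=
    integral_congr_ae (h2.mono fun x hx => by simp only [hx])
  rw [← e1, ← e2]
  exact hf.2.2 η hη hc

theorem HasWeakGradient.unique (hf : HasWeakGradient f G) (hg : HasWeakGradient f H) :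
    G =ᵐ[volume] H := by
  refine ae_eq_of_integral_contDiff_smul_eq hf.2.1 hg.2.1 fun η hη hc => ?_
  have := (hf.2.2 η hη hc).symm.trans (hg.2.2 η hη hc)
  exact neg_injective this

theorem HasWeakGradient.const_mul (hf : HasWeakGradient f G) (c : ℝ) :
    HasWeakGradient (fun x => c * f x) (fun x => c • G x) := by
  refine ⟨hf.1.smul c, hf.2.1.smul c, fun η hη hc => ?_⟩
  have h := hf.2.2 η hη hc
  simp only [mul_smul, smul_comm _ c]
  rw [integral_smul, integral_smul, h, smul_neg]

theorem HasWeakGradient.add (hf : HasWeakGradient f G) (hg : HasWeakGradient g H) :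
    HasWeakGradient (fun x => f x + g x) (fun x => G x + H x) := by
  refine ⟨hf.1.add hg.1, hf.2.1.add hg.2.1, fun η hη hc => ?_⟩
  have hη' := (ContDiff.gradient_space hη).continuous
  have hc' := HasCompactSupport.gradient hc
  simp only [add_smul, smul_add]
  rw [integral_add (LocallyIntegrable.smul_test hf.1 hη' hc') (LocallyIntegrable.smul_test hg.1 hη' hc'),
    integral_add (LocallyIntegrable.test_smul hf.2.1 hη.continuous hc)
      (LocallyIntegrable.test_smul hg.2.1 hη.continuous hc), hf.2.2 η hη hc, hg.2.2 η hη hc]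
  abel

theorem HasWeakGradient.sub (hf : HasWeakGradient f G) (hg : HasWeakGradient g H) :
    HasWeakGradient (fun x => f x - g x) (fun x => G x - H x) := by
  have := hf.add (hg.const_mul (-1))
  simpa [sub_eq_add_neg] using this

theorem HasWeakGradient.mul_smooth (hf : HasWeakGradient f G) {χ : Space N → ℝ}
    (hχ : ContDiff ℝ ∞ χ) :
    HasWeakGradient (fun x => χ x * f x) (fun x => χ x • G x + f x • ∇ χ x) := by
  have hχ' := (ContDiff.gradient_space hχ).continuous
  have l1 : LocallyIntegrable (fun x => χ x * f x) := by
    refine (locallyIntegrableOn_univ.1 ((locallyIntegrableOn_univ.2 hf.1).continuousOn_smul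
      isOpen_univ.isLocallyClosed hχ.continuous.continuousOn))
  have l2 : LocallyIntegrable (fun x => χ x • G x) := by
    refine (locallyIntegrableOn_univ.1 ((locallyIntegrableOn_univ.2 hf.2.1).continuousOn_smul
      isOpen_univ.isLocallyClosed hχ.continuous.continuousOn))
  have l3 : LocallyIntegrable (fun x => f x • ∇ χ x) := by
    refine (locallyIntegrableOn_univ.1 ((locallyIntegrableOn_univ.2 hf.1).smul_continuousOn
      isOpen_univ.isLocallyClosed hχ'.continuousOn))
  refine ⟨l1, l2.add l3, fun η hη hc => ?_⟩
  have hη' := (ContDiff.gradient_space hη).continuous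
  have key := hf.2.2 (fun x => χ x * η x) (hχ.mul hη) hc.mul_left
  have e : ∀ x, f x • ∇ (fun y => χ y * η y) x = (χ x * f x) • ∇ η x + η x • (f x • ∇ χ x) := by
    intro x
    rw [gradient_mul (hη.differentiable (by simp) x) (hχ.differentiable (by simp) x), smul_add,
      smul_smul, smul_smul, smul_smul, mul_comm (f x), mul_comm (f x)]
  simp only [e] at key
  rw [integral_add (LocallyIntegrable.smul_test l1 hη' (HasCompactSupport.gradient hc))
    (LocallyIntegrable.test_smul l3 hη.continuous hc)] at key
  simp only [smul_add]
  rw [integral_add (LocallyIntegrable.test_smul l2 hη.continuous hc)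
    (LocallyIntegrable.test_smul l3 hη.continuous hc)]
  rw [eq_sub_of_add_eq key]
  simp only [mul_smul, smul_comm (χ _) (η _)]
  abel

theorem LocallyIntegrable.comp_smul_space {F : Type*} [NormedAddCommGroup F] {w : Space N → F}
    (hw : LocallyIntegrable w) {t : ℝ} (ht : t ≠ 0) : LocallyIntegrable (fun x => w (t • x)) := by
  rw [locallyIntegrable_iff] at hw ⊢
  intro k hk
  have h1 := hw (t • k) (hk.smul t)
  have hm : MeasurableSet k := hk.measurableSet
  rw [← integrable_indicator_iff hm]
  rw [← integrable_indicator_iff (hk.smul t).measurableSet] at h1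
  refine (h1.comp_smul ht).congr (Eventually.of_forall fun x => ?_)
  by_cases hx : x ∈ k
  · have : t • x ∈ t • k := Set.smul_mem_smul_set hx
    simp [hx, this]
  · have : t • x ∉ t • k := fun h => hx ((Set.smul_mem_smul_set_iff₀ ht _ _).1 h)
    simp [hx, this]

theorem integral_comp_smul_space {F : Type*} [NormedAddCommGroup F] [NormedSpace ℝ F]
    (w : Space N → F) {t : ℝ} (ht : 0 < t) :
    ∫ x, w (t • x) = (t ^ N)⁻¹ • ∫ x, w x := by
  rw [Measure.integral_comp_smul_of_nonneg _ _ _ (hR := ht.le)]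
  simp

theorem HasWeakGradient.comp_smul (hf : HasWeakGradient f G) {t : ℝ} (ht : 0 < t) :
    HasWeakGradient (fun x => f (t • x)) (fun x => t • G (t • x)) := by
  refine ⟨LocallyIntegrable.comp_smul_space hf.1 ht.ne',
    (LocallyIntegrable.comp_smul_space hf.2.1 ht.ne').smul t, fun η hη hc => ?_⟩
  -- The dilation is moved onto the test function; rescaling both integrals produces the same
  -- Jacobian on each side.
  have h := hf.2.2 (fun x => η (t⁻¹ • x)) (hη.comp (contDiff_const_smul _))
    (tsupport_comp_smul_isCompact hc (inv_ne_zero ht.ne'))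
  simp only [gradient_comp_smul] at h
  have e1 := integral_comp_smul_space (fun x => f x • t⁻¹ • ∇ η (t⁻¹ • x)) ht
  have e2 := integral_comp_smul_space (fun x => η (t⁻¹ • x) • G x) ht
  simp only [smul_smul, inv_mul_cancel₀ ht.ne', one_smul] at e1 e2 h
  rw [h, smul_neg, ← e2] at e1
  have e3 : ∀ x, f (t • x) • ∇ η x = t • ((f (t • x) * t⁻¹) • ∇ η x) := by
    intro x; rw [smul_smul]; congr 1; field_simp
  have e4 : ∀ x, η x • t • G (t • x) = t • (η x • G (t • x)) := fun x => smul_comm _ _ _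
  simp only [e3, e4]
  rw [integral_smul, integral_smul, e1, smul_neg]

/-- Weak gradients pass to dominated almost everywhere limits. -/
theorem HasWeakGradient.of_tendsto {fn : ℕ → Space N → ℝ} {Gn : ℕ → Space N → Space N}
    (hn : ∀ n, HasWeakGradient (fn n) (Gn n)) {b c : Space N → ℝ} (hb : LocallyIntegrable b)
    (hc : LocallyIntegrable c) (hfb : ∀ n, ∀ᵐ x, ‖fn n x‖ ≤ b x) (hGc : ∀ n, ∀ᵐ x, ‖Gn n x‖ ≤ c x)
    (hf : ∀ᵐ x, Tendsto (fun n => fn n x) atTop (𝓝 (f x)))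
    (hG : ∀ᵐ x, Tendsto (fun n => Gn n x) atTop (𝓝 (G x))) : HasWeakGradient f G := by
  have mf : AEStronglyMeasurable f :=
    aestronglyMeasurable_of_tendsto_ae atTop (fun n => (hn n).1.aestronglyMeasurable) hf
  have mG : AEStronglyMeasurable G :=
    aestronglyMeasurable_of_tendsto_ae atTop (fun n => (hn n).2.1.aestronglyMeasurable) hG
  have bf : ∀ᵐ x, ‖f x‖ ≤ ‖b x‖ := by
    filter_upwards [ae_all_iff.2 hfb, hf] with x h1 h2
    exact (le_of_tendsto' h2.norm h1).trans (le_abs_self _)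
  have bG : ∀ᵐ x, ‖G x‖ ≤ ‖c x‖ := by
    filter_upwards [ae_all_iff.2 hGc, hG] with x h1 h2
    exact (le_of_tendsto' h2.norm h1).trans (le_abs_self _)
  refine ⟨hb.mono mf bf, hc.mono mG bG, fun η hη hcη => ?_⟩
  have hη' := (ContDiff.gradient_space hη).continuous
  have hc' := HasCompactSupport.gradient hcη
  have t1 : Tendsto (fun n => ∫ x, fn n x • ∇ η x) atTop (𝓝 (∫ x, f x • ∇ η x)) := by
    refine tendsto_integral_of_dominated_convergence (fun x => ‖b x • ∇ η x‖)
      (fun n => (LocallyIntegrable.smul_test (hn n).1 hη' hc').aestronglyMeasurable)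
      (LocallyIntegrable.smul_test hb hη' hc').norm (fun n => ?_) ?_
    · filter_upwards [hfb n] with x hx
      rw [norm_smul, norm_smul]
      exact mul_le_mul_of_nonneg_right (hx.trans (le_abs_self _)) (norm_nonneg _)
    · filter_upwards [hf] with x hx using hx.smul_const _
  have t2 : Tendsto (fun n => ∫ x, η x • Gn n x) atTop (𝓝 (∫ x, η x • G x)) := by
    refine tendsto_integral_of_dominated_convergence (fun x => ‖η x • c x‖)
      (fun n => (LocallyIntegrable.test_smul (hn n).2.1 hη.continuous hcη).aestronglyMeasurable)
      (LocallyIntegrable.test_smul hc hη.continuous hcη).norm (fun n => ?_) ?_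
    · filter_upwards [hGc n] with x hx
      rw [norm_smul, norm_smul]
      exact mul_le_mul_of_nonneg_left (hx.trans (le_abs_self _)) (norm_nonneg _)
    · filter_upwards [hG] with x hx using hx.const_smul _
  refine tendsto_nhds_unique t1 (t2.neg.congr fun n => ?_)
  exact ((hn n).2.2 η hη hcη).symm

end WeakGradient

/-! ### Mollification in `L^p` and its commutation with weak gradients. -/

section Mollifier

set_option linter.unusedSectionVars false

variable {N : ℕ} {F : Type*} [NormedAddCommGroup F] [NormedSpace ℝ F] [CompleteSpace F]

/-- A shrinking sequence of smooth bumps at the origin. -/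
noncomputable def mollBump (N n : ℕ) : ContDiffBump (0 : Space N) where
  rIn := ((n : ℝ) + 2)⁻¹
  rOut := 2 * ((n : ℝ) + 2)⁻¹
  rIn_pos := by positivity
  rIn_lt_rOut := by
    have : 0 < ((n : ℝ) + 2)⁻¹ := by positivity
    linarith

/-- Mollification. -/
noncomputable def moll (n : ℕ) (g : Space N → F) : Space N → F :=
  convolution ((mollBump N n).normed volume) g (ContinuousLinearMap.lsmul ℝ ℝ) volume

theorem mollBump_rOut_le (n : ℕ) : (mollBump N n).rOut ≤ 1 := by
  have : ((n : ℝ) + 2)⁻¹ ≤ 2⁻¹ := by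
    apply inv_anti₀ <;> linarith [(Nat.cast_nonneg n : (0 : ℝ) ≤ n)]
  change 2 * ((n : ℝ) + 2)⁻¹ ≤ 1
  linarith

theorem tendsto_mollBump_rOut : Tendsto (fun n => (mollBump N n).rOut) atTop (𝓝 0) := by
  have h : Tendsto (fun n : ℕ => 2 * ((n : ℝ) + 2)⁻¹) atTop (𝓝 (2 * 0)) := by
    refine Tendsto.const_mul _ (tendsto_inv_atTop_zero.comp ?_)
    exact tendsto_atTop_add_const_right _ _ tendsto_natCast_atTop_atTop
  rw [mul_zero] at h
  exact h

theorem moll_apply (n : ℕ) (g : Space N → F) (x : Space N) :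
    moll n g x = ∫ y, (mollBump N n).normed volume y • g (x - y) := rfl

theorem moll_apply' (n : ℕ) (g : Space N → F) (x : Space N) :
    moll n g x = ∫ y, (mollBump N n).normed volume (x - y) • g y := by
  rw [moll, convolution_eq_swap]; rfl

theorem contDiff_moll (n : ℕ) {g : Space N → F} (hg : LocallyIntegrable g) :
    ContDiff ℝ ∞ (moll n g) :=
  HasCompactSupport.contDiff_convolution_left _ (ContDiffBump.hasCompactSupport_normed _)
    (ContDiffBump.contDiff_normed _) hg

theorem convolutionExists_moll (n : ℕ) {g : Space N → F} (hg : LocallyIntegrable g) :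
    ConvolutionExists ((mollBump N n).normed volume) g (ContinuousLinearMap.lsmul ℝ ℝ) volume :=
  HasCompactSupport.convolutionExists_left _ (ContDiffBump.hasCompactSupport_normed _)
    (ContDiffBump.contDiff_normed (n := 0) _).continuous hg

theorem integrable_moll_aux (n : ℕ) {g : Space N → F} (hg : LocallyIntegrable g) (x : Space N) :
    Integrable fun y => (mollBump N n).normed volume y • g (x - y) :=
  convolutionExists_moll n hg x

theorem moll_sub (n : ℕ) {g h : Space N → F} (hg : LocallyIntegrable g) (hh : LocallyIntegrable h) :
    moll n (g - h) = moll n g - moll n h := by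
  funext x
  simp only [moll_apply, Pi.sub_apply, smul_sub]
  exact integral_sub (integrable_moll_aux n hg x) (integrable_moll_aux n hh x)

theorem ae_tendsto_moll {g : Space N → F} (hg : LocallyIntegrable g) :
    ∀ᵐ x, Tendsto (fun n => moll n g x) atTop (𝓝 (g x)) :=
  ContDiffBump.ae_convolution_tendsto_right_of_locallyIntegrable (K := 2) tendsto_mollBump_rOut
    (Eventually.of_forall fun _ => le_rfl) hg

theorem norm_moll_le (n : ℕ) {g : Space N → F} {M : ℝ} (hM : ∀ x, ‖g x‖ ≤ M) (x : Space N) :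
    ‖moll n g x‖ ≤ M := by
  rw [moll_apply]
  have hi : Integrable ((mollBump N n).normed (volume : Measure (Space N))) :=
    (ContDiffBump.contDiff_normed (n := 0) _).continuous.integrable_of_hasCompactSupport
      (ContDiffBump.hasCompactSupport_normed _)
  calc _ ≤ ∫ y, (mollBump N n).normed volume y * M := by
        refine norm_integral_le_of_norm_le (hi.mul_const M) (Eventually.of_forall fun y => ?_)
        rw [norm_smul, Real.norm_of_nonneg (ContDiffBump.nonneg_normed _ _)]
        exact mul_le_mul_of_nonneg_left (hM _) (ContDiffBump.nonneg_normed _ _)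
    _ = M := by
        rw [integral_mul_const, ContDiffBump.integral_normed, one_mul]

/-- All bumps have outer radius at most one, so supports grow by at most one, uniformly in `n`. This
keeps a whole sequence of mollified test functions inside one compact set. -/
theorem moll_eq_zero (n : ℕ) {g : Space N → F} {S : Set (Space N)}
    (hS : ∀ x, x ∉ S → g x = 0) {x : Space N} (hx : x ∉ Metric.cthickening 1 S) :
    moll n g x = 0 := by
  rw [moll_apply']
  refine integral_eq_zero_of_ae (Eventually.of_forall fun y => ?_)
  by_cases hy : y ∈ S
  · have : (mollBump N n).normed volume (x - y) = 0 := by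
      rw [← notMem_support, ContDiffBump.support_normed_eq]
      intro h
      apply hx
      refine Metric.mem_cthickening_of_dist_le x y 1 S hy ?_
      rw [Metric.mem_ball, dist_zero_right, ← dist_eq_norm] at h
      exact h.le.trans (mollBump_rOut_le n)
    simp [this]
  · simp [hS y hy]

/-- Locality of mollification: it allows a locally integrable function to be cut off to a compact
set without changing the mollifications on `S`. -/
theorem moll_congr (n : ℕ) {g h : Space N → F} {S : Set (Space N)}
    (hS : ∀ x, x ∈ Metric.cthickening 1 S → g x = h x) {x : Space N} (hx : x ∈ S) :
    moll n g x = moll n h x := by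
  rw [moll_apply', moll_apply']
  refine integral_congr_ae (Eventually.of_forall fun y => ?_)
  by_cases hy : y ∈ Metric.cthickening 1 S
  · simp only [hS y hy]
  · have : (mollBump N n).normed volume (x - y) = 0 := by
      rw [← notMem_support, ContDiffBump.support_normed_eq]
      intro h
      apply hy
      refine Metric.mem_cthickening_of_dist_le y x 1 S hx ?_
      rw [Metric.mem_ball, dist_zero_right, ← dist_eq_norm, dist_comm] at h
      exact h.le.trans (mollBump_rOut_le n)
    simp [this]

/-- The normalised bump is the density of a probability measure. Monotonicity of `L^p` norms under
that measure (Jensen) gives a pointwise bound, and Tonelli with translation invariance integrates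
it. -/
theorem eLpNorm_moll_le (n : ℕ) {g : Space N → F} {p : ℝ≥0∞} (hp1 : 1 ≤ p) (hp : p ≠ ⊤)
    (hg : AEStronglyMeasurable g) : eLpNorm (moll n g) p ≤ eLpNorm g p := by
  set ρ := (mollBump N n).normed (volume : Measure (Space N)) with hρ
  have hρc : Continuous ρ := (ContDiffBump.contDiff_normed (n := 0) _).continuous
  have hρ0 : ∀ y, 0 ≤ ρ y := ContDiffBump.nonneg_normed _
  have hρi : Integrable ρ :=
    hρc.integrable_of_hasCompactSupport (ContDiffBump.hasCompactSupport_normed _)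
  have hρm : Measurable fun y => ENNReal.ofReal (ρ y) := hρc.measurable.ennreal_ofReal
  set μ : Measure (Space N) := volume.withDensity fun y => ENNReal.ofReal (ρ y) with hμ
  have hprob : IsProbabilityMeasure μ := by
    refine ⟨?_⟩
    rw [hμ, withDensity_apply _ MeasurableSet.univ, Measure.restrict_univ,
      ← ofReal_integral_eq_lintegral_ofReal hρi (Eventually.of_forall hρ0),
      ContDiffBump.integral_normed, ENNReal.ofReal_one]
  have hp0 : p ≠ 0 := (zero_lt_one.trans_le hp1).ne'
  have hpt : 0 < p.toReal := ENNReal.toReal_pos hp0 hp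
  have hgm : AEStronglyMeasurable (fun z : Space N × Space N => g (z.1 - z.2)) (volume.prod μ) :=
    hg.comp_quasiMeasurePreserving (quasiMeasurePreserving_sub_of_right_invariant volume μ)
  have hpt1 : ∀ᵐ x : Space N, ‖moll n g x‖ₑ ^ p.toReal ≤ ∫⁻ y, ‖g (x - y)‖ₑ ^ p.toReal ∂μ := by
    filter_upwards [hgm.prodMk_left] with x hx
    have e1 : moll n g x = ∫ y, g (x - y) ∂μ := by
      rw [hμ, integral_withDensity_eq_integral_toReal_smul hρm
        (Eventually.of_forall fun _ => ENNReal.ofReal_lt_top), moll_apply]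
      simp only [ENNReal.toReal_ofReal (hρ0 _)]
      rfl
    have e2 : ‖moll n g x‖ₑ ≤ eLpNorm (fun y => g (x - y)) p μ := by
      rw [e1]
      refine (enorm_integral_le_lintegral_enorm _).trans ?_
      rw [← eLpNorm_one_eq_lintegral_enorm]
      exact eLpNorm_le_eLpNorm_of_exponent_le hp1 hx
    rw [eLpNorm_eq_lintegral_rpow_enorm_toReal hp0 hp] at e2
    have e3 := ENNReal.rpow_le_rpow e2 hpt.le
    rwa [← ENNReal.rpow_mul, one_div, inv_mul_cancel₀ hpt.ne', ENNReal.rpow_one] at e3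
  rw [eLpNorm_eq_lintegral_rpow_enorm_toReal hp0 hp, eLpNorm_eq_lintegral_rpow_enorm_toReal hp0 hp]
  refine ENNReal.rpow_le_rpow ?_ (by positivity)
  calc ∫⁻ x, ‖moll n g x‖ₑ ^ p.toReal ≤ ∫⁻ x, ∫⁻ y, ‖g (x - y)‖ₑ ^ p.toReal ∂μ :=
        lintegral_mono_ae hpt1
    _ = ∫⁻ y, (∫⁻ x, ‖g (x - y)‖ₑ ^ p.toReal) ∂μ := by
        refine lintegral_lintegral_swap ?_
        exact hgm.enorm.pow_const _
    _ = ∫⁻ _y, (∫⁻ x, ‖g x‖ₑ ^ p.toReal) ∂μ := by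
        refine lintegral_congr fun y => ?_
        exact lintegral_sub_right_eq_self (fun x => ‖g x‖ₑ ^ p.toReal) y
    _ = ∫⁻ x, ‖g x‖ₑ ^ p.toReal := by simp

/-- Uniform continuity makes the difference uniformly small, and a common compact support turns this
into smallness in `L^p`. -/
theorem tendsto_moll_of_continuous {g : Space N → F} (hg : Continuous g)
    (hc : HasCompactSupport g) {p : ℝ≥0∞} (hp1 : 1 ≤ p) (hp : p ≠ ⊤) :
    Tendsto (fun n => eLpNorm (moll n g - g) p) atTop (𝓝 0) := by
  set S := Metric.cthickening 1 (tsupport g) with hS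
  have hSc : IsCompact S := IsCompact.cthickening hc
  have hsub : tsupport g ⊆ S := Metric.self_subset_cthickening _
  have hvS : volume S ≠ ⊤ := hSc.measure_lt_top.ne
  have hpt : 0 < p.toReal := ENNReal.toReal_pos (zero_lt_one.trans_le hp1).ne' hp
  have hu := hc.uniformContinuous_of_continuous hg
  have hli : LocallyIntegrable g := hg.locallyIntegrable
  have bound : ∀ δ : ℝ, 0 < δ → ∀ᶠ n in atTop,
      eLpNorm (moll n g - g) p ≤ ENNReal.ofReal δ * volume S ^ (1 / p.toReal) := by
    intro δ hδ
    obtain ⟨r, hr, hr'⟩ := Metric.uniformContinuous_iff.1 hu δ hδ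
    filter_upwards [tendsto_mollBump_rOut.eventually (gt_mem_nhds hr)] with n hn
    refine eLpNorm_sub_le_of_dist_bdd volume hp hSc.measurableSet hδ.le (fun x => ?_) ?_ ?_
    · refine ContDiffBump.dist_normed_convolution_le hg.aestronglyMeasurable fun y hy => ?_
      exact (hr' ((Metric.mem_ball.1 hy).trans hn)).le
    · intro x hx
      by_contra hxS
      exact hx (moll_eq_zero n (S := tsupport g) (fun y hy => image_eq_zero_of_notMem_tsupport hy) hxS)
    · exact (subset_tsupport g).trans hsub
  have hfin : volume S ^ (1 / p.toReal) ≠ ⊤ := ENNReal.rpow_ne_top_of_nonneg (by positivity) hvS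
  rw [ENNReal.tendsto_nhds_zero]
  intro ε hε
  rcases eq_or_ne (volume S ^ (1 / p.toReal)) 0 with h0 | h0
  · filter_upwards [bound 1 one_pos] with n hn
    rw [h0, mul_zero] at hn
    exact hn.trans hε.le
  rcases eq_or_ne ε ⊤ with rfl | hε'
  · exact Eventually.of_forall fun _ => le_top
  have hq : 0 < (ε / volume S ^ (1 / p.toReal)).toReal :=
    ENNReal.toReal_pos (ENNReal.div_pos hε.ne' hfin).ne' (ENNReal.div_ne_top hε' h0)
  filter_upwards [bound _ hq] with n hn
  rwa [ENNReal.ofReal_toReal (ENNReal.div_ne_top hε' h0), ENNReal.div_mul_cancel h0 hfin] at hn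

/-- An `ε/3` argument: smooth compactly supported functions are dense, and mollification is an `L^p`
contraction. -/
theorem tendsto_eLpNorm_moll {g : Space N → F} {p : ℝ≥0∞} (hp1 : 1 ≤ p) (hp : p ≠ ⊤)
    (hg : MemLp g p) : Tendsto (fun n => eLpNorm (moll n g - g) p) atTop (𝓝 0) := by
  have hli := hg.locallyIntegrable hp1
  rw [ENNReal.tendsto_nhds_zero]
  intro ε hε
  rcases eq_or_ne ε ⊤ with rfl | hε'
  · exact Eventually.of_forall fun _ => le_top
  have h3 : 0 < (ε / 3).toReal :=
    ENNReal.toReal_pos (ENNReal.div_pos hε.ne' (by simp)).ne' (ENNReal.div_ne_top hε' (by simp))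
  obtain ⟨g', hc', hs', hgg'⟩ := hg.exist_eLpNorm_sub_le hp hp1 h3
  rw [ENNReal.ofReal_toReal (ENNReal.div_ne_top hε' (by simp))] at hgg'
  have hli' : LocallyIntegrable g' := hs'.continuous.locallyIntegrable
  have ht := tendsto_moll_of_continuous hs'.continuous hc' hp1 hp
  filter_upwards [(ENNReal.tendsto_nhds_zero.1 ht) (ε / 3) (ENNReal.div_pos hε.ne' (by simp))]
    with n hn
  have e : moll n g - g = moll n (g - g') + (moll n g' - g') - (g - g') := by
    rw [moll_sub n hli hli']
    funext x
    simp only [Pi.add_apply, Pi.sub_apply]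
    abel
  have m1 : AEStronglyMeasurable (moll n (g - g')) :=
    (contDiff_moll n (hli.sub hli')).continuous.aestronglyMeasurable
  have m2 : AEStronglyMeasurable (moll n g' - g') :=
    ((contDiff_moll n hli').continuous.sub hs'.continuous).aestronglyMeasurable
  have m3 : AEStronglyMeasurable (g - g') := hg.1.sub hs'.continuous.aestronglyMeasurable
  rw [e]
  have b1 := (eLpNorm_moll_le n hp1 hp m3).trans hgg'
  have b2 := eLpNorm_sub_le (m1.add m2) m3 hp1
  have b3 := eLpNorm_add_le m1 m2 hp1
  refine b2.trans ?_
  rw [← ENNReal.add_thirds ε]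
  exact add_le_add (b3.trans (add_le_add b1 hn)) hgg'

/-- The derivative of the convolution falls on the bump. As a function of `y`, `ρ(x - y)` is itself
a test function, and its gradient carries a minus sign that cancels the one in the definition of the
weak gradient. -/
theorem HasWeakGradient.gradient_moll {f : Space N → ℝ} {G : Space N → Space N}
    (hf : HasWeakGradient f G) (n : ℕ) (x : Space N) : ∇ (moll n f) x = moll n G x := by
  set ρ := (mollBump N n).normed (volume : Measure (Space N)) with hρ
  have hρs : ContDiff ℝ ∞ ρ := ContDiffBump.contDiff_normed _
  have hρc : HasCompactSupport ρ := ContDiffBump.hasCompactSupport_normed _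
  have hd := HasCompactSupport.hasFDerivAt_convolution_left (ContinuousLinearMap.lsmul ℝ ℝ)
    (𝕜 := ℝ) hρc (hρs.of_le (by simp)) hf.1 x
  have hρx : ContDiff ℝ ∞ fun y => ρ (x - y) := hρs.comp (contDiff_const.sub contDiff_id)
  have hcx : HasCompactSupport fun y => ρ (x - y) :=
    hρc.comp_homeomorph (Homeomorph.subLeft x)
  have hgr : ∀ y, ∇ (fun y => ρ (x - y)) y = -∇ ρ (x - y) := by
    intro y
    refine ext_inner_left ℝ fun v => ?_
    rw [inner_gradient, inner_neg_right, inner_gradient]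
    have h1 : HasFDerivAt (fun y => ρ (x - y)) ((fderiv ℝ ρ (x - y)).comp
        (-ContinuousLinearMap.id ℝ (Space N))) y :=
      ((hρs.differentiable (by simp)) (x - y)).hasFDerivAt.comp y
        ((hasFDerivAt_id y).const_sub x)
    rw [h1.fderiv]; simp
  have hkey := hf.2.2 _ hρx hcx
  simp only [hgr, smul_neg, integral_neg, neg_inj] at hkey
  rw [moll_apply', ← hkey]
  refine ext_inner_left ℝ fun v => ?_
  rw [inner_gradient]
  have hint : Integrable fun y => f y • ∇ ρ (x - y) := by
    have := LocallyIntegrable.smul_test hf.1 (ContDiff.gradient_space hρx).continuous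
      (HasCompactSupport.gradient hcx)
    simp only [hgr, smul_neg] at this
    simpa using this.neg
  rw [← integral_inner hint]
  change fderiv ℝ (convolution ρ f (ContinuousLinearMap.lsmul ℝ ℝ) volume) x v = _
  rw [hd.fderiv, convolution_eq_swap, ContinuousLinearMap.integral_apply]
  · refine integral_congr_ae (Eventually.of_forall fun y => ?_)
    simp [inner_smul_right, mul_comm]
  · have := (HasCompactSupport.convolutionExists_left
      (ContinuousLinearMap.precompL (Space N) (ContinuousLinearMap.lsmul ℝ ℝ : ℝ →L[ℝ] ℝ →L[ℝ] ℝ)) (μ := volume)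
      (hρc.fderiv ℝ) (hρs.continuous_fderiv (by simp)) hf.1 x).integrable_swap
    exact this

end Mollifier

/-! ### Hölder pairing of vector valued functions. -/

section InnerL2

variable {X : Type*} [MeasurableSpace X] {μ : Measure X} {V : Type*} [NormedAddCommGroup V]
  [InnerProductSpace ℝ V]

theorem eLpNorm_inner_le {p q : ℝ≥0∞} [ENNReal.HolderTriple p q 1] {a b : X → V}
    (ha : AEStronglyMeasurable a μ) (hb : AEStronglyMeasurable b μ) :
    eLpNorm (fun x => ⟪a x, b x⟫) 1 μ ≤ eLpNorm a p μ * eLpNorm b q μ := by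
  have := eLpNorm_le_eLpNorm_mul_eLpNorm'_of_norm (p := p) (q := q) (r := 1) ha hb
    (fun v w : V => ⟪v, w⟫) 1 (Eventually.of_forall fun x => by
      simpa using norm_inner_le_norm (𝕜 := ℝ) (a x) (b x))
  simpa using this

theorem integrable_inner_of_memLp {p q : ℝ≥0∞} [ENNReal.HolderTriple p q 1] {a b : X → V}
    (ha : MemLp a p μ) (hb : MemLp b q μ) : Integrable (fun x => ⟪a x, b x⟫) μ := by
  rw [← memLp_one_iff_integrable]
  exact ⟨ha.1.inner hb.1, (eLpNorm_inner_le ha.1 hb.1).trans_lt (ENNReal.mul_lt_top ha.2 hb.2)⟩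

theorem tendsto_integral_inner {a b : X → V} {bn : ℕ → X → V} (ha : MemLp a 2 μ)
    (hb : MemLp b 2 μ) (hbn : ∀ n, MemLp (bn n) 2 μ)
    (h : Tendsto (fun n => eLpNorm (bn n - b) 2 μ) atTop (𝓝 0)) :
    Tendsto (fun n => ∫ x, ⟪a x, bn n x⟫ ∂μ) atTop (𝓝 (∫ x, ⟪a x, b x⟫ ∂μ)) := by
  refine tendsto_integral_of_L1' _ (ha.1.inner hb.1)
    (Eventually.of_forall fun n => integrable_inner_of_memLp ha (hbn n)) ?_
  have h2 : Tendsto (fun n => eLpNorm a 2 μ * eLpNorm (bn n - b) 2 μ) atTop (𝓝 0) := by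
    have := ENNReal.Tendsto.const_mul h (Or.inr ha.2.ne)
    simpa using this
  refine tendsto_of_tendsto_of_tendsto_of_le_of_le tendsto_const_nhds h2 (fun _ => zero_le)
    fun n => ?_
  refine le_trans (le_of_eq ?_) (eLpNorm_inner_le (p := 2) (q := 2) ha.1 ((hbn n).1.sub hb.1))
  congr 1
  funext x
  simp [inner_sub_right]

end InnerL2

/-! ### The chain rule for weak gradients. -/

section ChainRule

variable {N : ℕ}

theorem tendsto_eLpNorm_moll_restrict {F : Type*} [NormedAddCommGroup F] [NormedSpace ℝ F]
    [CompleteSpace F] {g : Space N → F} (hg : LocallyIntegrable g) {S : Set (Space N)}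
    (hS : IsCompact S) :
    Tendsto (fun n => eLpNorm (moll n g - g) 1 (volume.restrict S)) atTop (𝓝 0) := by
  set S' := Metric.cthickening 1 S
  have hS' : IsCompact S' := hS.cthickening
  have h1 : MemLp (S'.indicator g) 1 := by
    rw [memLp_one_iff_integrable, integrable_indicator_iff hS'.measurableSet]
    exact hg.integrableOn_isCompact hS'
  refine tendsto_of_tendsto_of_tendsto_of_le_of_le tendsto_const_nhds
    (tendsto_eLpNorm_moll le_rfl (by simp) h1) (fun _ => zero_le) fun n => ?_
  refine le_trans (le_of_eq ?_) (eLpNorm_restrict_le _ _ _ S)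
  refine eLpNorm_congr_ae ((ae_restrict_iff' hS.measurableSet).2 (Eventually.of_forall fun x hx => ?_))
  have hx' : x ∈ S' := Metric.self_subset_cthickening _ hx
  simp only [Pi.sub_apply, Set.indicator_of_mem hx']
  rw [moll_congr n (S := S) (fun y hy => (Set.indicator_of_mem hy g).symm) hx]

theorem hasWeakGradient_of_contDiff {w : Space N → ℝ} (hw : ContDiff ℝ 1 w) :
    HasWeakGradient w (∇ w) := by
  have hw' := ContDiff.continuous_gradient hw
  refine ⟨hw.continuous.locallyIntegrable, hw'.locallyIntegrable, fun η hη hc => ?_⟩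
  have hη' := (ContDiff.gradient_space hη).continuous
  have hc' := HasCompactSupport.gradient hc
  have i1 : Integrable fun x => w x • ∇ η x :=
    LocallyIntegrable.smul_test hw.continuous.locallyIntegrable hη' hc'
  have i2 : Integrable fun x => η x • ∇ w x :=
    LocallyIntegrable.test_smul hw'.locallyIntegrable hη.continuous hc
  have i3 : Integrable fun x => w x * η x :=
    LocallyIntegrable.smul_test hw.continuous.locallyIntegrable hη.continuous hc
  refine ext_inner_left ℝ fun v => ?_
  rw [inner_neg_right, ← integral_inner i1, ← integral_inner i2]
  have j1 := i1.const_inner (𝕜 := ℝ) v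
  have j2 := i2.const_inner (𝕜 := ℝ) v
  simp only [inner_smul_right, inner_gradient] at j1 j2 ⊢
  have := integral_mul_fderiv_eq_neg_fderiv_mul_of_integrable (μ := volume) (f := w) (g := η) (v := v)
    (by simpa only [mul_comm] using j2) j1 i3 (fun x _ => hw.differentiable one_ne_zero x)
    (fun x _ => hη.differentiable (by simp) x)
  simpa only [mul_comm (η _)] using this

theorem gradient_comp_real {β β' : ℝ → ℝ} {w : Space N → ℝ} {x : Space N}
    (hβ : HasDerivAt β (β' (w x)) (w x)) (hw : DifferentiableAt ℝ w x) :
    ∇ (fun y => β (w y)) x = β' (w x) • ∇ w x := by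
  refine ext_inner_left ℝ fun v => ?_
  rw [inner_gradient, inner_smul_right, inner_gradient]
  have := hβ.comp_hasFDerivAt x hw.hasFDerivAt
  rw [show (fun y => β (w y)) = β ∘ w from rfl, this.fderiv]
  simp

theorem abs_sub_le_of_deriv_bound {β β' : ℝ → ℝ} {M : ℝ} (hβ : ∀ s, HasDerivAt β (β' s) s)
    (hM : ∀ s, |β' s| ≤ M) (a b : ℝ) : |β a - β b| ≤ M * |a - b| := by
  have := Convex.norm_image_sub_le_of_norm_hasDerivWithin_le (s := Set.univ) (f := β) (f' := β')
    (C := M) (x := b) (y := a) (fun x _ => (hβ x).hasDerivWithinAt) (fun x _ => hM x) convex_univ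
    (Set.mem_univ _) (Set.mem_univ _)
  simpa using this

theorem locallyIntegrable_comp_lipschitz {β : ℝ → ℝ} {M : ℝ} {f : Space N → ℝ}
    (hβc : Continuous β) (hM : ∀ a b, |β a - β b| ≤ M * |a - b|) (hf : LocallyIntegrable f) :
    LocallyIntegrable fun x => β (f x) := by
  have h1 : LocallyIntegrable fun x => |β 0| + M * |f x| :=
    (locallyIntegrable_const _).add ((locallyIntegrable_iff.2 fun k hk =>
      ((hf.integrableOn_isCompact hk).abs)).smul M)
  refine h1.mono (hβc.comp_aestronglyMeasurable hf.aestronglyMeasurable)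
    (Eventually.of_forall fun x => ?_)
  have := hM (f x) 0
  rw [sub_zero] at this
  rw [Real.norm_eq_abs, Real.norm_eq_abs]
  refine le_trans ?_ (le_abs_self _)
  calc |β (f x)| = |β 0 + (β (f x) - β 0)| := by ring_nf
    _ ≤ _ := (abs_add_le _ _).trans (by linarith)

/-- Chain rule for weak gradients. -/
theorem HasWeakGradient.comp {f : Space N → ℝ} {G : Space N → Space N} (hf : HasWeakGradient f G)
    {β β' : ℝ → ℝ} {M : ℝ} (hβ : ∀ s, HasDerivAt β (β' s) s) (hβ' : Continuous β')
    (hM : ∀ s, |β' s| ≤ M) : HasWeakGradient (fun x => β (f x)) (fun x => β' (f x) • G x) := by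
  have hlip := abs_sub_le_of_deriv_bound hβ hM
  have hβc : Continuous β := continuous_iff_continuousAt.2 fun s => (hβ s).continuousAt
  have hM0 : 0 ≤ M := (abs_nonneg _).trans (hM 0)
  have lG : LocallyIntegrable fun x => β' (f x) • G x := by
    refine (hf.2.1.smul M).mono ((hβ'.comp_aestronglyMeasurable hf.1.aestronglyMeasurable).smul
      hf.2.1.aestronglyMeasurable) (Eventually.of_forall fun x => ?_)
    rw [norm_smul, Pi.smul_apply, norm_smul]
    exact mul_le_mul_of_nonneg_right ((hM _).trans (le_abs_self _)) (norm_nonneg _)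
  refine ⟨locallyIntegrable_comp_lipschitz hβc hlip hf.1, lG, fun η hη hc => ?_⟩
  have hη' := (ContDiff.gradient_space hη).continuous
  have hc' := HasCompactSupport.gradient hc
  set S := tsupport η with hS
  have hSc : IsCompact S := hc
  have hsm : ∀ n, ContDiff ℝ ∞ (moll n f) := fun n => contDiff_moll n hf.1
  have hβC : ContDiff ℝ 1 β := by
    rw [contDiff_one_iff_deriv]
    refine ⟨fun s => (hβ s).differentiableAt, ?_⟩
    rwa [show deriv β = β' from funext fun s => (hβ s).deriv]
  -- For mollified functions this is the classical chain rule, since mollification commutes with the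
  -- gradient; what remains is the passage to the limit.
  have key : ∀ n, ∫ x, β (moll n f x) • ∇ η x = -∫ x, η x • β' (moll n f x) • moll n G x := by
    intro n
    have := (hasWeakGradient_of_contDiff (hβC.comp ((hsm n).of_le (by simp)))).2.2 η hη hc
    refine this.trans ?_
    congr 1
    refine integral_congr_ae (Eventually.of_forall fun x => ?_)
    simp only
    rw [show β ∘ moll n f = fun y => β (moll n f y) from rfl,
      gradient_comp_real (hβ _) ((hsm n).differentiable (by simp) x), hf.gradient_moll]
  obtain ⟨C, hC⟩ : ∃ C, ∀ x, ‖∇ η x‖ ≤ C := hc'.exists_bound_of_continuous hη'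
  obtain ⟨D, hD⟩ : ∃ D, ∀ x, ‖η x‖ ≤ D := hc.exists_bound_of_continuous hη.continuous
  have hgη : ∀ x, x ∉ S → ∇ η x = 0 := by
    intro x hx
    have : fderiv ℝ η x = 0 := by
      by_contra h
      exact hx (support_fderiv_subset ℝ h)
    simp [gradient, this]
  have hη0 : ∀ x, x ∉ S → η x = 0 := fun x hx => image_eq_zero_of_notMem_tsupport hx
  have toS : ∀ {w : Space N → Space N}, (∀ x, x ∉ S → w x = 0) → ∫ x in S, w x = ∫ x, w x :=
    fun h => setIntegral_eq_integral_of_forall_compl_eq_zero h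
  have mG : ∀ n, Continuous (moll n G) := fun n => (contDiff_moll n hf.2.1).continuous
  have t1 : Tendsto (fun n => ∫ x, β (moll n f x) • ∇ η x) atTop (𝓝 (∫ x, β (f x) • ∇ η x)) := by
    rw [← toS (fun x hx => by rw [hgη x hx, smul_zero])]
    have e : ∀ n, ∫ x, β (moll n f x) • ∇ η x = ∫ x in S, β (moll n f x) • ∇ η x := fun n =>
      (toS (fun x hx => by rw [hgη x hx, smul_zero])).symm
    simp only [e]
    refine tendsto_integral_of_L1' _ ((hβc.comp_aestronglyMeasurable
      hf.1.aestronglyMeasurable.restrict).smul hη'.aestronglyMeasurable) (Eventually.of_forall fun n =>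
        ((hβc.comp (hsm n).continuous).smul hη').continuousOn.integrableOn_compact hSc) ?_
    have h0 := tendsto_eLpNorm_moll_restrict hf.1 hSc
    have h1 : Tendsto (fun n => ENNReal.ofReal (M * C) * eLpNorm (moll n f - f) 1 (volume.restrict S))
        atTop (𝓝 0) := by
      simpa using ENNReal.Tendsto.const_mul h0 (Or.inr ENNReal.ofReal_ne_top)
    refine tendsto_of_tendsto_of_tendsto_of_le_of_le tendsto_const_nhds h1 (fun _ => zero_le)
      fun n => ?_
    refine eLpNorm_le_mul_eLpNorm_of_ae_le_mul (Eventually.of_forall fun x => ?_) 1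
    change ‖β (moll n f x) • ∇ η x - β (f x) • ∇ η x‖ ≤ M * C * |moll n f x - f x|
    rw [← sub_smul, norm_smul, Real.norm_eq_abs]
    calc |β (moll n f x) - β (f x)| * ‖∇ η x‖ ≤ (M * |moll n f x - f x|) * C :=
          mul_le_mul (hlip _ _) (hC x) (norm_nonneg _) (by positivity)
      _ = M * C * |moll n f x - f x| := by ring
  -- Both factors vary with `n`. Against the fixed field `G`, the bounded factor `β'` converges
  -- almost everywhere (`t3`); the error `moll n G - G` tends to zero in `L¹` on the support of `η`
  -- while `β'` stays bounded (`t4`).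
  have t2 : Tendsto (fun n => ∫ x, η x • β' (moll n f x) • moll n G x) atTop
      (𝓝 (∫ x, η x • β' (f x) • G x)) := by
    have t3 : Tendsto (fun n => ∫ x, η x • β' (moll n f x) • G x) atTop
        (𝓝 (∫ x, η x • β' (f x) • G x)) := by
      refine tendsto_integral_of_dominated_convergence (fun x => M * ‖η x • G x‖)
        (fun n => hη.continuous.aestronglyMeasurable.smul
          ((hβ'.comp (hsm n).continuous).aestronglyMeasurable.smul hf.2.1.aestronglyMeasurable))
        ((LocallyIntegrable.test_smul hf.2.1 hη.continuous hc).norm.const_mul M)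
        (fun n => Eventually.of_forall fun x => ?_) ?_
      · rw [smul_comm, norm_smul]
        exact mul_le_mul_of_nonneg_right (hM _) (norm_nonneg _)
      · filter_upwards [ae_tendsto_moll hf.1] with x hx
        exact (((hβ'.tendsto _).comp hx).smul_const _).const_smul _
    have t4 : Tendsto (fun n => ∫ x, η x • β' (moll n f x) • (moll n G x - G x)) atTop (𝓝 0) := by
      have e : ∀ n, ∫ x, η x • β' (moll n f x) • (moll n G x - G x) =
          ∫ x in S, η x • β' (moll n f x) • (moll n G x - G x) := fun n =>
        (toS (fun x hx => by rw [hη0 x hx, zero_smul])).symm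
      simp only [e]
      have h0 := tendsto_eLpNorm_moll_restrict hf.2.1 hSc
      have h1 : Tendsto (fun n => ENNReal.ofReal (D * M) *
          eLpNorm (moll n G - G) 1 (volume.restrict S)) atTop (𝓝 0) := by
        simpa using ENNReal.Tendsto.const_mul h0 (Or.inr ENNReal.ofReal_ne_top)
      rw [← integral_zero (Space N) (Space N) (μ := volume.restrict S)]
      refine tendsto_integral_of_L1' _ aestronglyMeasurable_const (Eventually.of_forall fun n => ?_) ?_
      · have i1 : Integrable fun x => (η x * β' (moll n f x)) • (moll n G x - G x) :=
          LocallyIntegrable.test_smul ((mG n).locallyIntegrable.sub hf.2.1)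
            (hη.continuous.mul (hβ'.comp (hsm n).continuous)) hc.mul_right
        simp only [mul_smul] at i1
        exact i1.integrableOn
      · refine tendsto_of_tendsto_of_tendsto_of_le_of_le tendsto_const_nhds h1 (fun _ => zero_le)
          fun n => ?_
        refine eLpNorm_le_mul_eLpNorm_of_ae_le_mul (Eventually.of_forall fun x => ?_) 1
        simp only [Pi.sub_apply, norm_smul, sub_zero]
        rw [← mul_assoc]
        refine mul_le_mul_of_nonneg_right ?_ (norm_nonneg _)
        exact mul_le_mul (hD x) (hM _) (norm_nonneg _) ((norm_nonneg _).trans (hD x))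
    have := t3.add t4
    rw [add_zero] at this
    refine this.congr fun n => ?_
    have i1 : Integrable fun x => (η x * β' (moll n f x)) • G x :=
      LocallyIntegrable.test_smul hf.2.1
        (hη.continuous.mul (hβ'.comp (hsm n).continuous)) hc.mul_right
    have i2 : Integrable fun x => (η x * β' (moll n f x)) • (moll n G x - G x) :=
      LocallyIntegrable.test_smul ((mG n).locallyIntegrable.sub hf.2.1)
        (hη.continuous.mul (hβ'.comp (hsm n).continuous)) hc.mul_right
    simp only [mul_smul] at i1 i2
    rw [← integral_add i1 i2]
    refine integral_congr_ae (Eventually.of_forall fun x => ?_)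
    simp only [← smul_add, add_sub_cancel]
  exact tendsto_nhds_unique t1 ((t2.neg).congr fun n => (key n).symm)

end ChainRule

/-! ### Smooth bounded truncations of the identity. -/

section Truncation

/-- A bounded smooth truncation of the identity. -/
noncomputable def trunc (ε s : ℝ) : ℝ := s / (1 + ε * s ^ 2)

noncomputable def truncDeriv (ε s : ℝ) : ℝ := (1 - ε * s ^ 2) / (1 + ε * s ^ 2) ^ 2

/-- The truncation is this factor times `s`. As the factor lies in `[0, 1]`, products with a
truncated function keep their sign and are dominated by the untruncated products. -/
noncomputable def truncFactor (ε s : ℝ) : ℝ := (1 + ε * s ^ 2)⁻¹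

variable {ε : ℝ}

theorem trunc_eq (ε s : ℝ) : trunc ε s = truncFactor ε s * s := by
  rw [trunc, truncFactor, div_eq_inv_mul]

theorem trunc_denom_pos (hε : 0 ≤ ε) (s : ℝ) : 0 < 1 + ε * s ^ 2 := by positivity

theorem truncFactor_nonneg (hε : 0 ≤ ε) (s : ℝ) : 0 ≤ truncFactor ε s :=
  inv_nonneg.2 (trunc_denom_pos hε s).le

theorem truncFactor_le_one (hε : 0 ≤ ε) (s : ℝ) : truncFactor ε s ≤ 1 :=
  inv_le_one_of_one_le₀ (by nlinarith [mul_nonneg hε (sq_nonneg s)])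

theorem hasDerivAt_trunc (hε : 0 ≤ ε) (s : ℝ) : HasDerivAt (trunc ε) (truncDeriv ε s) s := by
  have h := (hasDerivAt_id s).div (((hasDerivAt_pow 2 s).const_mul ε).const_add 1)
    (trunc_denom_pos hε s).ne'
  refine h.congr_deriv ?_
  rw [truncDeriv]
  congr 1
  simp
  ring

theorem continuous_truncDeriv (hε : 0 ≤ ε) : Continuous (truncDeriv ε) :=
  Continuous.div (by fun_prop) (by fun_prop) fun s => (pow_pos (trunc_denom_pos hε s) 2).ne'

theorem abs_truncDeriv_le (hε : 0 ≤ ε) (s : ℝ) : |truncDeriv ε s| ≤ 1 := by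
  have h := trunc_denom_pos hε s
  have h2 := mul_nonneg hε (sq_nonneg s)
  rw [truncDeriv, abs_div, abs_of_pos (pow_pos h 2), div_le_one (pow_pos h 2), abs_le]
  constructor <;> nlinarith

theorem abs_trunc_le (hε : 0 ≤ ε) (s : ℝ) : |trunc ε s| ≤ |s| := by
  rw [trunc_eq, abs_mul, abs_of_nonneg (truncFactor_nonneg hε s)]
  exact mul_le_of_le_one_left (abs_nonneg _) (truncFactor_le_one hε s)

theorem abs_trunc_le_inv (hε : 0 < ε) (hε1 : ε ≤ 1) (s : ℝ) : |trunc ε s| ≤ ε⁻¹ := by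
  have h := trunc_denom_pos hε.le s
  rw [trunc, abs_div, abs_of_pos h, div_le_iff₀ h, mul_add, mul_one, ← mul_assoc,
    inv_mul_cancel₀ hε.ne', one_mul]
  -- It then suffices that `|s| ≤ 1 + s²`.
  have : 1 ≤ ε⁻¹ := (one_le_inv₀ hε).2 hε1
  nlinarith [sq_nonneg (|s| - 1), sq_abs s]

theorem trunc_zero (ε : ℝ) : trunc ε 0 = 0 := by simp [trunc]

/-- The truncation parameters tending to zero. -/
noncomputable def truncSeq (n : ℕ) : ℝ := ((n : ℝ) + 1)⁻¹

theorem truncSeq_pos (n : ℕ) : 0 < truncSeq n := by unfold truncSeq; positivity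

theorem truncSeq_le_one (n : ℕ) : truncSeq n ≤ 1 :=
  inv_le_one_of_one_le₀ (by linarith [(Nat.cast_nonneg n : (0 : ℝ) ≤ n)])

theorem tendsto_truncSeq : Tendsto truncSeq atTop (𝓝 0) :=
  tendsto_inv_atTop_zero.comp (tendsto_atTop_add_const_right _ _ tendsto_natCast_atTop_atTop)

theorem tendsto_truncFactor (s : ℝ) : Tendsto (fun n => truncFactor (truncSeq n) s) atTop (𝓝 1) := by
  have : Tendsto (fun n => 1 + truncSeq n * s ^ 2) atTop (𝓝 (1 + 0 * s ^ 2)) :=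
    (tendsto_truncSeq.mul_const _).const_add 1
  rw [zero_mul, add_zero] at this
  simpa [truncFactor] using this.inv₀ one_ne_zero

theorem tendsto_trunc (s : ℝ) : Tendsto (fun n => trunc (truncSeq n) s) atTop (𝓝 s) := by
  simp only [trunc_eq]
  simpa using (tendsto_truncFactor s).mul_const s

theorem tendsto_truncDeriv (s : ℝ) :
    Tendsto (fun n => truncDeriv (truncSeq n) s) atTop (𝓝 1) := by
  have h1 : Tendsto (fun n => 1 + truncSeq n * s ^ 2) atTop (𝓝 (1 + 0 * s ^ 2)) :=
    (tendsto_truncSeq.mul_const _).const_add 1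
  have h2 : Tendsto (fun n => 1 - truncSeq n * s ^ 2) atTop (𝓝 (1 - 0 * s ^ 2)) :=
    (tendsto_truncSeq.mul_const _).const_sub 1
  rw [zero_mul, add_zero] at h1
  rw [zero_mul, sub_zero] at h2
  have h3 := h2.div (h1.pow 2) (by simp)
  rw [one_pow, div_one] at h3
  exact h3

end Truncation

/-- Fatou's lemma. It supplies integrability of `F v` and of `f φ`, which is not assumed but follows
from bounds on approximate integrals. -/
theorem integrable_of_tendsto_of_integral_le {X : Type*} [MeasurableSpace X] {μ : Measure X}
    {g : ℕ → X → ℝ} {f : X → ℝ} (hg : ∀ n, Integrable (g n) μ) (h0 : ∀ n, ∀ᵐ x ∂μ, 0 ≤ g n x) {C : ℝ}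
    (hC : ∀ n, ∫ x, g n x ∂μ ≤ C) (hf : ∀ᵐ x ∂μ, Tendsto (fun n => g n x) atTop (𝓝 (f x))) :
    Integrable f μ := by
  refine ⟨aestronglyMeasurable_of_tendsto_ae _ (fun n => (hg n).1) hf, ?_⟩
  have h1 : ∫⁻ x, ‖f x‖ₑ ∂μ ≤ liminf (fun n => ∫⁻ x, ‖g n x‖ₑ ∂μ) atTop :=
    lintegral_congr_ae (by filter_upwards [hf] with x hx using hx.enorm.liminf_eq) ▸
      (lintegral_liminf_le' fun n => (hg n).1.enorm)
  refine lt_of_le_of_lt (h1.trans ?_) (ENNReal.ofReal_lt_top (r := C))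
  refine liminf_le_of_frequently_le' (Frequently.of_forall fun n => ?_)
  rw [← ofReal_integral_norm_eq_lintegral_enorm (hg n)]
  refine ENNReal.ofReal_le_ofReal ((le_of_eq ?_).trans (hC n))
  exact integral_congr_ae ((h0 n).mono fun x hx => Real.norm_of_nonneg hx)

/-! ### Enlarging the class of admissible test functions. -/

section Testing

variable {N : ℕ} {Du Dv : Space N → Space N} {F F₁ F₂ Θ v : Space N → ℝ} {S : Set (Space N)}

/-- `-div Du = F` in the sense of distributions. -/
def IsDistribSol (Du : Space N → Space N) (F : Space N → ℝ) : Prop :=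
  ∀ η : Space N → ℝ, ContDiff ℝ ∞ η → HasCompactSupport η → ∫ x, ⟪Du x, ∇ η x⟫ = ∫ x, F x * η x

theorem setIntegral_eq_of_zero {V : Type*} [NormedAddCommGroup V] [NormedSpace ℝ V]
    {w : Space N → V} (hw : ∀ x, x ∉ S → w x = 0) : ∫ x, w x = ∫ x in S, w x :=
  (setIntegral_eq_integral_of_forall_compl_eq_zero hw).symm

theorem integrable_of_integrableOn_zero {V : Type*} [NormedAddCommGroup V]
    {w : Space N → V} (hS : MeasurableSet S) (h : IntegrableOn w S) (hw : ∀ x, x ∉ S → w x = 0) :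
    Integrable w := by
  rw [← integrable_indicator_iff hS] at h
  rwa [Set.indicator_eq_self.2 fun x hx => by_contra fun h => hx (hw x h)] at h

theorem IsDistribSol.integrable_inner (hDu : MemLpLoc Du 2) (hS : IsCompact S) (hDv : MemLp Dv 2)
    (hDvS : ∀ x, x ∉ S → Dv x = 0) : Integrable fun x => ⟪Du x, Dv x⟫ :=
  integrable_of_integrableOn_zero hS.measurableSet
    (integrable_inner_of_memLp (p := 2) (q := 2) (hDu S hS) (hDv.restrict S))
    (fun x hx => by rw [hDvS x hx, inner_zero_right])

theorem LocallyIntegrable.integrable_bdd_mul (hF : LocallyIntegrable F) (hS : IsCompact S)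
    (hvm : AEStronglyMeasurable v) (hvS : ∀ x, x ∉ S → v x = 0) {M : ℝ} (hM : ∀ x, |v x| ≤ M) :
    Integrable fun x => F x * v x := by
  refine integrable_of_integrableOn_zero hS.measurableSet ?_ (fun x hx => by rw [hvS x hx, mul_zero])
  exact (hF.integrableOn_isCompact hS).mul_bdd (c := M) hvm.restrict (Eventually.of_forall hM)

/-- Testing with bounded compactly supported Sobolev functions. -/
theorem IsDistribSol.test_bdd (hu : IsDistribSol Du F) (hDu : MemLpLoc Du 2)
    (hF : LocallyIntegrable F) (hS : IsCompact S) (hv : HasWeakGradient v Dv) (hDv : MemLp Dv 2)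
    (hvS : ∀ x, x ∉ S → v x = 0) (hDvS : ∀ x, x ∉ S → Dv x = 0) {M : ℝ} (hM : ∀ x, |v x| ≤ M) :
    ∫ x, ⟪Du x, Dv x⟫ = ∫ x, F x * v x := by
  set S' := Metric.cthickening 1 S
  have hS' : IsCompact S' := hS.cthickening
  have hSS' : S ⊆ S' := Metric.self_subset_cthickening _
  have z1 : ∀ n x, x ∉ S' → moll n v x = 0 := fun n x hx => moll_eq_zero n hvS hx
  have z2 : ∀ n x, x ∉ S' → moll n Dv x = 0 := fun n x hx => moll_eq_zero n hDvS hx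
  have key : ∀ n, ∫ x, ⟪Du x, moll n Dv x⟫ = ∫ x, F x * moll n v x := by
    intro n
    have hc : HasCompactSupport (moll n v) := HasCompactSupport.intro hS' (z1 n)
    have := hu (moll n v) (contDiff_moll n hv.1) hc
    simpa only [hv.gradient_moll] using this
  have mDv : ∀ n, MemLp (moll n Dv) 2 := fun n =>
    ⟨(contDiff_moll n hv.2.1).continuous.aestronglyMeasurable,
      (eLpNorm_moll_le n (by norm_num) (by simp) hDv.1).trans_lt hDv.2⟩
  -- Mollified gradients converge in `L²`, which handles this side. On the other side `F` is only
  -- locally integrable, and the uniform bound on `v` allows dominated convergence.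
  have t1 : Tendsto (fun n => ∫ x, ⟪Du x, moll n Dv x⟫) atTop (𝓝 (∫ x, ⟪Du x, Dv x⟫)) := by
    rw [setIntegral_eq_of_zero (S := S') (fun x hx => by
      rw [hDvS x fun h => hx (hSS' h), inner_zero_right])]
    have e : ∀ n, ∫ x, ⟪Du x, moll n Dv x⟫ = ∫ x in S', ⟪Du x, moll n Dv x⟫ := fun n =>
      setIntegral_eq_of_zero (fun x hx => by rw [z2 n x hx, inner_zero_right])
    simp only [e]
    refine tendsto_integral_inner (hDu S' hS') (hDv.restrict S') (fun n => (mDv n).restrict _) ?_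
    exact tendsto_of_tendsto_of_tendsto_of_le_of_le tendsto_const_nhds
      (tendsto_eLpNorm_moll (by norm_num) (by simp) hDv) (fun _ => zero_le)
      fun n => eLpNorm_restrict_le _ _ _ _
  have t2 : Tendsto (fun n => ∫ x, F x * moll n v x) atTop (𝓝 (∫ x, F x * v x)) := by
    rw [setIntegral_eq_of_zero (S := S') (fun x hx => by
      rw [hvS x fun h => hx (hSS' h), mul_zero])]
    have e : ∀ n, ∫ x, F x * moll n v x = ∫ x in S', F x * moll n v x := fun n =>
      setIntegral_eq_of_zero (fun x hx => by rw [z1 n x hx, mul_zero])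
    simp only [e]
    have hFi := hF.integrableOn_isCompact hS'
    refine tendsto_integral_of_dominated_convergence (fun x => ‖F x‖ * M)
      (fun n => hFi.1.mul (contDiff_moll n hv.1).continuous.aestronglyMeasurable)
      (hFi.norm.mul_const M) (fun n => Eventually.of_forall fun x => ?_) ?_
    · rw [norm_mul]
      exact mul_le_mul_of_nonneg_left (norm_moll_le n hM x) (norm_nonneg _)
    · filter_upwards [ae_restrict_of_ae (ae_tendsto_moll hv.1)] with x hx using hx.const_mul _
  exact tendsto_nhds_unique t1 (t2.congr fun n => (key n).symm)

theorem HasWeakGradient.trunc (hv : HasWeakGradient v Dv) {ε : ℝ} (hε : 0 ≤ ε) :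
    HasWeakGradient (fun x => trunc ε (v x)) (fun x => truncDeriv ε (v x) • Dv x) :=
  hv.comp (hasDerivAt_trunc hε) (continuous_truncDeriv hε) (abs_truncDeriv_le hε)

theorem memLp_truncDeriv_smul {p : ℝ≥0∞} (hv : AEStronglyMeasurable v) (hDv : MemLp Dv p)
    {ε : ℝ} (hε : 0 ≤ ε) : MemLp (fun x => truncDeriv ε (v x) • Dv x) p := by
  refine hDv.mono (((continuous_truncDeriv hε).comp_aestronglyMeasurable hv).smul hDv.1)
    (Eventually.of_forall fun x => ?_)
  rw [norm_smul]
  exact mul_le_of_le_one_left (norm_nonneg _) (abs_truncDeriv_le hε _)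

theorem IsDistribSol.test_trunc (hu : IsDistribSol Du F) (hDu : MemLpLoc Du 2)
    (hF : LocallyIntegrable F) (hS : IsCompact S) (hv : HasWeakGradient v Dv) (hDv : MemLp Dv 2)
    (hvS : ∀ x, x ∉ S → v x = 0) (hDvS : ∀ x, x ∉ S → Dv x = 0) (n : ℕ) :
    ∫ x, truncDeriv (truncSeq n) (v x) * ⟪Du x, Dv x⟫ = ∫ x, F x * trunc (truncSeq n) (v x) := by
  have hε := truncSeq_pos n
  have := hu.test_bdd hDu hF hS (hv.trunc hε.le)
    (memLp_truncDeriv_smul hv.1.aestronglyMeasurable hDv hε.le)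
    (fun x hx => by simp only [hvS x hx, trunc_zero])
    (fun x hx => by simp only [hDvS x hx, smul_zero])
    (fun x => abs_trunc_le_inv hε (truncSeq_le_one n) _)
  simpa only [inner_smul_right] using this

theorem IsDistribSol.tendsto_test_trunc (hDu : MemLpLoc Du 2)
    (hS : IsCompact S) (hv : AEStronglyMeasurable v) (hDv : MemLp Dv 2)
    (hDvS : ∀ x, x ∉ S → Dv x = 0) :
    Tendsto (fun n => ∫ x, truncDeriv (truncSeq n) (v x) * ⟪Du x, Dv x⟫) atTop
      (𝓝 (∫ x, ⟪Du x, Dv x⟫)) := by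
  have hi := IsDistribSol.integrable_inner hDu hS hDv hDvS
  refine tendsto_integral_of_dominated_convergence (fun x => ‖⟪Du x, Dv x⟫‖)
    (fun n => ((continuous_truncDeriv (truncSeq_pos n).le).comp_aestronglyMeasurable hv).mul hi.1)
    hi.norm (fun n => Eventually.of_forall fun x => ?_) (Eventually.of_forall fun x => ?_)
  · rw [norm_mul]
    exact mul_le_of_le_one_left (norm_nonneg _) (abs_truncDeriv_le (truncSeq_pos n).le _)
  · simpa using (tendsto_truncDeriv (v x)).mul_const ⟪Du x, Dv x⟫

theorem tendsto_integral_truncFactor {h : Space N → ℝ} (hv : AEStronglyMeasurable v)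
    (hh : Integrable h) :
    Tendsto (fun n => ∫ x, truncFactor (truncSeq n) (v x) * h x) atTop (𝓝 (∫ x, h x)) := by
  have hc : ∀ n, Continuous (truncFactor (truncSeq n)) := fun n =>
    Continuous.inv₀ (by fun_prop) fun s => (trunc_denom_pos (truncSeq_pos n).le s).ne'
  refine tendsto_integral_of_dominated_convergence (fun x => ‖h x‖)
    (fun n => ((hc n).comp_aestronglyMeasurable hv).mul hh.1)
    hh.norm (fun n => Eventually.of_forall fun x => ?_) (Eventually.of_forall fun x => ?_)
  · rw [norm_mul, Real.norm_of_nonneg (truncFactor_nonneg (truncSeq_pos n).le _)]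
    exact mul_le_of_le_one_left (norm_nonneg _) (truncFactor_le_one (truncSeq_pos n).le _)
  · simpa using (tendsto_truncFactor (v x)).mul_const (h x)

/-- One-sided testing with unbounded Sobolev functions. -/
theorem IsDistribSol.test_le (hu : IsDistribSol Du fun x => F₁ x - F₂ x) (hDu : MemLpLoc Du 2)
    (hF₁ : LocallyIntegrable F₁) (hF₂ : LocallyIntegrable F₂) (hS : IsCompact S)
    (hv : HasWeakGradient v Dv) (hDv : MemLp Dv 2)
    (hvS : ∀ x, x ∉ S → v x = 0) (hDvS : ∀ x, x ∉ S → Dv x = 0)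
    (h₁ : Integrable fun x => F₁ x * v x) (hΘ : Integrable Θ)
    (hle : ∀ᵐ x, F₂ x * v x ≤ Θ x) :
    ∫ x, F₁ x * v x ≤ (∫ x, ⟪Du x, Dv x⟫) + ∫ x, Θ x := by
  have hvm := hv.1.aestronglyMeasurable
  have t1 := IsDistribSol.tendsto_test_trunc hDu hS hvm hDv hDvS
  have t2 := tendsto_integral_truncFactor hvm h₁
  have t3 := tendsto_integral_truncFactor hvm hΘ
  refine le_of_tendsto_of_tendsto' t2 (t1.add t3) fun n => ?_
  have hε := truncSeq_pos n
  have tm : AEStronglyMeasurable fun x => ChoquardSP.trunc (truncSeq n) (v x) :=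
    (hv.trunc hε.le).1.aestronglyMeasurable
  have tS : ∀ x, x ∉ S → ChoquardSP.trunc (truncSeq n) (v x) = 0 := fun x hx => by
    rw [hvS x hx, trunc_zero]
  have tb : ∀ x, |ChoquardSP.trunc (truncSeq n) (v x)| ≤ (truncSeq n)⁻¹ := fun x =>
    abs_trunc_le_inv hε (truncSeq_le_one n) _
  have i1 := LocallyIntegrable.integrable_bdd_mul hF₁ hS tm tS tb
  have i2 := LocallyIntegrable.integrable_bdd_mul hF₂ hS tm tS tb
  rw [hu.test_trunc hDu (hF₁.sub hF₂) hS hv hDv hvS hDvS n]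
  have e : ∫ x, (F₁ x - F₂ x) * ChoquardSP.trunc (truncSeq n) (v x) =
      (∫ x, F₁ x * ChoquardSP.trunc (truncSeq n) (v x)) -
        ∫ x, F₂ x * ChoquardSP.trunc (truncSeq n) (v x) := by
    rw [← integral_sub i1 i2]; simp only [sub_mul]
  have e1 : ∀ x, F₁ x * ChoquardSP.trunc (truncSeq n) (v x) =
      truncFactor (truncSeq n) (v x) * (F₁ x * v x) := fun x => by rw [trunc_eq]; ring
  have i3 : Integrable fun x => truncFactor (truncSeq n) (v x) * Θ x := by
    have hc : Continuous (truncFactor (truncSeq n)) :=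
      Continuous.inv₀ (by fun_prop) fun s => (trunc_denom_pos hε.le s).ne'
    refine hΘ.bdd_mul (c := 1) (hc.comp_aestronglyMeasurable hvm) (Eventually.of_forall fun x => ?_)
    rw [Real.norm_of_nonneg (truncFactor_nonneg hε.le _)]
    exact truncFactor_le_one hε.le _
  -- The product `F₂ v` is not assumed integrable, so it is compared with `Θ` while the truncation
  -- is still present; only `F₁ v` and `Θ` are passed to the limit.
  have e2 : ∫ x, F₂ x * ChoquardSP.trunc (truncSeq n) (v x) ≤
      ∫ x, truncFactor (truncSeq n) (v x) * Θ x := by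
    refine integral_mono_ae i2 i3 (hle.mono fun x hx => ?_)
    simp only [trunc_eq]
    calc _ = truncFactor (truncSeq n) (v x) * (F₂ x * v x) := by ring
      _ ≤ _ := mul_le_mul_of_nonneg_left hx (truncFactor_nonneg hε.le _)
  rw [e]
  simp only [← e1]
  linarith

/-- Testing with nonnegative Sobolev functions when the right-hand side is nonnegative. -/
theorem IsDistribSol.test_nonneg (hu : IsDistribSol Du F) (hDu : MemLpLoc Du 2)
    (hF : LocallyIntegrable F) (hF0 : ∀ᵐ x, 0 ≤ F x) (hS : IsCompact S)
    (hv : HasWeakGradient v Dv) (hDv : MemLp Dv 2) (hv0 : ∀ᵐ x, 0 ≤ v x)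
    (hvS : ∀ x, x ∉ S → v x = 0) (hDvS : ∀ x, x ∉ S → Dv x = 0) :
    Integrable (fun x => F x * v x) ∧ ∫ x, F x * v x = ∫ x, ⟪Du x, Dv x⟫ := by
  have hvm := hv.1.aestronglyMeasurable
  have t1 := IsDistribSol.tendsto_test_trunc hDu hS hvm hDv hDvS
  have e1 : ∀ n x, F x * ChoquardSP.trunc (truncSeq n) (v x) =
      truncFactor (truncSeq n) (v x) * (F x * v x) := fun n x => by rw [trunc_eq]; ring
  -- The truncated tests are nonnegative, and by the equation their integrals form a convergent,
  -- hence bounded, sequence; Fatou applies.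
  have hint : Integrable fun x => F x * v x := by
    have i0 : ∀ n, Integrable fun x => F x * ChoquardSP.trunc (truncSeq n) (v x) := fun n =>
      LocallyIntegrable.integrable_bdd_mul hF hS
        (hv.trunc (truncSeq_pos n).le).1.aestronglyMeasurable
        (fun x hx => by simp only [hvS x hx, trunc_zero])
        (fun x => abs_trunc_le_inv (truncSeq_pos n) (truncSeq_le_one n) _)
    obtain ⟨C, hC⟩ := t1.bddAbove_range
    refine integrable_of_tendsto_of_integral_le i0 (fun n => ?_) (C := C) (fun n => ?_)
      (Eventually.of_forall fun x => (tendsto_trunc (v x)).const_mul (F x))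
    · filter_upwards [hF0, hv0] with x h1 h2
      rw [e1]
      exact mul_nonneg (truncFactor_nonneg (truncSeq_pos n).le _) (mul_nonneg h1 h2)
    · rw [← hu.test_trunc hDu hF hS hv hDv hvS hDvS n]
      exact hC ⟨n, rfl⟩
  refine ⟨hint, ?_⟩
  have t2 := tendsto_integral_truncFactor hvm hint
  refine tendsto_nhds_unique t2 (t1.congr fun n => ?_)
  rw [hu.test_trunc hDu hF hS hv hDv hvS hDvS n]
  simp only [e1]

end Testing

/-! ### Dilations: derivative in the parameter and effect on `L^p` norms. -/

section Dilation

variable {N : ℕ} {w : Space N → ℝ} {G : Space N → Space N}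

/-- Differentiation of the dilations of a compactly supported function against a locally
integrable one. -/
theorem hasDerivAt_integral_dilate {χ g : Space N → ℝ} (hχ : ContDiff ℝ 1 χ)
    (hc : HasCompactSupport χ) (hg : LocallyIntegrable g) :
    HasDerivAt (fun σ : ℝ => ∫ x, χ (σ • x) * g x) (∫ x, ⟪x, ∇ χ x⟫ * g x) 1 := by
  have hχ' := ContDiff.continuous_gradient hχ
  have hc' := HasCompactSupport.gradient hc
  obtain ⟨C, hC⟩ : ∃ C, ∀ x, ‖∇ χ x‖ ≤ C := hc'.exists_bound_of_continuous hχ'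
  have hC0 : 0 ≤ C := (norm_nonneg _).trans (hC 0)
  obtain ⟨R, hR⟩ := hc'.isCompact.isBounded.subset_closedBall (0 : Space N)
  -- For dilation factors above `1/2`, a point outside radius `2R` is still sent outside radius `R`,
  -- where the gradient of `χ` vanishes.
  set B := Metric.closedBall (0 : Space N) (2 * R)
  have hB : IsCompact B := isCompact_closedBall _ _
  have hd : ∀ σ : ℝ, ∀ x, HasDerivAt (fun σ : ℝ => χ (σ • x) * g x)
      (⟪x, ∇ χ (σ • x)⟫ * g x) σ := by
    intro σ x
    have h1 : HasDerivAt (fun σ : ℝ => σ • x) x σ := by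
      simpa using (hasDerivAt_id σ).smul_const x
    have h2 := (hχ.differentiable one_ne_zero (σ • x)).hasFDerivAt.comp_hasDerivAt σ h1
    rw [← inner_gradient] at h2
    exact h2.mul_const (g x)
  have key := hasDerivAt_integral_of_dominated_loc_of_deriv_le (μ := (volume : Measure (Space N)))
    (F := fun (σ : ℝ) x => χ (σ • x) * g x) (F' := fun σ x => ⟪x, ∇ χ (σ • x)⟫ * g x) (x₀ := 1)
    (s := Set.Ioo (1 / 2) 2) (bound := B.indicator fun x => 2 * R * C * ‖g x‖)
    (Ioo_mem_nhds (by norm_num) (by norm_num))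
    (Eventually.of_forall fun σ => ((hχ.continuous.comp
      (continuous_const_smul σ)).aestronglyMeasurable).mul hg.aestronglyMeasurable)
    (by
      have := LocallyIntegrable.test_smul hg hχ.continuous hc
      simpa using this)
    ((continuous_id.inner (hχ'.comp (continuous_const_smul _))).aestronglyMeasurable.mul
      hg.aestronglyMeasurable)
    (Eventually.of_forall fun x σ hσ => ?_)
    ((integrable_indicator_iff hB.measurableSet).2 ((hg.integrableOn_isCompact hB).norm.const_mul _))
    (Eventually.of_forall fun x σ _ => hd σ x)
  · simpa using key.2
  · by_cases hx : x ∈ B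
    · rw [Set.indicator_of_mem hx, norm_mul]
      refine mul_le_mul_of_nonneg_right ?_ (norm_nonneg _)
      have hx' : ‖x‖ ≤ 2 * R := by simpa [B] using hx
      exact (norm_inner_le_norm _ _).trans (mul_le_mul hx' (hC _) (norm_nonneg _)
        ((norm_nonneg _).trans hx'))
    · have : ∇ χ (σ • x) = 0 := by
        by_contra h
        have h1 := hR (subset_tsupport _ h)
        apply hx
        rw [mem_closedBall_zero_iff, norm_smul, Real.norm_of_nonneg (by linarith [hσ.1])] at h1
        rw [mem_closedBall_zero_iff]
        nlinarith [hσ.1, norm_nonneg x]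
      simp [this, Set.indicator_of_notMem hx]

theorem inner_single (v : Space N) (i : Fin N) :
    ⟪v, (EuclideanSpace.single i (1 : ℝ) : Space N)⟫ = v i := by
  rw [EuclideanSpace.inner_single_right]; simp

theorem inner_eq_sum (v v' : Space N) : ⟪v, v'⟫ = ∑ i, v i * v' i := by
  rw [PiLp.inner_apply]
  exact Finset.sum_congr rfl fun i _ => by simp [mul_comm]

theorem sum_fderiv_single (η : Space N → ℝ) (x v : Space N) :
    ∑ i, v i * fderiv ℝ η x (EuclideanSpace.single i 1) = fderiv ℝ η x v := by
  rw [← inner_gradient, inner_eq_sum]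
  refine Finset.sum_congr rfl fun i _ => ?_
  rw [← inner_gradient, real_inner_comm, inner_single]

theorem HasWeakGradient.partial_test (hw : HasWeakGradient w G) {η : Space N → ℝ}
    (hη : ContDiff ℝ ∞ η) (hc : HasCompactSupport η) (i : Fin N) :
    ∫ x, w x * fderiv ℝ η x (EuclideanSpace.single i 1) = -∫ x, η x * G x i := by
  have i1 := LocallyIntegrable.smul_test hw.1 (ContDiff.gradient_space hη).continuous
    (HasCompactSupport.gradient hc)
  have i2 := LocallyIntegrable.test_smul hw.2.1 hη.continuous hc
  have := congrArg (fun v => ⟪(EuclideanSpace.single i (1 : ℝ) : Space N), v⟫) (hw.2.2 η hη hc)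
  rw [inner_neg_right, ← integral_inner i1, ← integral_inner i2] at this
  simp only [inner_smul_right, inner_gradient] at this
  simpa only [real_inner_comm, inner_single] using this

/-- The weak gradient tested against a smooth compactly supported vector field. -/
theorem HasWeakGradient.div_test (hw : HasWeakGradient w G) {Y : Space N → Space N}
    (hY : ContDiff ℝ ∞ Y) (hc : HasCompactSupport Y) :
    ∫ x, w x * ∑ i, fderiv ℝ (fun y => Y y i) x (EuclideanSpace.single i 1) =
      -∫ x, ⟪Y x, G x⟫ := by
  have hYi : ∀ i, ContDiff ℝ ∞ fun y => Y y i := fun i => (contDiff_euclidean.1 hY) i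
  have hci : ∀ i, HasCompactSupport fun y => Y y i := fun i =>
    hc.comp_left (g := fun v : Space N => v i) rfl
  have h1 : ∀ i, Integrable fun x => w x * fderiv ℝ (fun y => Y y i) x
      (EuclideanSpace.single i 1) := by
    intro i
    have := (LocallyIntegrable.smul_test hw.1 (ContDiff.gradient_space (hYi i)).continuous
      (HasCompactSupport.gradient (hci i))).const_inner (𝕜 := ℝ) (EuclideanSpace.single i (1 : ℝ))
    simpa only [inner_smul_right, inner_gradient] using this
  have h2 : ∀ i, Integrable fun x => Y x i * G x i := by
    intro i
    have := (LocallyIntegrable.test_smul hw.2.1 (hYi i).continuous (hci i)).const_inner (𝕜 := ℝ)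
      (EuclideanSpace.single i (1 : ℝ))
    simpa only [inner_smul_right, real_inner_comm, inner_single] using this
  simp only [Finset.mul_sum, inner_eq_sum]
  rw [integral_finsetSum _ fun i _ => h1 i, integral_finsetSum _ fun i _ => h2 i,
    ← Finset.sum_neg_distrib]
  exact Finset.sum_congr rfl fun i _ => hw.partial_test (hYi i) (hci i) i

/-- The divergence of the field `x ↦ χ(x) x`. -/
theorem sum_fderiv_radial {χ : Space N → ℝ} {x : Space N} (hχ : DifferentiableAt ℝ χ x) :
    ∑ i, fderiv ℝ (fun y => (χ y • y) i) x (EuclideanSpace.single i 1) =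
      N * χ x + ⟪x, ∇ χ x⟫ := by
  have h : ∀ i, fderiv ℝ (fun y => (χ y • y) i) x (EuclideanSpace.single i 1) =
      χ x + x i * fderiv ℝ χ x (EuclideanSpace.single i 1) := by
    intro i
    have hp : HasFDerivAt (fun y : Space N => y i) (EuclideanSpace.proj i : Space N →L[ℝ] ℝ) x :=
      (EuclideanSpace.proj i : Space N →L[ℝ] ℝ).hasFDerivAt
    have := (hχ.hasFDerivAt.mul hp).fderiv
    have e : (fun y => (χ y • y) i) = fun y => χ y * y i := rfl
    rw [e]
    change fderiv ℝ (χ * fun y : Space N => y i) x _ = _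
    rw [this]
    simp
  simp only [h]
  rw [Finset.sum_add_distrib, sum_fderiv_single, inner_gradient]
  simp

theorem HasWeakGradient.radial_test (hw : HasWeakGradient w G) {χ : Space N → ℝ}
    (hχ : ContDiff ℝ ∞ χ) (hc : HasCompactSupport χ) :
    ∫ x, w x * (N * χ x + ⟪x, ∇ χ x⟫) = -∫ x, χ x * ⟪x, G x⟫ := by
  have := hw.div_test (Y := fun x => χ x • x) (hχ.smul contDiff_id) hc.smul_right
  simp only [sum_fderiv_radial (hχ.differentiable (by simp) _), inner_smul_left] at this
  simpa using this

/-- A change of variables moves the dilation onto the smooth factor `h`, where it can be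
differentiated. Integrating by parts against the field `h(x) x` moves the derivative back to `w`;
the divergence `N` of the identity field cancels the derivative of the Jacobian. -/
theorem HasWeakGradient.hasDerivAt_dilate_one (hw : HasWeakGradient w G) {h : Space N → ℝ}
    (hh : ContDiff ℝ ∞ h) (hc : HasCompactSupport h) :
    HasDerivAt (fun t : ℝ => ∫ x, h x * w (t • x)) (∫ x, h x * ⟪x, G x⟫) 1 := by
  have h1 := hasDerivAt_integral_dilate (hh.of_le (by simp)) hc hw.1
  have h2 : HasDerivAt (fun t : ℝ => ∫ x, h (t⁻¹ • x) * w x)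
      ((∫ x, ⟪x, ∇ h x⟫ * w x) * (-((1 : ℝ) ^ 2)⁻¹)) 1 :=
    HasDerivAt.comp (h₂ := fun σ : ℝ => ∫ x, h (σ • x) * w x) (1 : ℝ) (by simpa using h1)
      (hasDerivAt_inv one_ne_zero)
  have h3 : HasDerivAt (fun t : ℝ => (t ^ N)⁻¹) (-(N : ℝ)) 1 := by
    have := (hasDerivAt_pow N (1 : ℝ)).inv (by simp)
    refine this.congr_deriv ?_
    simp
  have h4 := h3.mul h2
  have e : ∀ᶠ t : ℝ in 𝓝 1, ∫ x, h x * w (t • x) = (t ^ N)⁻¹ * ∫ x, h (t⁻¹ • x) * w x := by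
    filter_upwards [lt_mem_nhds (zero_lt_one (α := ℝ))] with t ht
    have := integral_comp_smul_space (fun x => h (t⁻¹ • x) * w x) ht
    simpa only [smul_smul, inv_mul_cancel₀ ht.ne', one_smul, smul_eq_mul] using this
  refine (h4.congr_of_eventuallyEq e).congr_deriv ?_
  have i1 : Integrable fun x => w x * (N * h x) :=
    LocallyIntegrable.smul_test hw.1 (continuous_const.mul hh.continuous) hc.mul_left
  have i2 : Integrable fun x => w x * ⟪x, ∇ h x⟫ := by
    refine LocallyIntegrable.smul_test hw.1
      (continuous_id.inner (ContDiff.gradient_space hh).continuous) ?_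
    refine (HasCompactSupport.gradient hc).mono fun x hx => ?_
    rw [mem_support] at hx ⊢
    contrapose! hx
    simp [hx]
  have e1 := hw.radial_test hh hc
  simp only [mul_add] at e1
  rw [integral_add i1 i2] at e1
  have e2 : ∫ x, w x * (N * h x) = N * ∫ x, h x * w x := by
    rw [← integral_const_mul]; congr 1; funext x; ring
  have e3 : ∫ x, w x * ⟪x, ∇ h x⟫ = ∫ x, ⟪x, ∇ h x⟫ * w x := by
    congr 1; funext x; ring
  rw [e2, e3] at e1
  simp only [inv_one, one_smul, one_pow]
  linarith

theorem HasWeakGradient.hasDerivAt_dilate (hw : HasWeakGradient w G) {h : Space N → ℝ}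
    (hh : ContDiff ℝ ∞ h) (hc : HasCompactSupport h) {τ : ℝ} (hτ : 0 < τ) :
    HasDerivAt (fun t : ℝ => ∫ x, h x * w (t • x)) (∫ x, h x * ⟪x, G (τ • x)⟫) τ := by
  have h1 := (hw.comp_smul hτ).hasDerivAt_dilate_one hh hc
  have h2 : HasDerivAt (fun t : ℝ => t / τ) (1 / τ) τ := (hasDerivAt_id τ).div_const τ
  have h3 := HasDerivAt.comp (h₂ := fun t : ℝ => ∫ x, h x * w (τ • t • x)) τ
    (by rw [div_self hτ.ne']; exact h1) h2
  have e : (fun t : ℝ => ∫ x, h x * w (t • x)) =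
      (fun t : ℝ => ∫ x, h x * w (τ • t • x)) ∘ fun t => t / τ := by
    funext t
    simp only [comp_apply, smul_smul, mul_div_cancel₀ t hτ.ne']
  rw [e]
  refine h3.congr_deriv ?_
  rw [← integral_mul_const]
  congr 1
  funext x
  rw [inner_smul_right]
  field_simp

theorem map_smul_volume {t : ℝ} (ht : 0 < t) : Measure.map (fun x : Space N => t • x) volume =
    ENNReal.ofReal ((t ^ N)⁻¹) • (volume : Measure (Space N)) := by
  have := Measure.map_addHaar_smul (volume : Measure (Space N)) ht.ne'
  rw [finrank_euclideanSpace_fin, abs_of_pos (by positivity)] at this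
  exact this

theorem quasiMeasurePreserving_smul_space {t : ℝ} (ht : 0 < t) :
    Measure.QuasiMeasurePreserving (fun x : Space N => t • x) volume volume :=
  ⟨measurable_const_smul t, by rw [map_smul_volume ht]; exact Measure.smul_absolutelyContinuous⟩

theorem eLpNorm_comp_smul {F : Type*} [NormedAddCommGroup F] {g : Space N → F}
    (hg : AEStronglyMeasurable g) (p : ℝ≥0∞) {t : ℝ} (ht : 0 < t) :
    eLpNorm (fun x => g (t • x)) p =
      ENNReal.ofReal ((t ^ N)⁻¹) ^ (1 / p).toReal * eLpNorm g p := by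
  have hm := map_smul_volume (N := N) ht
  have h1 := eLpNorm_map_measure (p := p) (μ := (volume : Measure (Space N)))
    (f := fun x : Space N => t • x) (g := g)
    (by rw [hm]; exact hg.smul_measure _) (continuous_const_smul t).aemeasurable
  rw [hm, eLpNorm_smul_measure_of_ne_zero (by
    simp only [ne_eq, ENNReal.ofReal_eq_zero, not_le]; positivity)] at h1
  rw [smul_eq_mul] at h1
  exact h1.symm

theorem MemLp.comp_smul_space {F : Type*} [NormedAddCommGroup F] {g : Space N → F} {p : ℝ≥0∞}
    (hg : MemLp g p) {t : ℝ} (ht : 0 < t) : MemLp (fun x => g (t • x)) p := by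
  refine ⟨?_, ?_⟩
  · exact hg.1.comp_quasiMeasurePreserving (quasiMeasurePreserving_smul_space ht)
  · rw [eLpNorm_comp_smul hg.1 p ht]
    exact ENNReal.mul_lt_top (ENNReal.rpow_lt_top_of_nonneg (by positivity) ENNReal.ofReal_ne_top) hg.2

end Dilation

/-! ### Differentiating dilations of Sobolev functions. -/

section DilationDerivative

variable {N : ℕ} {w : Space N → ℝ} {G : Space N → Space N}

theorem MemLpLoc.comp_smul_space {F : Type*} [NormedAddCommGroup F] {g : Space N → F} {p : ℝ≥0∞}
    (hg : MemLpLoc g p) {t : ℝ} (ht : 0 < t) {S : Set (Space N)} (hS : IsCompact S) :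
    MemLp (fun x => g (t • x)) p (volume.restrict S) := by
  have hS' : IsCompact ((fun x => t • x) '' S) := hS.image (continuous_const_smul t)
  have h1 : MemLp (((fun x => t • x) '' S).indicator g) p :=
    (memLp_indicator_iff_restrict hS'.measurableSet).2 (hg _ hS')
  refine (memLp_congr_ae ?_).1 ((MemLp.comp_smul_space h1 ht).restrict S)
  refine (ae_restrict_iff' hS.measurableSet).2 (Eventually.of_forall fun x hx => ?_)
  exact Set.indicator_of_mem (Set.mem_image_of_mem (fun x => t • x) hx) g

/-- Uniform bound of dilations on balls. -/
theorem MemLpLoc.exists_dilate_bound {g : Space N → Space N} {p : ℝ≥0∞}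
    (hg : MemLpLoc g p) (R : ℝ) :
    ∃ M : ℝ≥0∞, M ≠ ⊤ ∧ ∀ τ ∈ Set.Ioo (1 / 2 : ℝ) 2,
      eLpNorm (fun x => ⟪x, g (τ • x)⟫) p (volume.restrict (Metric.closedBall 0 R)) ≤ M := by
  obtain ⟨B2, hB2, hB2m⟩ : ∃ B2 : Set (Space N), IsCompact B2 ∧ ∀ x, ‖x‖ ≤ 2 * R → x ∈ B2 :=
    ⟨Metric.closedBall 0 (2 * R), isCompact_closedBall _ _, fun x hx => by simpa using hx⟩
  have h1 : MemLp (B2.indicator g) p :=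
    (memLp_indicator_iff_restrict hB2.measurableSet).2 (hg _ hB2)
  have hA : ENNReal.ofReal R * (ENNReal.ofReal (2 ^ N) ^ (1 / p).toReal *
      eLpNorm (B2.indicator g) p) ≠ ⊤ := ENNReal.mul_ne_top ENNReal.ofReal_ne_top (ENNReal.mul_ne_top
      (ENNReal.rpow_ne_top_of_nonneg ENNReal.toReal_nonneg ENNReal.ofReal_ne_top) h1.eLpNorm_ne_top)
  refine ⟨_, hA, fun τ hτ => ?_⟩
  have hτ0 : 0 < τ := by linarith [hτ.1]
  have h2 : eLpNorm (fun x => ⟪x, g (τ • x)⟫) p (volume.restrict (Metric.closedBall 0 R)) ≤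
      ENNReal.ofReal R * eLpNorm (fun x => B2.indicator g (τ • x)) p (volume.restrict (Metric.closedBall 0 R)) := by
    refine eLpNorm_le_mul_eLpNorm_of_ae_le_mul ((ae_restrict_iff' measurableSet_closedBall).2
      (Eventually.of_forall fun x hx => ?_)) p
    have hx' : ‖x‖ ≤ R := by simpa using hx
    have : τ • x ∈ B2 := by
      refine hB2m _ ?_
      rw [norm_smul, Real.norm_of_nonneg hτ0.le]
      exact mul_le_mul hτ.2.le hx' (norm_nonneg _) (by norm_num)
    rw [Set.indicator_of_mem this]
    exact (norm_inner_le_norm _ _).trans (mul_le_mul_of_nonneg_right hx' (norm_nonneg _))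
  have h3 := eLpNorm_restrict_le (fun x => B2.indicator g (τ • x)) p volume (Metric.closedBall 0 R)
  rw [eLpNorm_comp_smul h1.1 p hτ0] at h3
  have h4 : (τ ^ N)⁻¹ ≤ (2 : ℝ) ^ N := by
    rw [← inv_pow]
    refine pow_le_pow_left₀ (by positivity) ?_ N
    rw [inv_le_comm₀ hτ0 two_pos]
    linarith [hτ.1]
  have h5 : ENNReal.ofReal ((τ ^ N)⁻¹) ^ (1 / p).toReal ≤ ENNReal.ofReal (2 ^ N) ^ (1 / p).toReal :=
    ENNReal.rpow_le_rpow (ENNReal.ofReal_le_ofReal h4) ENNReal.toReal_nonneg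
  exact h2.trans (mul_le_mul' le_rfl (h3.trans (mul_le_mul' h5 le_rfl)))

theorem abs_integral_mul_le {p q : ℝ≥0∞} [ENNReal.HolderTriple p q 1] {B : Set (Space N)}
    {k v : Space N → ℝ} (hk : MemLp k p) (hkB : ∀ x, x ∉ B → k x = 0)
    (hv : MemLp v q (volume.restrict B)) :
    |∫ x, k x * v x| ≤ (eLpNorm k p * eLpNorm v q (volume.restrict B)).toReal := by
  rw [setIntegral_eq_of_zero (S := B) fun x hx => by rw [hkB x hx, zero_mul]]
  have h := eLpNorm_inner_le (p := p) (q := q) (hk.1.restrict (s := B)) hv.1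
  have h' := h.trans (mul_le_mul_left (eLpNorm_restrict_le k p volume B) _)
  have hfin : eLpNorm k p * eLpNorm v q (volume.restrict B) ≠ ⊤ := ENNReal.mul_ne_top hk.eLpNorm_ne_top hv.eLpNorm_ne_top
  rw [← Real.norm_eq_abs]
  have h2 := (enorm_integral_le_lintegral_enorm (μ := volume.restrict B) (fun x => k x * v x))
  rw [← eLpNorm_one_eq_lintegral_enorm] at h2
  have e : (fun x => ⟪k x, v x⟫) = fun x => k x * v x := by
    funext x; simp [mul_comm]
  rw [e] at h'
  have h3 := ENNReal.toReal_mono hfin (h2.trans h')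
  rwa [toReal_enorm] at h3

theorem integrable_mul_of_zero_off {p q : ℝ≥0∞} [ENNReal.HolderTriple p q 1] {B : Set (Space N)}
    (hB : MeasurableSet B) {k v : Space N → ℝ} (hk : MemLp k p) (hkB : ∀ x, x ∉ B → k x = 0)
    (hv : MemLp v q (volume.restrict B)) : Integrable fun x => k x * v x := by
  refine integrable_of_integrableOn_zero hB ?_ fun x hx => by rw [hkB x hx, zero_mul]
  have := integrable_inner_of_memLp (p := p) (q := q) (hk.restrict B) hv
  simpa [IntegrableOn, mul_comm] using this

/-- Smooth approximation of `L^p` functions supported in a ball by functions supported in a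
slightly larger ball. -/
theorem exists_smooth_approx {p : ℝ≥0∞} (hp1 : 1 ≤ p) (hp : p ≠ ⊤) {h : Space N → ℝ}
    (hh : MemLp h p) {R : ℝ} (hR : 0 < R) (hhR : ∀ x, R < ‖x‖ → h x = 0) {ε : ℝ} (hε : 0 < ε) :
    ∃ g : Space N → ℝ, ContDiff ℝ ∞ g ∧ HasCompactSupport g ∧ (∀ x, R + 1 < ‖x‖ → g x = 0) ∧
      eLpNorm (g - h) p ≤ ENNReal.ofReal ε := by
  obtain ⟨g, hgc, hgs, hgε⟩ := hh.exist_eLpNorm_sub_le hp hp1 hε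
  let ψ : ContDiffBump (0 : Space N) := ⟨R, R + 1, hR, by linarith⟩
  have hψ : ContDiff ℝ ∞ ψ := ψ.contDiff
  refine ⟨fun x => ψ x * g x, hψ.mul hgs, hgc.mul_left, fun x hx => ?_, ?_⟩
  · have : ψ x = 0 := ψ.zero_of_le_dist (by rw [dist_zero_right]; exact hx.le)
    simp only [this, zero_mul]
  · rw [eLpNorm_sub_comm] at hgε
    refine le_trans (eLpNorm_mono fun x => ?_) hgε
    have : ψ x * h x = h x := by
      by_cases hx : R < ‖x‖
      · rw [hhR x hx, mul_zero]
      · rw [ψ.one_of_mem_closedBall (by simpa using hx), one_mul]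
    have e : ψ x * g x - h x = ψ x * (g x - h x) := by rw [mul_sub, this]
    simp only [Pi.sub_apply]
    rw [e, norm_mul, Real.norm_of_nonneg ψ.nonneg]
    exact mul_le_of_le_one_left (norm_nonneg _) ψ.le_one

/-- Differentiation of dilations of a Sobolev function against a compactly supported function. -/
theorem HasWeakGradient.hasDerivAt_dilate_memLp (hw : HasWeakGradient w G) {p q : ℝ≥0∞}
    [ENNReal.HolderTriple p q 1] (hp1 : 1 ≤ p) (hp : p ≠ ⊤) (hwq : MemLpLoc w q)
    (hGq : MemLpLoc G q) {h : Space N → ℝ} (hh : MemLp h p) (hc : HasCompactSupport h) :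
    HasDerivAt (fun t : ℝ => ∫ x, h x * w (t • x)) (∫ x, h x * ⟪x, G x⟫) 1 := by
  obtain ⟨R₀, hR₀⟩ := hc.isCompact.isBounded.subset_closedBall (0 : Space N)
  set R := max R₀ 1 with hR
  have hR0 : 0 < R := lt_of_lt_of_le one_pos (le_max_right _ _)
  have hhR : ∀ x, R < ‖x‖ → h x = 0 := by
    intro x hx
    by_contra hne
    have := hR₀ (subset_tsupport _ hne)
    rw [mem_closedBall_zero_iff] at this
    exact absurd (this.trans (le_max_left _ _)) (not_le.2 hx)
  choose g hgs hgc hgR hgε using fun n : ℕ =>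
    exists_smooth_approx hp1 hp hh hR0 hhR (show (0 : ℝ) < ((n : ℝ) + 1)⁻¹ by positivity)
  have hgε0 : Tendsto (fun n => eLpNorm (g n - h) p) atTop (𝓝 0) := by
    have h1 : Tendsto (fun n : ℕ => ENNReal.ofReal (((n : ℝ) + 1)⁻¹)) atTop (𝓝 0) := by
      have := ENNReal.tendsto_ofReal (tendsto_inv_atTop_zero.comp
        (tendsto_atTop_add_const_right _ (1 : ℝ) tendsto_natCast_atTop_atTop))
      rw [ENNReal.ofReal_zero] at this
      exact this
    exact tendsto_of_tendsto_of_tendsto_of_le_of_le tendsto_const_nhds h1 (fun _ => zero_le) hgε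
  set B := Metric.closedBall (0 : Space N) (R + 1) with hB
  have hBc : IsCompact B := isCompact_closedBall _ _
  have nB : ∀ x, x ∉ B → R + 1 < ‖x‖ := fun x hx => by
    rw [mem_closedBall_zero_iff] at hx; exact not_le.1 hx
  have hhB : ∀ x, x ∉ B → h x = 0 := fun x hx => hhR x ((lt_add_one R).trans (nB x hx))
  have hgB : ∀ n x, x ∉ B → g n x = 0 := fun n x hx => hgR n x (nB x hx)
  have hgm : ∀ n, MemLp (g n) p := fun n =>
    (hgs n).continuous.memLp_of_hasCompactSupport (hgc n)
  have lim : ∀ {v : Space N → ℝ}, MemLp v q (volume.restrict B) →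
      ∀ n, |(∫ x, g n x * v x) - ∫ x, h x * v x| ≤
        (eLpNorm (g n - h) p * eLpNorm v q (volume.restrict B)).toReal := by
    intro v hv n
    have := abs_integral_mul_le (B := B) ((hgm n).sub hh) (fun x hx => by
      simp [hhB x hx, hgB n x hx]) hv
    simp only [Pi.sub_apply, sub_mul] at this
    rwa [integral_sub (integrable_mul_of_zero_off hBc.measurableSet (hgm n) (hgB n) hv)
      (integrable_mul_of_zero_off hBc.measurableSet hh hhB hv)] at this
  obtain ⟨M, hM, hMb⟩ := hGq.exists_dilate_bound (R + 1)
  have hGv : ∀ τ ∈ Set.Ioo (1 / 2 : ℝ) 2,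
      MemLp (fun x => ⟪x, G (τ • x)⟫) q (volume.restrict B) := by
    intro τ hτ
    have hτ0 : 0 < τ := by linarith [hτ.1]
    exact ⟨aestronglyMeasurable_id.inner (hGq.comp_smul_space hτ0 hBc).1,
      (hMb τ hτ).trans_lt hM.lt_top⟩
  -- The function `h` is replaced by smooth approximations with supports in a common ball. By Hölder
  -- and the bound on dilates of `G` uniform over `(1/2, 2)`, the derivatives converge uniformly, so
  -- the limit may be differentiated.
  have hder := hasDerivAt_of_tendstoUniformlyOn (l := atTop) (s := Set.Ioo (1 / 2 : ℝ) 2) (x := 1)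
    (f := fun n (t : ℝ) => ∫ x, g n x * w (t • x))
    (f' := fun n τ => ∫ x, g n x * ⟪x, G (τ • x)⟫) (g := fun t : ℝ => ∫ x, h x * w (t • x))
    (g' := fun τ => ∫ x, h x * ⟪x, G (τ • x)⟫) isOpen_Ioo ?_
    (Eventually.of_forall fun n τ hτ => hw.hasDerivAt_dilate (hgs n) (hgc n) (by linarith [hτ.1]))
    ?_ ⟨by norm_num, by norm_num⟩
  · simpa using hder
  · rw [Metric.tendstoUniformlyOn_iff]
    intro ε hε
    have h1 : Tendsto (fun n => (eLpNorm (g n - h) p * M).toReal) atTop (𝓝 0) := by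
      have h2 := ENNReal.Tendsto.mul_const hgε0 (Or.inr hM)
      rw [zero_mul] at h2
      exact (ENNReal.continuousAt_toReal ENNReal.zero_ne_top).tendsto.comp h2
    filter_upwards [h1.eventually (gt_mem_nhds hε)] with n hn τ hτ
    rw [dist_comm, Real.dist_eq]
    refine lt_of_le_of_lt ((lim (hGv τ hτ) n).trans ?_) hn
    exact ENNReal.toReal_mono (ENNReal.mul_ne_top ((hgm n).sub hh).2.ne hM)
      (mul_le_mul' le_rfl (hMb τ hτ))
  · intro t ht
    have ht0 : 0 < t := by linarith [ht.1]
    have hv := hwq.comp_smul_space ht0 hBc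
    rw [tendsto_iff_dist_tendsto_zero]
    have h1 : Tendsto (fun n => (eLpNorm (g n - h) p *
        eLpNorm (fun x => w (t • x)) q (volume.restrict B)).toReal) atTop (𝓝 0) := by
      have h2 := ENNReal.Tendsto.mul_const (b := eLpNorm (fun x => w (t • x)) q (volume.restrict B))
        hgε0 (Or.inr hv.eLpNorm_ne_top)
      rw [zero_mul] at h2
      exact (ENNReal.continuousAt_toReal ENNReal.zero_ne_top).tendsto.comp h2
    exact squeeze_zero (fun _ => dist_nonneg) (fun n => by rw [Real.dist_eq]; exact lim hv n) h1

/-- A square integrable function with vanishing weak gradient vanishes. -/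
theorem HasWeakGradient.ae_eq_zero (hN : 0 < N) (hw : HasWeakGradient w G) (hG : G =ᵐ[volume] 0)
    (hw2 : MemLp w 2) : w =ᵐ[volume] 0 := by
  have hw' : HasWeakGradient w (fun _ => (0 : Space N)) := hw.congr EventuallyEq.rfl hG
  refine ae_eq_zero_of_integral_contDiff_smul_eq_zero hw.1 fun h hh hc => ?_
  have hd : ∀ τ : ℝ, 0 < τ → HasDerivAt (fun t : ℝ => ∫ x, h x * w (t • x)) 0 τ := by
    intro τ hτ
    simpa using hw'.hasDerivAt_dilate hh hc hτ
  -- A vanishing gradient makes the pairing of `h` with the dilates of `w` independent of `t`. The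
  -- `L²` norm of those dilates decays like `t^(-N/2)`, so the constant value is zero.
  have hconst : ∀ t : ℝ, 0 < t → ∫ x, h x * w (t • x) = ∫ x, h x * w x := by
    intro t ht
    have := isOpen_Ioi.is_const_of_deriv_eq_zero (s := Set.Ioi (0 : ℝ)) (𝕜 := ℝ)
      (f := fun t : ℝ => ∫ x, h x * w (t • x)) isPreconnected_Ioi
      (fun τ hτ => (hd τ hτ).differentiableAt.differentiableWithinAt)
      (fun τ hτ => (hd τ hτ).deriv) ht (Set.mem_Ioi.2 one_pos)
    simpa using this
  have hh2 : MemLp h 2 := hh.continuous.memLp_of_hasCompactSupport hc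
  have hb : ∀ t : ℝ, 0 < t → |∫ x, h x * w x| ≤ (eLpNorm h 2 *
      (ENNReal.ofReal ((t ^ N)⁻¹) ^ (1 / (2 : ℝ≥0∞)).toReal * eLpNorm w 2)).toReal := by
    intro t ht
    have := abs_integral_mul_le (p := 2) (q := 2) (B := Set.univ) hh2 (by simp)
      (by rw [Measure.restrict_univ]; exact MemLp.comp_smul_space hw2 ht)
    rwa [hconst t ht, Measure.restrict_univ, eLpNorm_comp_smul hw2.1 2 ht] at this
  have hlim : Tendsto (fun t : ℝ => (eLpNorm h 2 *
      (ENNReal.ofReal ((t ^ N)⁻¹) ^ (1 / (2 : ℝ≥0∞)).toReal * eLpNorm w 2)).toReal) atTop (𝓝 0) := by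
    have h1 : Tendsto (fun t : ℝ => ENNReal.ofReal ((t ^ N)⁻¹)) atTop (𝓝 0) := by
      have := ENNReal.tendsto_ofReal (tendsto_inv_atTop_zero.comp
        (tendsto_pow_atTop (α := ℝ) hN.ne'))
      rw [ENNReal.ofReal_zero] at this
      exact this
    have hpos : 0 < (1 / (2 : ℝ≥0∞)).toReal := ENNReal.toReal_pos (by simp) (by simp)
    have h2 : Tendsto (fun t : ℝ => ENNReal.ofReal ((t ^ N)⁻¹) ^ (1 / (2 : ℝ≥0∞)).toReal) atTop
        (𝓝 (0 ^ (1 / (2 : ℝ≥0∞)).toReal)) := (ENNReal.continuous_rpow_const.tendsto 0).comp h1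
    rw [ENNReal.zero_rpow_of_pos hpos] at h2
    have nw : eLpNorm w 2 ≠ ⊤ := hw2.eLpNorm_ne_top
    have nh : eLpNorm h 2 ≠ ⊤ := hh2.eLpNorm_ne_top
    have h3 : Tendsto (fun t : ℝ => eLpNorm h 2 *
        (ENNReal.ofReal ((t ^ N)⁻¹) ^ (1 / (2 : ℝ≥0∞)).toReal * eLpNorm w 2)) atTop
        (𝓝 (eLpNorm h 2 * (0 * eLpNorm w 2))) :=
      ENNReal.Tendsto.const_mul (ENNReal.Tendsto.mul_const h2 (Or.inr nw)) (Or.inr nh)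
    rw [zero_mul, mul_zero] at h3
    exact (ENNReal.continuousAt_toReal ENNReal.zero_ne_top).tendsto.comp h3
  have h0 : |∫ x, h x * w x| ≤ 0 :=
    ge_of_tendsto hlim ((eventually_gt_atTop 0).mono fun t ht => hb t ht)
  simpa using abs_nonpos_iff.1 h0

end DilationDerivative

/-! ### Power kernels: integrals over balls and the sublevel estimate. -/

section RieszKernel

variable {N : ℕ}

/-- The power kernel `‖z‖^(-λ)` as an extended nonnegative function. -/
noncomputable def powKernel (l : ℝ) (z : Space N) : ℝ≥0∞ := ENNReal.ofReal (‖z‖ ^ (-l))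

theorem measurable_powKernel (l : ℝ) : Measurable (powKernel l : Space N → ℝ≥0∞) :=
  (measurable_norm.pow_const _).ennreal_ofReal

theorem powKernel_neg (l : ℝ) (z : Space N) : powKernel l (-z) = powKernel l z := by
  simp [powKernel]

theorem powKernel_smul (l : ℝ) {t : ℝ} (ht : 0 < t) (z : Space N) :
    powKernel l (t • z) = ENNReal.ofReal (t ^ (-l)) * powKernel l z := by
  rw [powKernel, powKernel, norm_smul, Real.norm_of_nonneg ht.le,
    Real.mul_rpow ht.le (norm_nonneg _), ENNReal.ofReal_mul (by positivity)]

theorem powKernel_rpow (l : ℝ) {s : ℝ} (hs : 0 ≤ s) (z : Space N) :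
    powKernel l z ^ s = powKernel (l * s) z := by
  rw [powKernel, powKernel, ENNReal.ofReal_rpow_of_nonneg (by positivity) hs, ← Real.rpow_mul
    (norm_nonneg _), neg_mul]

theorem lintegral_comp_smul_space {F : Space N → ℝ≥0∞} (hF : Measurable F) {t : ℝ} (ht : 0 < t) :
    ∫⁻ x, F x = ENNReal.ofReal (t ^ N) * ∫⁻ x, F (t • x) := by
  have h := lintegral_map (μ := (volume : Measure (Space N))) hF (measurable_const_smul t)
  rw [map_smul_volume ht, lintegral_smul_measure, smul_eq_mul] at h
  rw [← h, ← mul_assoc, ← ENNReal.ofReal_mul (by positivity), mul_inv_cancel₀ (by positivity),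
    ENNReal.ofReal_one, one_mul]

theorem lintegral_powKernel_unit_lt_top (hN : 1 ≤ N) {l : ℝ} (hl : l < N) :
    ∫⁻ z in Metric.ball (0 : Space N) 1, powKernel l z < ⊤ := by
  have := integrableOn_ball_of_norm_le_rpow (μ := (volume : Measure (Space N)))
    (E := Space N) (f := fun z : Space N => ‖z‖ ^ (-l)) (C := 1) (α := l) (r := 1) (by simpa using hN)
    (by simpa using hl) (Eventually.of_forall fun x => by
      rw [one_mul, Real.norm_of_nonneg (by positivity)])
    (measurable_norm.pow_const _).aestronglyMeasurable
  exact (hasFiniteIntegral_iff_ofReal (Eventually.of_forall fun x => by positivity)).1 this.2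

theorem lintegral_powKernel_compl_unit_lt_top (hN : 1 ≤ N) {l : ℝ} (hl : (N : ℝ) < l) :
    ∫⁻ z in (Metric.ball (0 : Space N) 1)ᶜ, powKernel l z < ⊤ := by
  have : Nontrivial (Space N) := by
    apply Module.nontrivial_of_finrank_pos (R := ℝ)
    rw [finrank_euclideanSpace_fin]
    omega
  have h1 : IntegrableOn (fun y : ℝ => y ^ (N - 1 : ℕ) • (Set.Ici (1 : ℝ)).indicator
      (fun y => y ^ (-l)) y) (Set.Ioi 0) := by
    have h2 : IntegrableOn (fun y : ℝ => y ^ ((N : ℝ) - 1 - l)) (Set.Ici 1) := by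
      rw [integrableOn_Ici_iff_integrableOn_Ioi]
      exact integrableOn_Ioi_rpow_of_lt (by linarith) one_pos
    have h3 : Integrable ((Set.Ici (1 : ℝ)).indicator fun y : ℝ => y ^ ((N : ℝ) - 1 - l)) :=
      (integrable_indicator_iff measurableSet_Ici).2 h2
    refine (h3.integrableOn (s := Set.Ioi 0)).congr_fun (fun y hy => ?_) measurableSet_Ioi
    have hy0 : 0 < y := hy
    by_cases h : y ∈ Set.Ici (1 : ℝ)
    · simp only [Set.indicator_of_mem h, smul_eq_mul]
      rw [← Real.rpow_natCast, ← Real.rpow_add hy0, Nat.cast_sub hN]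
      congr 1
      push_cast
      ring
    · simp [Set.indicator_of_notMem h]
  have h4 := (integrable_fun_norm_addHaar (volume : Measure (Space N))
    (f := (Set.Ici (1 : ℝ)).indicator fun y : ℝ => y ^ (-l))).2 (by simpa using h1)
  rw [← lintegral_indicator Metric.isOpen_ball.measurableSet.compl]
  refine lt_of_le_of_lt (lintegral_mono fun z => ?_) h4.2
  by_cases hz : z ∈ (Metric.ball (0 : Space N) 1)ᶜ
  · rw [Set.indicator_of_mem hz]
    have : ‖z‖ ∈ Set.Ici (1 : ℝ) := by simpa using hz
    beta_reduce
    rw [show ((Set.Ici (1 : ℝ)).indicator (fun y : ℝ => y ^ (-l)) ‖z‖) = ‖z‖ ^ (-l) from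
      Set.indicator_of_mem this _, powKernel, Real.enorm_of_nonneg (by positivity)]
  · rw [Set.indicator_of_notMem hz]
    exact zero_le

theorem lintegral_powKernel_ball {l : ℝ} {R : ℝ} (hR : 0 < R) :
    ∫⁻ z in Metric.ball (0 : Space N) R, powKernel l z =
      ENNReal.ofReal (R ^ (N - l)) * ∫⁻ z in Metric.ball (0 : Space N) 1, powKernel l z := by
  rw [← lintegral_indicator Metric.isOpen_ball.measurableSet,
    ← lintegral_indicator Metric.isOpen_ball.measurableSet,
    lintegral_comp_smul_space ((measurable_powKernel l).indicator
      Metric.isOpen_ball.measurableSet) hR]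
  have e : ∀ x : Space N, (Metric.ball (0 : Space N) R).indicator (powKernel l) (R • x) =
      ENNReal.ofReal (R ^ (-l)) * (Metric.ball (0 : Space N) 1).indicator (powKernel l) x := by
    intro x
    have hiff : R • x ∈ Metric.ball (0 : Space N) R ↔ x ∈ Metric.ball (0 : Space N) 1 := by
      rw [mem_ball_zero_iff, mem_ball_zero_iff, norm_smul, Real.norm_of_nonneg hR.le]
      exact mul_lt_iff_lt_one_right hR
    by_cases h : x ∈ Metric.ball (0 : Space N) 1
    · rw [Set.indicator_of_mem h, Set.indicator_of_mem (hiff.2 h), powKernel_smul l hR]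
    · rw [Set.indicator_of_notMem h, Set.indicator_of_notMem (mt hiff.1 h), mul_zero]
  simp only [e]
  rw [lintegral_const_mul' _ _ ENNReal.ofReal_ne_top, ← mul_assoc,
    ← ENNReal.ofReal_mul (by positivity)]
  congr 2
  rw [← Real.rpow_natCast, ← Real.rpow_add hR, sub_eq_add_neg]

theorem lintegral_powKernel_compl_ball {l : ℝ} {R : ℝ} (hR : 0 < R) :
    ∫⁻ z in (Metric.ball (0 : Space N) R)ᶜ, powKernel l z =
      ENNReal.ofReal (R ^ (N - l)) * ∫⁻ z in (Metric.ball (0 : Space N) 1)ᶜ, powKernel l z := by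
  have hm : ∀ r : ℝ, MeasurableSet (Metric.ball (0 : Space N) r)ᶜ := fun r =>
    Metric.isOpen_ball.measurableSet.compl
  rw [← lintegral_indicator (hm _), ← lintegral_indicator (hm _),
    lintegral_comp_smul_space ((measurable_powKernel l).indicator (hm _)) hR]
  have e : ∀ x : Space N, (Metric.ball (0 : Space N) R)ᶜ.indicator (powKernel l) (R • x) =
      ENNReal.ofReal (R ^ (-l)) * (Metric.ball (0 : Space N) 1)ᶜ.indicator (powKernel l) x := by
    intro x
    have hiff : R • x ∈ (Metric.ball (0 : Space N) R)ᶜ ↔ x ∈ (Metric.ball (0 : Space N) 1)ᶜ := by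
      rw [Set.mem_compl_iff, Set.mem_compl_iff, mem_ball_zero_iff, mem_ball_zero_iff, norm_smul,
        Real.norm_of_nonneg hR.le]
      exact (mul_lt_iff_lt_one_right hR).not
    by_cases h : x ∈ (Metric.ball (0 : Space N) 1)ᶜ
    · rw [Set.indicator_of_mem h, Set.indicator_of_mem (hiff.2 h), powKernel_smul l hR]
    · rw [Set.indicator_of_notMem h, Set.indicator_of_notMem (mt hiff.1 h), mul_zero]
  simp only [e]
  rw [lintegral_const_mul' _ _ ENNReal.ofReal_ne_top, ← mul_assoc,
    ← ENNReal.ofReal_mul (by positivity)]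
  congr 2
  rw [← Real.rpow_natCast, ← Real.rpow_add hR, sub_eq_add_neg]

/-- The double integral `∬ ‖x - y‖^(-(N-α)) f(x) g(y)`. -/
noncomputable def rieszForm (l : ℝ) (f g : Space N → ℝ≥0∞) : ℝ≥0∞ :=
  ∫⁻ y, ∫⁻ x, powKernel l (x - y) * f x * g y

variable {α : ℝ}

theorem hls_conjugate (hα0 : 0 < α) (hαN : α < N) :
    (2 * N / (N + α) : ℝ).HolderConjugate (2 * N / (N - α)) := by
  have hN : (0 : ℝ) < N := hα0.trans hαN
  rw [Real.holderConjugate_iff]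
  refine ⟨?_, ?_⟩
  · rw [lt_div_iff₀ (by linarith)]; linarith
  · rw [inv_div, inv_div]; field_simp; ring

/-- Constants of the truncated kernel estimate. -/
noncomputable def hlsNear (N : ℕ) (α : ℝ) : ℝ≥0∞ :=
  ∫⁻ z in Metric.ball (0 : Space N) 1, powKernel (N - α) z

/-- The exponent `2N` is `N - α` times the dual exponent `2N/(N - α)`; the outer power completes the
corresponding norm of the kernel away from the origin. -/
noncomputable def hlsFar (N : ℕ) (α : ℝ) : ℝ≥0∞ :=
  (∫⁻ z in (Metric.ball (0 : Space N) 1)ᶜ, powKernel (2 * N) z) ^ ((N - α) / (2 * N) : ℝ)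

theorem hlsNear_lt_top (hα0 : 0 < α) (hαN : α < N) : hlsNear N α < ⊤ := by
  have hN : (0 : ℝ) < N := hα0.trans hαN
  exact lintegral_powKernel_unit_lt_top (Nat.cast_pos.1 hN) (by linarith)

theorem hlsFar_lt_top (hα0 : 0 < α) (hαN : α < N) : hlsFar N α < ⊤ := by
  have hN : (0 : ℝ) < N := hα0.trans hαN
  refine ENNReal.rpow_lt_top_of_nonneg (div_nonneg (by linarith) (by linarith)) ?_
  exact (lintegral_powKernel_compl_unit_lt_top (Nat.cast_pos.1 hN) (by linarith)).ne

/-- The kernel is split at a radius `R` around `y`. Inside, `f ≤ t` and local integrability of the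
kernel give a multiple of `t R^α`; outside, Hölder gives a multiple of `R^(-(N - α)/2)` times the
norm of `f`. The choice `R = t^(-2/(N + α))` turns both into the same power of `t`. -/
theorem lintegral_sublevel_powKernel_le (hα0 : 0 < α) (hαN : α < N) {f : Space N → ℝ≥0∞}
    (hf : Measurable f) {t : ℝ} (ht : 0 < t) (y : Space N) :
    ∫⁻ x in {x | f x ≤ ENNReal.ofReal t}, powKernel (N - α) (x - y) * f x ≤
      ENNReal.ofReal t ^ ((N - α) / (N + α) : ℝ) * (hlsNear N α + hlsFar N α *
        (∫⁻ x, f x ^ (2 * N / (N + α) : ℝ)) ^ ((N + α) / (2 * N) : ℝ)) := by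
  have hN : (0 : ℝ) < N := hα0.trans hαN
  have hNα : (0 : ℝ) < N + α := by linarith
  set R : ℝ := t ^ (-2 / (N + α) : ℝ) with hRdef
  have hR : 0 < R := Real.rpow_pos_of_pos ht _
  set A := {x | f x ≤ ENNReal.ofReal t} with hA
  have hAm : MeasurableSet A := hf measurableSet_Iic
  set k : Space N → ℝ≥0∞ := fun x => powKernel (N - α) (x - y) with hk
  have hkm : Measurable k := (measurable_powKernel _).comp (measurable_id.sub_const y)
  have hbm : MeasurableSet (Metric.ball y R) := Metric.isOpen_ball.measurableSet
  have shift : ∀ (B : Set (Space N)) (hB : MeasurableSet B) (l : ℝ),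
      ∫⁻ x in (fun x => x - y) ⁻¹' B, powKernel l (x - y) = ∫⁻ z in B, powKernel l z := by
    intro B hB l
    have hB' : MeasurableSet ((fun x : Space N => x - y) ⁻¹' B) := (measurable_sub_const y) hB
    rw [← lintegral_indicator hB', ← lintegral_indicator hB,
      ← lintegral_sub_right_eq_self (fun z => B.indicator (powKernel l) z) y]
    rfl
  have hball : Metric.ball y R = (fun x => x - y) ⁻¹' Metric.ball (0 : Space N) R := by
    ext x; simp [dist_eq_norm]
  have e0 : ENNReal.ofReal t ^ ((N - α) / (N + α) : ℝ) = ENNReal.ofReal (t ^ ((N - α) / (N + α) : ℝ)) :=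
    ENNReal.ofReal_rpow_of_nonneg ht.le (div_nonneg (by linarith) hNα.le)
  have near : ∫⁻ x in A ∩ Metric.ball y R, k x * f x ≤
      ENNReal.ofReal t ^ ((N - α) / (N + α) : ℝ) * hlsNear N α := by
    calc ∫⁻ x in A ∩ Metric.ball y R, k x * f x
        ≤ ∫⁻ x in A ∩ Metric.ball y R, k x * ENNReal.ofReal t :=
          setLIntegral_mono' (hAm.inter hbm) fun x hx => mul_le_mul' le_rfl hx.1
      _ ≤ ∫⁻ x in Metric.ball y R, k x * ENNReal.ofReal t :=
          lintegral_mono_set Set.inter_subset_right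
      _ = (∫⁻ x in Metric.ball y R, k x) * ENNReal.ofReal t :=
          lintegral_mul_const' _ _ ENNReal.ofReal_ne_top
      _ = ENNReal.ofReal t ^ ((N - α) / (N + α) : ℝ) * hlsNear N α := by
          rw [hball, shift _ Metric.isOpen_ball.measurableSet, lintegral_powKernel_ball hR,
            ← hlsNear, mul_right_comm, ← ENNReal.ofReal_mul (by positivity), e0]
          congr 2
          rw [hRdef, ← Real.rpow_mul ht.le]
          nth_rewrite 2 [← Real.rpow_one t]
          rw [← Real.rpow_add ht]
          congr 1
          field_simp
          ring
  have far : ∫⁻ x in A \ Metric.ball y R, k x * f x ≤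
      ENNReal.ofReal t ^ ((N - α) / (N + α) : ℝ) * (hlsFar N α *
        (∫⁻ x, f x ^ (2 * N / (N + α) : ℝ)) ^ ((N + α) / (2 * N) : ℝ)) := by
    have hconj := (hls_conjugate hα0 hαN).symm
    have hr0 : (0 : ℝ) ≤ 2 * N / (N - α) := hconj.nonneg
    calc ∫⁻ x in A \ Metric.ball y R, k x * f x ≤ ∫⁻ x in (Metric.ball y R)ᶜ, (k * f) x :=
          lintegral_mono_set fun x hx => hx.2
      _ ≤ (∫⁻ x in (Metric.ball y R)ᶜ, k x ^ (2 * N / (N - α) : ℝ)) ^ (1 / (2 * N / (N - α)) : ℝ) *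
          (∫⁻ x in (Metric.ball y R)ᶜ, f x ^ (2 * N / (N + α) : ℝ)) ^ (1 / (2 * N / (N + α)) : ℝ) :=
          ENNReal.lintegral_mul_le_Lp_mul_Lq _ hconj hkm.aemeasurable hf.aemeasurable
      _ ≤ (ENNReal.ofReal t ^ ((N - α) / (N + α) : ℝ) * hlsFar N α) *
          (∫⁻ x, f x ^ (2 * N / (N + α) : ℝ)) ^ ((N + α) / (2 * N) : ℝ) := by
          rw [one_div_div, one_div_div]
          refine mul_le_mul' (le_of_eq ?_) (ENNReal.rpow_le_rpow (setLIntegral_le_lintegral _ _)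
            (div_nonneg hNα.le (by linarith)))
          have e1 : ∀ x, k x ^ (2 * N / (N - α) : ℝ) = powKernel (2 * N) (x - y) := by
            intro x
            rw [hk]
            simp only
            rw [powKernel_rpow _ hr0]
            congr 1
            have : (N : ℝ) - α ≠ 0 := by linarith
            field_simp
          simp only [e1]
          rw [hball, ← Set.preimage_compl, shift _ Metric.isOpen_ball.measurableSet.compl,
            lintegral_powKernel_compl_ball hR, ENNReal.mul_rpow_of_nonneg _ _
              (div_nonneg (by linarith) (by linarith)), ← hlsFar, e0]
          congr 1
          rw [ENNReal.ofReal_rpow_of_nonneg (by positivity) (div_nonneg (by linarith) (by linarith)),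
            hRdef, ← Real.rpow_mul ht.le, ← Real.rpow_mul ht.le]
          congr 2
          field_simp
          ring
      _ = _ := by rw [mul_assoc]
  calc ∫⁻ x in A, k x * f x = (∫⁻ x in A ∩ Metric.ball y R, k x * f x) +
        ∫⁻ x in A \ Metric.ball y R, k x * f x := (lintegral_inter_add_sdiff _ _ hbm).symm
    _ ≤ _ := by
        rw [mul_add]
        exact add_le_add near far

end RieszKernel

/-! ### The diagonal Hardy–Littlewood–Sobolev inequality. -/

section HardyLittlewoodSobolev

variable {N : ℕ} {α : ℝ}

theorem measurable_powKernel_sub (l : ℝ) :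
    Measurable fun z : Space N × Space N => powKernel l (z.1 - z.2) :=
  (measurable_powKernel l).comp (measurable_fst.sub measurable_snd)

/-- By symmetry, at most twice the part where `f x ≤ f y` has to be controlled. There the sublevel
estimate at height `t = f y` applies, and `(N - α)/(N + α) + 1 = 2N/(N + α)` is exactly the exponent
of the Lebesgue norm. -/
theorem rieszForm_self_le (hα0 : 0 < α) (hαN : α < N) {f : Space N → ℝ≥0∞}
    (hf : Measurable f) (hfin : ∀ x, f x ≠ ⊤) :
    rieszForm (N - α) f f ≤ 2 * ((hlsNear N α + hlsFar N α *
        (∫⁻ x, f x ^ (2 * N / (N + α) : ℝ)) ^ ((N + α) / (2 * N) : ℝ)) *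
        ∫⁻ x, f x ^ (2 * N / (N + α) : ℝ)) := by
  have hN : (0 : ℝ) < N := hα0.trans hαN
  have hNα : (0 : ℝ) < N + α := by linarith
  set C := hlsNear N α + hlsFar N α *
        (∫⁻ x, f x ^ (2 * N / (N + α) : ℝ)) ^ ((N + α) / (2 * N) : ℝ) with hC
  set H : Space N × Space N → ℝ≥0∞ := {z : Space N × Space N | f z.1 ≤ f z.2}.indicator
    fun z => powKernel (N - α) (z.1 - z.2) * f z.1 * f z.2 with hH
  have hHm : Measurable H := by
    refine Measurable.indicator ?_ (measurableSet_le (hf.comp measurable_fst) (hf.comp measurable_snd))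
    exact ((measurable_powKernel_sub _).mul (hf.comp measurable_fst)).mul (hf.comp measurable_snd)
  have hrow : ∀ y, ∫⁻ x, H (x, y) ≤ C * f y ^ (2 * N / (N + α) : ℝ) := by
    intro y
    have hy := hfin y
    rcases eq_or_ne (f y) 0 with h0 | h0
    · have : ∀ x, H (x, y) = 0 := fun x => by
        by_cases hx : (x, y) ∈ {z : Space N × Space N | f z.1 ≤ f z.2}
        · rw [hH, Set.indicator_of_mem hx]; simp [h0]
        · rw [hH, Set.indicator_of_notMem hx]
      simp [this]
    · have ht : 0 < (f y).toReal := ENNReal.toReal_pos h0 hy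
      have e : ENNReal.ofReal (f y).toReal = f y := ENNReal.ofReal_toReal hy
      have hA : MeasurableSet {x | f x ≤ f y} := hf measurableSet_Iic
      calc ∫⁻ x, H (x, y) = ∫⁻ x, {x | f x ≤ f y}.indicator
            (fun x => powKernel (N - α) (x - y) * f x) x * f y := by
            refine lintegral_congr fun x => ?_
            by_cases hx : f x ≤ f y
            · have h1 : (x, y) ∈ {z : Space N × Space N | f z.1 ≤ f z.2} := hx
              have h2 : x ∈ {x | f x ≤ f y} := hx
              rw [hH, Set.indicator_of_mem h1, Set.indicator_of_mem h2]
            · have h1 : (x, y) ∉ {z : Space N × Space N | f z.1 ≤ f z.2} := hx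
              have h2 : x ∉ {x | f x ≤ f y} := hx
              rw [hH, Set.indicator_of_notMem h1, Set.indicator_of_notMem h2, zero_mul]
        _ = (∫⁻ x in {x | f x ≤ f y}, powKernel (N - α) (x - y) * f x) * f y := by
            rw [lintegral_mul_const' _ _ hy, lintegral_indicator hA]
        _ ≤ (f y ^ ((N - α) / (N + α) : ℝ) * C) * f y := by
            refine mul_le_mul' ?_ le_rfl
            have := lintegral_sublevel_powKernel_le hα0 hαN hf ht y
            rwa [e] at this
        _ = C * f y ^ (2 * N / (N + α) : ℝ) := by
            rw [mul_comm (f y ^ _) C, mul_assoc]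
            congr 1
            nth_rewrite 2 [← ENNReal.rpow_one (f y)]
            rw [← ENNReal.rpow_add _ _ h0 hy]
            congr 1
            field_simp
            ring
  have hle : ∀ x y, powKernel (N - α) (x - y) * f x * f y ≤ H (x, y) + H (y, x) := by
    intro x y
    rcases le_total (f x) (f y) with hx | hx
    · have h1 : (x, y) ∈ {z : Space N × Space N | f z.1 ≤ f z.2} := hx
      rw [hH, Set.indicator_of_mem h1]
      exact le_self_add
    · have h1 : (y, x) ∈ {z : Space N × Space N | f z.1 ≤ f z.2} := hx
      rw [hH, Set.indicator_of_mem h1]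
      refine le_trans (le_of_eq ?_) le_add_self
      simp only
      rw [← neg_sub x y, powKernel_neg, mul_right_comm]
  have hswap : Measurable fun z : Space N × Space N => H (z.2, z.1) := hHm.comp measurable_swap
  calc rieszForm (N - α) f f ≤ ∫⁻ y, ∫⁻ x, (H (x, y) + H (y, x)) :=
        lintegral_mono fun y => lintegral_mono fun x => hle x y
    _ = ∫⁻ y, ((∫⁻ x, H (x, y)) + ∫⁻ x, H (y, x)) :=
        lintegral_congr fun y => lintegral_add_left (hHm.comp measurable_prodMk_right) _
    _ = (∫⁻ y, ∫⁻ x, H (x, y)) + ∫⁻ y, ∫⁻ x, H (y, x) :=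
        lintegral_add_left (hHm.lintegral_prod_left') _
    _ = (∫⁻ y, ∫⁻ x, H (x, y)) + ∫⁻ y, ∫⁻ x, H (x, y) := by
        congr 1
        exact lintegral_lintegral_swap hHm.aemeasurable
    _ ≤ 2 * (C * ∫⁻ x, f x ^ (2 * N / (N + α) : ℝ)) := by
        rw [← two_mul, ← lintegral_const_mul _ (hf.pow_const _)]
        exact mul_le_mul' le_rfl (lintegral_mono hrow)

theorem rieszForm_mono {l : ℝ} {f g f' g' : Space N → ℝ≥0∞} (h1 : ∀ x, f x ≤ f' x)
    (h2 : ∀ x, g x ≤ g' x) : rieszForm l f g ≤ rieszForm l f' g' :=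
  lintegral_mono fun y => lintegral_mono fun x => mul_le_mul' (mul_le_mul' le_rfl (h1 x)) (h2 y)

/-- Since `f` and `g` are both at most `f + g`, the diagonal estimate for the sum suffices. The
constant is not homogeneous, but uniformity over the unit ball is all that duality requires. -/
theorem exists_rieszForm_bound (hα0 : 0 < α) (hαN : α < N) {f : Space N → ℝ≥0∞}
    (hf : Measurable f) (hfin : ∀ x, f x ≠ ⊤) (hfr : ∫⁻ x, f x ^ (2 * N / (N + α) : ℝ) ≠ ⊤) :
    ∃ M : ℝ≥0∞, M ≠ ⊤ ∧ ∀ g : Space N → ℝ≥0∞, Measurable g → (∀ x, g x ≠ ⊤) →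
      ∫⁻ x, g x ^ (2 * N / (N + α) : ℝ) ≤ 1 → rieszForm (N - α) f g ≤ M := by
  have hN : (0 : ℝ) < N := hα0.trans hαN
  have hNα : (0 : ℝ) < N + α := by linarith
  have hr1 : 1 ≤ (2 * N / (N + α) : ℝ) := (hls_conjugate hα0 hαN).lt.le
  set r : ℝ := 2 * N / (N + α) with hr
  set T : ℝ≥0∞ := 2 ^ (r - 1) * ((∫⁻ x, f x ^ r) + 1) with hT
  have hTtop : T ≠ ⊤ := ENNReal.mul_ne_top
    (ENNReal.rpow_ne_top_of_nonneg (by linarith) (by simp)) (by simp [hfr])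
  have hCtop : ∀ S : ℝ≥0∞, S ≤ T → 2 * ((hlsNear N α + hlsFar N α *
      S ^ ((N + α) / (2 * N) : ℝ)) * S) ≤ 2 * ((hlsNear N α + hlsFar N α *
      T ^ ((N + α) / (2 * N) : ℝ)) * T) := by
    intro S hS
    have : S ^ ((N + α) / (2 * N) : ℝ) ≤ T ^ ((N + α) / (2 * N) : ℝ) :=
      ENNReal.rpow_le_rpow hS (by positivity)
    gcongr
  refine ⟨2 * ((hlsNear N α + hlsFar N α * T ^ ((N + α) / (2 * N) : ℝ)) * T), ?_,
    fun g hg hgfin hg1 => ?_⟩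
  swap
  · refine le_trans ?_ (hCtop (∫⁻ x, (f x + g x) ^ r) ?_)
    · refine le_trans (rieszForm_mono (f' := fun x => f x + g x) (g' := fun x => f x + g x)
        (fun x => le_self_add) fun x => le_add_self) ?_
      exact rieszForm_self_le hα0 hαN (hf.add hg) fun x => ENNReal.add_ne_top.2 ⟨hfin x, hgfin x⟩
    · calc ∫⁻ x, (f x + g x) ^ r ≤ ∫⁻ x, 2 ^ (r - 1) * (f x ^ r + g x ^ r) :=
            lintegral_mono fun x => ENNReal.rpow_add_le_mul_rpow_add_rpow _ _ hr1
        _ = 2 ^ (r - 1) * ((∫⁻ x, f x ^ r) + ∫⁻ x, g x ^ r) := by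
            rw [lintegral_const_mul' _ _ (ENNReal.rpow_ne_top_of_nonneg (by linarith) (by simp)),
              lintegral_add_left (hf.pow_const _)]
        _ ≤ T := by rw [hT]; gcongr
  · refine ENNReal.mul_ne_top (by simp) (ENNReal.mul_ne_top (ENNReal.add_ne_top.2
      ⟨(hlsNear_lt_top hα0 hαN).ne, ENNReal.mul_ne_top (hlsFar_lt_top hα0 hαN).ne ?_⟩) hTtop)
    exact ENNReal.rpow_ne_top_of_nonneg (by positivity) hTtop

/-- A function whose pairing with the unit ball of `L^r` is bounded lies in the dual space. -/
theorem lintegral_rpow_le_of_pairing_le {r r' : ℝ} (hr : r.HolderConjugate r') {I : Space N → ℝ≥0∞}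
    (hI : Measurable I) {M : ℝ≥0∞} (hM : ∀ g : Space N → ℝ≥0∞, Measurable g → (∀ x, g x ≠ ⊤) →
      ∫⁻ x, g x ^ r ≤ 1 → ∫⁻ x, I x * g x ≤ M) : ∫⁻ x, I x ^ r' ≤ M ^ r' := by
  have hr0 : 0 < r := hr.pos
  have hr0' : 0 < r' := hr.symm.pos
  -- Truncating in height and to a ball makes the dual norm finite, so that it may be divided out;
  -- monotone approximation and Fatou then recover `I`.
  set H : ℕ → Space N → ℝ≥0∞ := fun n => (Metric.closedBall 0 (n : ℝ)).indicator
    fun x => min (I x) n with hH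
  have hHm : ∀ n, Measurable (H n) := fun n =>
    (hI.min measurable_const).indicator Metric.isClosed_closedBall.measurableSet
  have hHle : ∀ n x, H n x ≤ I x := fun n x => by
    rw [hH]
    exact (Set.indicator_le_self _ _ _).trans (min_le_left _ _)
  have hHn : ∀ n x, H n x ≤ n := fun n x => by
    rw [hH]
    exact (Set.indicator_le_self _ _ _).trans (min_le_right _ _)
  have hHtop : ∀ n x, H n x ≠ ⊤ := fun n x => ne_top_of_le_ne_top (by simp) (hHn n x)
  have hS : ∀ n, ∫⁻ x, H n x ^ r' ≤ M ^ r' := by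
    intro n
    set S := ∫⁻ x, H n x ^ r' with hSdef
    have hStop : S ≠ ⊤ := by
      refine ne_top_of_le_ne_top (b := ∫⁻ x in Metric.closedBall (0 : Space N) n, (n : ℝ≥0∞) ^ r') ?_ ?_
      · rw [setLIntegral_const]
        exact ENNReal.mul_ne_top (ENNReal.rpow_ne_top_of_nonneg hr0'.le (by simp))
          (isCompact_closedBall _ _).measure_lt_top.ne
      · rw [hSdef, ← lintegral_indicator Metric.isClosed_closedBall.measurableSet]
        refine lintegral_mono fun x => ?_
        by_cases hx : x ∈ Metric.closedBall (0 : Space N) n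
        · rw [Set.indicator_of_mem hx]
          exact ENNReal.rpow_le_rpow (hHn n x) hr0'.le
        · have h0 : H n x = 0 := Set.indicator_of_notMem hx _
          rw [h0, ENNReal.zero_rpow_of_pos hr0']
          exact zero_le
    rcases eq_or_ne S 0 with hS0 | hS0
    · rw [hS0]; exact zero_le
    have hinv : S ^ (-(1 / r)) ≠ ⊤ := ENNReal.rpow_ne_top_of_ne_zero hS0 hStop
    have hcoe : r' - 1 = r' / r := by
      rw [sub_eq_iff_eq_add, div_eq_mul_inv]
      have := hr.inv_add_inv_eq_one
      field_simp at this ⊢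
      linarith
    -- The extremal function of Hölder's inequality, normalised to have unit norm in `L^r`.
    have h1 := hM (fun x => H n x ^ (r' - 1) * S ^ (-(1 / r)))
      (((hHm n).pow_const _).mul_const _)
      (fun x => ENNReal.mul_ne_top (ENNReal.rpow_ne_top_of_nonneg
        (by linarith [hr.symm.lt]) (hHtop n x)) hinv) (by
        simp only [ENNReal.mul_rpow_of_nonneg _ _ hr0.le, ← ENNReal.rpow_mul]
        rw [lintegral_mul_const' _ _ (ENNReal.rpow_ne_top_of_ne_zero hS0 hStop)]
        rw [hcoe, div_mul_cancel₀ _ hr0.ne', neg_mul, one_div_mul_cancel hr0.ne',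
          ENNReal.rpow_neg_one, ENNReal.mul_inv_cancel hS0 hStop])
    have h2 : S * S ^ (-(1 / r)) ≤ M := by
      refine le_trans ?_ h1
      rw [hSdef, ← lintegral_mul_const' _ _ hinv]
      refine lintegral_mono fun x => ?_
      rw [← mul_assoc]
      refine mul_le_mul' ?_ le_rfl
      rcases eq_or_ne (H n x) 0 with h0 | h0
      · rw [h0, ENNReal.zero_rpow_of_pos hr0']; exact zero_le
      · calc H n x ^ r' = H n x * H n x ^ (r' - 1) := by
              nth_rewrite 2 [← ENNReal.rpow_one (H n x)]
              rw [← ENNReal.rpow_add _ _ h0 (hHtop n x)]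
              congr 1; ring
          _ ≤ _ := mul_le_mul' (hHle n x) le_rfl
    have h3 : S * S ^ (-(1 / r)) = S ^ (1 / r') := by
      nth_rewrite 1 [← ENNReal.rpow_one S]
      rw [← ENNReal.rpow_add _ _ hS0 hStop]
      congr 1
      have := hr.inv_add_inv_eq_one
      rw [one_div, one_div]; linarith
    rw [h3] at h2
    calc S = (S ^ (1 / r')) ^ r' := by
          rw [← ENNReal.rpow_mul, one_div_mul_cancel hr0'.ne', ENNReal.rpow_one]
      _ ≤ M ^ r' := ENNReal.rpow_le_rpow h2 hr0'.le
  have hlim : ∀ x, Tendsto (fun n => H n x ^ r') atTop (𝓝 (I x ^ r')) := by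
    intro x
    refine (ENNReal.continuous_rpow_const.tendsto _).comp ?_
    have h1 : Tendsto (fun n : ℕ => min (I x) (n : ℝ≥0∞)) atTop (𝓝 (min (I x) ⊤)) :=
      tendsto_const_nhds.min ENNReal.tendsto_nat_nhds_top
    rw [min_top_right] at h1
    refine h1.congr' ?_
    filter_upwards [eventually_ge_atTop ⌈‖x‖⌉₊] with n hn
    have hx : x ∈ Metric.closedBall (0 : Space N) n := by
      rw [mem_closedBall_zero_iff]
      exact (Nat.le_ceil _).trans (by exact_mod_cast hn)
    exact (Set.indicator_of_mem hx (fun x => min (I x) (n : ℝ≥0∞))).symm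
  calc ∫⁻ x, I x ^ r' = ∫⁻ x, liminf (fun n => H n x ^ r') atTop :=
        lintegral_congr fun x => (hlim x).liminf_eq.symm
    _ ≤ liminf (fun n => ∫⁻ x, H n x ^ r') atTop :=
        lintegral_liminf_le fun n => (hHm n).pow_const _
    _ ≤ M ^ r' := by
        refine (liminf_le_liminf (Eventually.of_forall hS)).trans ?_
        simp

theorem rieszConst_pos (hα0 : 0 < α) (hαN : α < N) : 0 < rieszConst N α := by
  unfold rieszConst
  have h1 := Real.Gamma_pos_of_pos (show 0 < ((N : ℝ) - α) / 2 by linarith)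
  have h2 := Real.Gamma_pos_of_pos (show 0 < α / 2 by linarith)
  positivity

theorem rieszKernel_nonneg (hα0 : 0 < α) (hαN : α < N) (z : Space N) : 0 ≤ rieszKernel α z := by
  have := rieszConst_pos hα0 hαN
  unfold rieszKernel
  positivity

theorem measurable_rieszKernel : Measurable (rieszKernel α : Space N → ℝ) :=
  measurable_const.div (measurable_norm.pow_const _)

theorem ofReal_rieszKernel (hα0 : 0 < α) (hαN : α < N) (z : Space N) :
    ENNReal.ofReal (rieszKernel α z) = ENNReal.ofReal (rieszConst N α) * powKernel (N - α) z := by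
  rw [rieszKernel, powKernel, ← ENNReal.ofReal_mul (rieszConst_pos hα0 hαN).le,
    Real.rpow_neg (norm_nonneg _), div_eq_mul_inv]

theorem rieszPotential_congr {F F' : Space N → ℝ} (h : F =ᵐ[volume] F') :
    rieszPotential α F = rieszPotential α F' := by
  funext x
  exact integral_congr_ae (h.mono fun y hy => by simp only [hy])

theorem exists_measurable_rep {F : Space N → ℝ} (hF : AEStronglyMeasurable F) (hF0 : ∀ x, 0 ≤ F x) :
    ∃ F' : Space N → ℝ, Measurable F' ∧ (∀ x, 0 ≤ F' x) ∧ F =ᵐ[volume] F' := by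
  refine ⟨fun x => |hF.mk F x|, hF.stronglyMeasurable_mk.measurable.abs, fun x => abs_nonneg _, ?_⟩
  filter_upwards [hF.ae_eq_mk] with x hx
  rw [← hx, abs_of_nonneg (hF0 x)]

theorem lintegral_rpow_ne_top {F : Space N → ℝ} {r : ℝ} (hr : 0 < r)
    (hF : MemLp F (ENNReal.ofReal r)) (hF0 : ∀ x, 0 ≤ F x) :
    ∫⁻ x, ENNReal.ofReal (F x) ^ r ≠ ⊤ := by
  have h := (eLpNorm_lt_top_iff_lintegral_rpow_enorm_lt_top (by simpa using hr)
    ENNReal.ofReal_ne_top).1 hF.eLpNorm_lt_top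
  rw [ENNReal.toReal_ofReal hr.le] at h
  simpa only [Real.enorm_of_nonneg (hF0 _)] using h.ne

/-- The Hardy–Littlewood–Sobolev inequality, diagonal case, qualitative form. -/
theorem memLp_rieszPotential (hα0 : 0 < α) (hαN : α < N) {F : Space N → ℝ} (hF0 : ∀ x, 0 ≤ F x)
    (hF : MemLp F (ENNReal.ofReal (2 * N / (N + α)))) :
    MemLp (rieszPotential α F) (ENNReal.ofReal (2 * N / (N - α))) ∧
      Integrable fun x => rieszPotential α F x * F x := by
  obtain ⟨F', hF'm, hF'0, hFF'⟩ := exists_measurable_rep hF.1 hF0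
  have hconj := hls_conjugate hα0 hαN
  rw [rieszPotential_congr hFF']
  have hF' := (memLp_congr_ae hFF').1 hF
  set f : Space N → ℝ≥0∞ := fun x => ENNReal.ofReal (F' x) with hf
  have hfm : Measurable f := hF'm.ennreal_ofReal
  have hfr : ∫⁻ x, f x ^ (2 * N / (N + α) : ℝ) ≠ ⊤ := lintegral_rpow_ne_top hconj.pos hF' hF'0
  obtain ⟨M, hM, hbound⟩ := exists_rieszForm_bound hα0 hαN hfm (fun x => ENNReal.ofReal_ne_top) hfr
  set I : Space N → ℝ≥0∞ := fun y => ∫⁻ x, powKernel (N - α) (x - y) * f x with hI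
  have hIm : Measurable I := Measurable.lintegral_prod_left'
    ((measurable_powKernel_sub (N - α)).mul (hfm.comp measurable_fst))
  have hIr := lintegral_rpow_le_of_pairing_le hconj hIm (M := M) fun g hg hgfin hg1 => by
    refine le_trans (le_of_eq ?_) (hbound g hg hgfin hg1)
    refine lintegral_congr fun y => ?_
    rw [hI, ← lintegral_mul_const' _ _ (hgfin y)]
  have hmeas : StronglyMeasurable (rieszPotential α F') := by
    refine StronglyMeasurable.integral_prod_right'
      (f := fun z : Space N × Space N => rieszKernel α (z.1 - z.2) * F' z.2) ?_
    exact ((measurable_rieszKernel.comp (measurable_fst.sub measurable_snd)).mul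
      (hF'm.comp measurable_snd)).stronglyMeasurable
  have hle : ∀ x, ‖rieszPotential α F' x‖ₑ ≤ ENNReal.ofReal (rieszConst N α) * I x := by
    intro x
    refine (enorm_integral_le_lintegral_enorm _).trans (le_of_eq ?_)
    rw [hI, ← lintegral_const_mul' _ _ ENNReal.ofReal_ne_top]
    refine lintegral_congr fun y => ?_
    rw [enorm_mul, Real.enorm_of_nonneg (rieszKernel_nonneg hα0 hαN _),
      Real.enorm_of_nonneg (hF'0 y), ofReal_rieszKernel hα0 hαN, ← neg_sub y x, powKernel_neg,
      mul_assoc]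
  have hmem : MemLp (rieszPotential α F') (ENNReal.ofReal (2 * N / (N - α))) := by
    refine ⟨hmeas.aestronglyMeasurable, ?_⟩
    rw [eLpNorm_lt_top_iff_lintegral_rpow_enorm_lt_top (by simpa using hconj.symm.pos)
      ENNReal.ofReal_ne_top, ENNReal.toReal_ofReal hconj.symm.nonneg]
    calc ∫⁻ x, ‖rieszPotential α F' x‖ₑ ^ (2 * N / (N - α) : ℝ)
        ≤ ∫⁻ x, (ENNReal.ofReal (rieszConst N α) * I x) ^ (2 * N / (N - α) : ℝ) :=
          lintegral_mono fun x => ENNReal.rpow_le_rpow (hle x) hconj.symm.nonneg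
      _ = ENNReal.ofReal (rieszConst N α) ^ (2 * N / (N - α) : ℝ) *
            ∫⁻ x, I x ^ (2 * N / (N - α) : ℝ) := by
          simp only [ENNReal.mul_rpow_of_nonneg _ _ hconj.symm.nonneg]
          exact lintegral_const_mul' _ _
            (ENNReal.rpow_ne_top_of_nonneg hconj.symm.nonneg ENNReal.ofReal_ne_top)
      _ < ⊤ := ENNReal.mul_lt_top
          (ENNReal.rpow_lt_top_of_nonneg hconj.symm.nonneg ENNReal.ofReal_ne_top)
          (hIr.trans_lt (ENNReal.rpow_lt_top_of_nonneg hconj.symm.nonneg hM))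
  refine ⟨hmem, ?_⟩
  have hH : (ENNReal.ofReal (2 * N / (N - α))).HolderConjugate (ENNReal.ofReal (2 * N / (N + α))) :=
    hconj.symm.ennrealOfReal
  exact MemLp.integrable_mul hmem hF

/-- The double integral defining the Riesz energy converges absolutely. -/
theorem integrable_rieszEnergy (hα0 : 0 < α) (hαN : α < N) {F : Space N → ℝ} (hF0 : ∀ x, 0 ≤ F x)
    (hF : MemLp F (ENNReal.ofReal (2 * N / (N + α)))) :
    Integrable (fun z : Space N × Space N => rieszKernel α (z.1 - z.2) * F z.1 * F z.2)
      (volume.prod volume) := by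
  obtain ⟨F', hF'm, hF'0, hFF'⟩ := exists_measurable_rep hF.1 hF0
  have hconj := hls_conjugate hα0 hαN
  have hF' := (memLp_congr_ae hFF').1 hF
  have h1 : (fun z : Space N × Space N => rieszKernel α (z.1 - z.2) * F z.1 * F z.2)
      =ᵐ[volume.prod volume] fun z => rieszKernel α (z.1 - z.2) * F' z.1 * F' z.2 := by
    filter_upwards [Measure.quasiMeasurePreserving_fst.ae hFF',
      Measure.quasiMeasurePreserving_snd.ae hFF'] with z hz1 hz2
    rw [hz1, hz2]
  refine Integrable.congr ?_ h1.symm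
  have hfm : Measurable fun x => ENNReal.ofReal (F' x) := hF'm.ennreal_ofReal
  have hfr := lintegral_rpow_ne_top hconj.pos hF' hF'0
  have hfin := rieszForm_self_le hα0 hαN hfm fun x => ENNReal.ofReal_ne_top
  have hlt : rieszForm (N - α) (fun x => ENNReal.ofReal (F' x)) (fun x => ENNReal.ofReal (F' x)) < ⊤ :=
    lt_of_le_of_lt hfin <| ENNReal.mul_lt_top (by simp) <| ENNReal.mul_lt_top
      (ENNReal.add_lt_top.2 ⟨hlsNear_lt_top hα0 hαN, ENNReal.mul_lt_top (hlsFar_lt_top hα0 hαN)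
        (ENNReal.rpow_lt_top_of_nonneg (div_nonneg (by linarith [hα0.trans hαN])
          (by linarith [hα0.trans hαN])) hfr)⟩) hfr.lt_top
  have hm : Measurable fun z : Space N × Space N => rieszKernel α (z.1 - z.2) * F' z.1 * F' z.2 :=
    ((measurable_rieszKernel.comp (measurable_fst.sub measurable_snd)).mul
      (hF'm.comp measurable_fst)).mul (hF'm.comp measurable_snd)
  refine ⟨hm.aestronglyMeasurable, ?_⟩
  rw [hasFiniteIntegral_iff_enorm, lintegral_prod_symm' _ hm.enorm]
  have e : ∀ y x : Space N, ‖rieszKernel α (x - y) * F' x * F' y‖ₑ = ENNReal.ofReal (rieszConst N α) *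
      (powKernel (N - α) (x - y) * ENNReal.ofReal (F' x) * ENNReal.ofReal (F' y)) := by
    intro y x
    rw [enorm_mul, enorm_mul, Real.enorm_of_nonneg (rieszKernel_nonneg hα0 hαN _),
      Real.enorm_of_nonneg (hF'0 x), Real.enorm_of_nonneg (hF'0 y), ofReal_rieszKernel hα0 hαN]
    ring
  simp only [e]
  simp only [lintegral_const_mul' _ _ ENNReal.ofReal_ne_top]
  exact ENNReal.mul_lt_top ENNReal.ofReal_lt_top hlt

end HardyLittlewoodSobolev

/-! ### The powers `|u|^p` and their weak gradients. -/

section Powers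

variable {N : ℕ} {u : Space N → ℝ} {Du : Space N → Space N} {p : ℝ}

/-- The odd power `|s|^(p-2) s`. -/
noncomputable def oddPow (p s : ℝ) : ℝ := |s| ^ (p - 2) * s

theorem abs_oddPow (hp : 1 < p) (s : ℝ) : |oddPow p s| = |s| ^ (p - 1) := by
  rw [oddPow, abs_mul, abs_of_nonneg (by positivity)]
  rcases eq_or_ne s 0 with rfl | h
  · rw [abs_zero, mul_zero, Real.zero_rpow (by linarith)]
  · nth_rewrite 2 [← Real.rpow_one |s|]
    rw [← Real.rpow_add (abs_pos.2 h)]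
    congr 1; ring

theorem oddPow_mul_self (hp : 1 < p) (s : ℝ) : oddPow p s * s = |s| ^ p := by
  rw [oddPow, mul_assoc, ← abs_mul_abs_self s]
  rcases eq_or_ne s 0 with rfl | h
  · rw [abs_zero, mul_zero, mul_zero, Real.zero_rpow (by linarith)]
  · nth_rewrite 2 3 [← Real.rpow_one |s|]
    rw [← Real.rpow_add (abs_pos.2 h), ← Real.rpow_add (abs_pos.2 h)]
    congr 1; ring

theorem hasDerivAt_rpow_abs (hp : 1 < p) (s : ℝ) :
    HasDerivAt (fun s : ℝ => |s| ^ p) (p * oddPow p s) s := by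
  have := hasDerivAt_abs_rpow s hp
  rwa [mul_assoc] at this

/-- For `p < 2` the factor `|s|^(p - 2)` is singular at the origin; continuity is read off from the
derivative of the `C¹` function `|s|^p`. -/
theorem continuous_oddPow (hp : 1 < p) : Continuous (oddPow p) := by
  have h1 : ContDiff ℝ 1 fun s : ℝ => ‖s‖ ^ p := contDiff_norm_rpow hp
  have h2 : Continuous (deriv fun s : ℝ => ‖s‖ ^ p) := h1.continuous_deriv le_rfl
  have h3 : deriv (fun s : ℝ => ‖s‖ ^ p) = fun s => p * oddPow p s :=
    funext fun s => (hasDerivAt_rpow_abs hp s).deriv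
  rw [h3] at h2
  have h4 : Continuous fun s => p⁻¹ * (p * oddPow p s) := continuous_const.mul h2
  exact h4.congr fun s => inv_mul_cancel_left₀ (by linarith) _

theorem rpow_mul_le_add (hp : 1 < p) {a b : ℝ} (ha : 0 ≤ a) (hb : 0 ≤ b) :
    a ^ (p - 1) * b ≤ a ^ p + b ^ p := by
  have key : ∀ c : ℝ, 0 ≤ c → c ^ (p - 1) * c = c ^ p := fun c hc => by
    rcases hc.eq_or_lt with rfl | h
    · rw [mul_zero, Real.zero_rpow (by linarith)]
    · nth_rewrite 2 [← Real.rpow_one c]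
      rw [← Real.rpow_add h]; congr 1; ring
  rcases le_total b a with h | h
  · calc a ^ (p - 1) * b ≤ a ^ (p - 1) * a := by gcongr
      _ = a ^ p := key a ha
      _ ≤ _ := le_add_of_nonneg_right (by positivity)
  · calc a ^ (p - 1) * b ≤ b ^ (p - 1) * b := by
          gcongr
      _ = b ^ p := key b hb
      _ ≤ _ := le_add_of_nonneg_left (by positivity)

theorem MemLpLoc.norm_rpow {F : Type*} [NormedAddCommGroup F] {g : Space N → F} {r : ℝ}
    (hp : 0 < p) (hg : MemLpLoc g (ENNReal.ofReal (p * r))) :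
    MemLpLoc (fun x => ‖g x‖ ^ p) (ENNReal.ofReal r) := by
  intro C hC
  have := (hg C hC).norm_rpow_div (ENNReal.ofReal p)
  rw [ENNReal.toReal_ofReal hp.le, ← ENNReal.ofReal_div_of_pos hp,
    mul_div_cancel_left₀ _ hp.ne'] at this
  exact this

theorem MemLpLoc.locallyIntegrable {F : Type*} [NormedAddCommGroup F] {g : Space N → F} {r : ℝ≥0∞}
    (hr : 1 ≤ r) (hg : MemLpLoc g r) : LocallyIntegrable g :=
  locallyIntegrable_iff.2 fun C hC => by
    have : IsFiniteMeasure (volume.restrict C) := ⟨by simpa using hC.measure_lt_top⟩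
    exact (hg C hC).integrable hr

theorem norm_oddPow_smul_le (hp : 1 < p) (s : ℝ) (v : Space N) :
    ‖(p * oddPow p s) • v‖ ≤ p * (‖s‖ ^ p + ‖v‖ ^ p) := by
  rw [norm_smul, norm_mul, Real.norm_of_nonneg (by linarith : 0 ≤ p), Real.norm_eq_abs,
    abs_oddPow hp, mul_assoc]
  exact mul_le_mul_of_nonneg_left (rpow_mul_le_add hp (abs_nonneg _) (norm_nonneg _)) (by linarith)

theorem MemLpLoc.oddPow_smul {r : ℝ} (hp : 1 < p) (hu : MemLpLoc u (ENNReal.ofReal (p * r)))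
    (hDu : MemLpLoc Du (ENNReal.ofReal (p * r))) :
    MemLpLoc (fun x => (p * oddPow p (u x)) • Du x) (ENNReal.ofReal r) := by
  intro C hC
  have h1 := MemLpLoc.norm_rpow (by linarith : 0 < p) hu C hC
  have h2 := MemLpLoc.norm_rpow (by linarith : 0 < p) hDu C hC
  refine ((h1.add h2).const_mul p).mono' ?_ (Eventually.of_forall fun x => ?_)
  · exact ((((continuous_oddPow hp).comp_aestronglyMeasurable (hu C hC).1).const_mul p).smul
      (hDu C hC).1)
  · exact norm_oddPow_smul_le hp _ _

/-- The chain rule needs a bounded derivative, so it is applied to the power of the truncation of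
`u`. The bound `|u|^(p-1) |Du| ≤ |u|^p + |Du|^p` dominates the gradients when the truncation is
removed. -/
theorem HasWeakGradient.abs_rpow (hu : HasWeakGradient u Du) (hp : 1 < p)
    (hup : MemLpLoc u (ENNReal.ofReal p)) (hDup : MemLpLoc Du (ENNReal.ofReal p)) :
    HasWeakGradient (fun x => |u x| ^ p) fun x => (p * oddPow p (u x)) • Du x := by
  have hp0 : 0 < p := by linarith
  have l1 : LocallyIntegrable fun x => ‖u x‖ ^ p := MemLpLoc.locallyIntegrable le_rfl (by
    rw [← ENNReal.ofReal_one]; exact MemLpLoc.norm_rpow hp0 (by rwa [mul_one]))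
  have l2 : LocallyIntegrable fun x => ‖Du x‖ ^ p := MemLpLoc.locallyIntegrable le_rfl (by
    rw [← ENNReal.ofReal_one]; exact MemLpLoc.norm_rpow hp0 (by rwa [mul_one]))
  set β : ℕ → ℝ → ℝ := fun n s => |ChoquardSP.trunc (truncSeq n) s| ^ p with hβ
  set β' : ℕ → ℝ → ℝ := fun n s =>
    p * oddPow p (ChoquardSP.trunc (truncSeq n) s) * truncDeriv (truncSeq n) s with hβ'
  have hd : ∀ n s, HasDerivAt (β n) (β' n s) s := fun n s =>
    (hasDerivAt_rpow_abs hp _).comp s (hasDerivAt_trunc (truncSeq_pos n).le s)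
  have htc : ∀ n, Continuous (ChoquardSP.trunc (truncSeq n)) := fun n =>
    continuous_iff_continuousAt.2 fun s => (hasDerivAt_trunc (truncSeq_pos n).le s).continuousAt
  have hc : ∀ n, Continuous (β' n) := fun n =>
    (continuous_const.mul ((continuous_oddPow hp).comp (htc n))).mul
      (continuous_truncDeriv (truncSeq_pos n).le)
  have habs : ∀ n s, |β' n s| ≤ p * |ChoquardSP.trunc (truncSeq n) s| ^ (p - 1) := fun n s => by
    rw [hβ']
    simp only
    rw [abs_mul, abs_mul, abs_of_pos hp0, abs_oddPow hp]
    exact mul_le_of_le_one_right (by positivity) (abs_truncDeriv_le (truncSeq_pos n).le s)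
  have hb : ∀ n s, |β' n s| ≤ p * (truncSeq n)⁻¹ ^ (p - 1) := fun n s =>
    (habs n s).trans (mul_le_mul_of_nonneg_left (Real.rpow_le_rpow (abs_nonneg _)
      (abs_trunc_le_inv (truncSeq_pos n) (truncSeq_le_one n) s) (by linarith)) hp0.le)
  refine HasWeakGradient.of_tendsto (fun n => hu.comp (hd n) (hc n) (hb n)) l1
    ((l1.add l2).smul p) (fun n => Eventually.of_forall fun x => ?_)
    (fun n => Eventually.of_forall fun x => ?_) (Eventually.of_forall fun x => ?_)
    (Eventually.of_forall fun x => ?_)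
  · rw [Real.norm_of_nonneg (by positivity)]
    exact Real.rpow_le_rpow (abs_nonneg _) (abs_trunc_le (truncSeq_pos n).le _) hp0.le
  · rw [norm_smul, Real.norm_eq_abs]
    calc |β' n (u x)| * ‖Du x‖ ≤ (p * |u x| ^ (p - 1)) * ‖Du x‖ := by
          refine mul_le_mul_of_nonneg_right ((habs n _).trans ?_) (norm_nonneg _)
          exact mul_le_mul_of_nonneg_left (Real.rpow_le_rpow (abs_nonneg _)
            (abs_trunc_le (truncSeq_pos n).le _) (by linarith)) hp0.le
      _ ≤ p * (‖u x‖ ^ p + ‖Du x‖ ^ p) := by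
          rw [mul_assoc]
          exact mul_le_mul_of_nonneg_left
            (rpow_mul_le_add hp (abs_nonneg _) (norm_nonneg _)) hp0.le
  · exact ((tendsto_trunc (u x)).abs).rpow_const (Or.inr hp0.le)
  · have h1 := (((continuous_oddPow hp).tendsto (u x)).comp (tendsto_trunc (u x))).const_mul p
    have h2 := (h1.mul (tendsto_truncDeriv (u x))).smul_const (Du x)
    simpa using h2

end Powers

/-! ### Cutoffs exhausting the space, with scale invariant bounds. -/

section Cutoff

variable {N : ℕ}

/-- A fixed bump function equal to one on the unit ball. -/
noncomputable def cutoffBump (N : ℕ) : ContDiffBump (0 : Space N) where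
  rIn := 1
  rOut := 2
  rIn_pos := one_pos
  rIn_lt_rOut := one_lt_two

/-- Smooth cutoff functions exhausting the space. -/
noncomputable def cutoff (n : ℕ) (x : Space N) : ℝ := cutoffBump N (((n : ℝ) + 1)⁻¹ • x)

theorem cutoff_scale_pos (n : ℕ) : 0 < ((n : ℝ) + 1)⁻¹ := by positivity

theorem cutoff_scale_le_one (n : ℕ) : ((n : ℝ) + 1)⁻¹ ≤ 1 :=
  inv_le_one_of_one_le₀ (by linarith [Nat.cast_nonneg (α := ℝ) n])

theorem contDiff_cutoff (n : ℕ) : ContDiff ℝ ∞ (cutoff n : Space N → ℝ) :=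
  (cutoffBump N).contDiff.comp (contDiff_const_smul _)

theorem hasCompactSupport_cutoff (n : ℕ) : HasCompactSupport (cutoff n : Space N → ℝ) :=
  (cutoffBump N).hasCompactSupport.comp_smul (cutoff_scale_pos n).ne'

theorem cutoff_nonneg (n : ℕ) (x : Space N) : 0 ≤ cutoff n x := (cutoffBump N).nonneg

theorem cutoff_le_one (n : ℕ) (x : Space N) : cutoff n x ≤ 1 := (cutoffBump N).le_one

/-- Equality in a neighbourhood, and not just at `x`, makes the derivatives of the cutoff vanish
there as well. -/
theorem eventually_cutoff_eq_one (x : Space N) : ∀ᶠ n : ℕ in atTop, cutoff n =ᶠ[𝓝 x] fun _ => 1 := by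
  filter_upwards [eventually_gt_atTop ⌈‖x‖⌉₊] with n hn
  have hx : ‖x‖ < (n : ℝ) + 1 := by
    have : ‖x‖ < n := (Nat.le_ceil _).trans_lt (by exact_mod_cast hn)
    linarith
  filter_upwards [(isOpen_lt continuous_norm continuous_const).mem_nhds hx] with y hy
  refine (cutoffBump N).one_of_mem_closedBall ?_
  rw [mem_closedBall_zero_iff, norm_smul, Real.norm_of_nonneg (cutoff_scale_pos n).le]
  change _ ≤ (1 : ℝ)
  rw [inv_mul_le_one₀ (by positivity)]
  exact le_of_lt hy

theorem gradient_eq_zero_of_eventuallyEq_const {η : Space N → ℝ} {x : Space N} {c : ℝ}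
    (h : η =ᶠ[𝓝 x] fun _ => c) : ∇ η x = 0 := by
  rw [gradient_eq_comp]
  simp [h.fderiv_eq]

theorem eventually_gradient_cutoff_eq_zero (x : Space N) :
    ∀ᶠ n : ℕ in atTop, ∇ (cutoff n) =ᶠ[𝓝 x] fun _ => 0 := by
  filter_upwards [eventually_cutoff_eq_one x] with n hn
  filter_upwards [hn.eventuallyEq_nhds] with y hy
  exact gradient_eq_zero_of_eventuallyEq_const hy

theorem tendsto_of_eventually_eq {X : Type*} [TopologicalSpace X] {f : ℕ → X} {a : X}
    (h : ∀ᶠ n in atTop, f n = a) : Tendsto f atTop (𝓝 a) :=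
  tendsto_const_nhds.congr' (h.mono fun _ hn => hn.symm)

theorem tendsto_cutoff (x : Space N) : Tendsto (fun n => cutoff n x) atTop (𝓝 1) :=
  tendsto_of_eventually_eq ((eventually_cutoff_eq_one x).mono fun _ h => h.self_of_nhds)

/-- The gradient of `ψ(x/R)` is of size `1/R` and lives where `|x|` is at most of order `R`, so
`|x|` times the gradient stays bounded uniformly in the scale. -/
theorem exists_dilation_gradient_bound {ψ : Space N → ℝ} (hψ : ContDiff ℝ 1 ψ)
    (hc : HasCompactSupport ψ) : ∃ C, 0 ≤ C ∧ ∀ (n : ℕ) x,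
      ‖∇ (fun y => ψ (((n : ℝ) + 1)⁻¹ • y)) x‖ ≤ C ∧
      ‖x‖ * ‖∇ (fun y => ψ (((n : ℝ) + 1)⁻¹ • y)) x‖ ≤ C := by
  have hg := ContDiff.continuous_gradient hψ
  have hgc := HasCompactSupport.gradient hc
  obtain ⟨C₁, h₁⟩ := hgc.exists_bound_of_continuous hg
  obtain ⟨C₂, h₂⟩ := (hgc.norm.mul_left (f := fun x : Space N => ‖x‖)).exists_bound_of_continuous
    (continuous_norm.mul hg.norm)
  refine ⟨max C₁ C₂, (norm_nonneg _).trans ((h₁ 0).trans (le_max_left _ _)), fun n x => ?_⟩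
  have hs := cutoff_scale_pos n
  rw [gradient_comp_smul, norm_smul, Real.norm_of_nonneg hs.le]
  constructor
  · exact ((mul_le_of_le_one_left (norm_nonneg _) (cutoff_scale_le_one n)).trans (h₁ _)).trans
      (le_max_left _ _)
  · have := h₂ (((n : ℝ) + 1)⁻¹ • x)
    simp only [Pi.mul_apply] at this
    rw [norm_mul, norm_norm, norm_norm, norm_smul, Real.norm_of_nonneg hs.le] at this
    refine le_trans (le_of_eq ?_) (this.trans (le_max_right _ _))
    ring

theorem gradient_const_mul {η : Space N → ℝ} {x : Space N} (hη : DifferentiableAt ℝ η x) (c : ℝ) :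
    ∇ (fun y => c * η y) x = c • ∇ η x := by
  rw [gradient_eq_comp, gradient_eq_comp]
  simp only
  rw [fderiv_const_mul hη, map_smul]

theorem exists_cutoff_bound (N : ℕ) : ∃ C, 0 ≤ C ∧ ∀ (n : ℕ) (x : Space N),
    ‖∇ (cutoff n) x‖ ≤ C ∧ ‖x‖ * ‖∇ (cutoff n) x‖ ≤ C ∧
      ∀ i, ‖x‖ * ‖∇ (fun y => ∇ (cutoff n) y i) x‖ ≤ C := by
  have hb : ContDiff ℝ ∞ (cutoffBump N : Space N → ℝ) := (cutoffBump N).contDiff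
  have hbc : HasCompactSupport (cutoffBump N : Space N → ℝ) := (cutoffBump N).hasCompactSupport
  obtain ⟨C₀, h0, hC₀⟩ := exists_dilation_gradient_bound (hb.of_le (by simp)) hbc
  have hp : ∀ i, ContDiff ℝ ∞ fun y => ∇ (cutoffBump N : Space N → ℝ) y i := fun i =>
    (contDiff_euclidean.1 (ContDiff.gradient_space hb)) i
  have hpc : ∀ i, HasCompactSupport fun y => ∇ (cutoffBump N : Space N → ℝ) y i := fun i =>
    (HasCompactSupport.gradient hbc).comp_left (g := fun v : Space N => v i) rfl
  choose C hCn hC using fun i => exists_dilation_gradient_bound ((hp i).of_le (by simp)) (hpc i)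
  refine ⟨C₀ + ∑ i, C i, by have := Finset.sum_nonneg (fun i (_ : i ∈ Finset.univ) => hCn i); linarith,
    fun n x => ⟨?_, ?_, fun i => ?_⟩⟩
  · exact (hC₀ n x).1.trans (le_add_of_nonneg_right (Finset.sum_nonneg fun i _ => hCn i))
  · exact (hC₀ n x).2.trans (le_add_of_nonneg_right (Finset.sum_nonneg fun i _ => hCn i))
  · have e : (fun y => ∇ (cutoff n : Space N → ℝ) y i) = fun y => ((n : ℝ) + 1)⁻¹ *
        ∇ (cutoffBump N : Space N → ℝ) (((n : ℝ) + 1)⁻¹ • y) i := by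
      funext y
      have : ∇ (cutoff n : Space N → ℝ) y = _ := gradient_comp_smul (cutoffBump N) _ y
      rw [this]; rfl
    have hd : DifferentiableAt ℝ (fun y : Space N =>
        ∇ (cutoffBump N : Space N → ℝ) (((n : ℝ) + 1)⁻¹ • y) i) x :=
      ((hp i).comp (contDiff_const_smul _)).differentiable (by simp) x
    have e2 : ∇ (fun y => ∇ (cutoff n : Space N → ℝ) y i) x = ((n : ℝ) + 1)⁻¹ • ∇ (fun y : Space N =>
        ∇ (cutoffBump N : Space N → ℝ) (((n : ℝ) + 1)⁻¹ • y) i) x := by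
      rw [e, gradient_const_mul hd]
    rw [e2, norm_smul, Real.norm_of_nonneg (cutoff_scale_pos n).le]
    calc ‖x‖ * (((n : ℝ) + 1)⁻¹ * _) = ((n : ℝ) + 1)⁻¹ * (‖x‖ * _) := by ring
      _ ≤ ‖x‖ * _ := mul_le_of_le_one_left (by positivity) (cutoff_scale_le_one n)
      _ ≤ C i := (hC i n x).2
      _ ≤ ∑ i, C i := Finset.single_le_sum (f := C) (fun i _ => hCn i) (Finset.mem_univ i)
      _ ≤ _ := le_add_of_nonneg_left h0

/-- A Lipschitz bound for the truncated dilation field. It cancels the factor `‖x - y‖^(-2)` that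
appears when the Riesz kernel is differentiated, with a constant uniform over the cutoffs. -/
theorem norm_radial_sub_le {χ : Space N → ℝ} (hχ : ContDiff ℝ ∞ χ) {C : ℝ} (h1 : ∀ x, |χ x| ≤ 1)
    (hC : ∀ x, ‖x‖ * ‖∇ χ x‖ ≤ C) (x y : Space N) :
    ‖χ x • x - χ y • y‖ ≤ (1 + C) * ‖x - y‖ := by
  have hd : ∀ x, HasFDerivAt (fun y => χ y • y)
      (χ x • ContinuousLinearMap.id ℝ (Space N) + (fderiv ℝ χ x).smulRight x) x := fun x =>
    (hχ.differentiable (by simp) x).hasFDerivAt.smul (hasFDerivAt_id x)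
  refine Convex.norm_image_sub_le_of_norm_hasFDerivWithin_le (s := Set.univ)
    (fun x _ => (hd x).hasFDerivWithinAt) (fun x _ => ?_) convex_univ (Set.mem_univ y) (Set.mem_univ x)
  refine (norm_add_le _ _).trans (add_le_add ?_ ?_)
  · rw [norm_smul]
    exact mul_le_one₀ (h1 x) (norm_nonneg _) ContinuousLinearMap.norm_id_le
  · rw [ContinuousLinearMap.norm_smulRight_apply]
    have : ‖fderiv ℝ χ x‖ = ‖∇ χ x‖ := by
      rw [gradient_eq_comp]; simp
    rw [this, mul_comm]
    exact hC x

end Cutoff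

/-! ### A smooth approximation of the Riesz kernel from below. -/

section RegularizedKernel

variable {N : ℕ} {α δ : ℝ}

/-- A smooth regularisation of the Riesz kernel. -/
noncomputable def regKernel (α δ : ℝ) (z : Space N) : ℝ :=
  rieszConst N α * (‖z‖ ^ 2 + δ) ^ (-((N - α) / 2) : ℝ)

theorem contDiff_regKernel (hδ : 0 < δ) : ContDiff ℝ ∞ (regKernel α δ : Space N → ℝ) :=
  contDiff_const.mul ((ContDiff.add (contDiff_norm_sq ℝ) contDiff_const).rpow_const_of_ne
    fun z => by positivity)

theorem regKernel_nonneg (hα0 : 0 < α) (hαN : α < N) (hδ : 0 < δ) (z : Space N) :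
    0 ≤ regKernel α δ z := by
  have := rieszConst_pos hα0 hαN
  unfold regKernel
  positivity

theorem rieszKernel_eq {z : Space N} :
    rieszKernel α z = rieszConst N α * (‖z‖ ^ 2) ^ (-((N - α) / 2) : ℝ) := by
  rw [rieszKernel, div_eq_mul_inv, ← Real.rpow_neg (norm_nonneg _), ← Real.rpow_natCast,
    ← Real.rpow_mul (norm_nonneg _)]
  congr 2
  push_cast
  ring

theorem regKernel_le (hα0 : 0 < α) (hαN : α < N) (hδ : 0 < δ) {z : Space N} (hz : z ≠ 0) :
    regKernel α δ z ≤ rieszKernel α z := by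
  rw [rieszKernel_eq, regKernel]
  have hz2 : 0 < ‖z‖ ^ 2 := by positivity
  exact mul_le_mul_of_nonneg_left (Real.rpow_le_rpow_of_nonpos hz2 (by linarith)
    (by linarith)) (rieszConst_pos hα0 hαN).le

theorem tendsto_regKernel {z : Space N} (hz : z ≠ 0) {d : ℕ → ℝ} (hd : Tendsto d atTop (𝓝 0)) :
    Tendsto (fun n => regKernel α (d n) z) atTop (𝓝 (rieszKernel α z)) := by
  rw [rieszKernel_eq]
  have h1 : Tendsto (fun n => ‖z‖ ^ 2 + d n) atTop (𝓝 (‖z‖ ^ 2)) := by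
    simpa using tendsto_const_nhds.add hd
  exact (h1.rpow_const (Or.inl (by positivity))).const_mul _

theorem regKernel_neg (z : Space N) : regKernel α δ (-z) = regKernel α δ z := by
  simp [regKernel]

theorem hasFDerivAt_regKernel (hδ : 0 < δ) (z : Space N) :
    HasFDerivAt (regKernel α δ : Space N → ℝ)
      ((-(N - α) * regKernel α δ z / (‖z‖ ^ 2 + δ)) • (innerSL ℝ z)) z := by
  have hpos : 0 < ‖z‖ ^ 2 + δ := by positivity
  have h1 : HasFDerivAt (fun z : Space N => ‖z‖ ^ 2 + δ) (2 • (innerSL ℝ z)) z :=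
    (hasStrictFDerivAt_norm_sq z).hasFDerivAt.add_const δ
  have h2 := ((Real.hasDerivAt_rpow_const (p := (-((N - α) / 2) : ℝ)) (Or.inl hpos.ne')).const_mul
    (rieszConst N α)).comp_hasFDerivAt z h1
  refine h2.congr_fderiv ?_
  rw [← Nat.cast_smul_eq_nsmul ℝ, smul_smul]
  congr 1
  rw [regKernel, Real.rpow_sub_one hpos.ne']
  push_cast
  field_simp

theorem inner_gradient_regKernel (hδ : 0 < δ) (y x v : Space N) :
    ⟪v, ∇ (fun x => regKernel α δ (x - y)) x⟫ =
      -(N - α) * regKernel α δ (x - y) / (‖x - y‖ ^ 2 + δ) * ⟪x - y, v⟫ := by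
  rw [inner_gradient]
  have h := (hasFDerivAt_regKernel (α := α) hδ (x - y)).comp x ((hasFDerivAt_id x).sub_const y)
  have e : fderiv ℝ (fun x => regKernel α δ (x - y)) x = _ := h.fderiv
  rw [e]
  simp [inner_sub_left]

end RegularizedKernel

/-! ### Convergence of bilinear Riesz integrals. -/

section Bilinear

variable {N : ℕ} {α : ℝ}

/-- Both `|F|` and `|G|` are at most `|F| + |G|`, whose Riesz energy is finite. -/
theorem integrable_rieszKernel_mul (hα0 : 0 < α) (hαN : α < N) {F G : Space N → ℝ}
    (hF : MemLp F (ENNReal.ofReal (2 * N / (N + α)))) (hG : MemLp G (ENNReal.ofReal (2 * N / (N + α)))) :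
    Integrable (fun z : Space N × Space N => rieszKernel α (z.1 - z.2) * (G z.1 * F z.2))
      (volume.prod volume) := by
  have hH : MemLp (fun x => |F x| + |G x|) (ENNReal.ofReal (2 * N / (N + α))) := hF.abs.add hG.abs
  have h := integrable_rieszEnergy hα0 hαN (fun x => by positivity) hH
  refine h.mono' ?_ (Eventually.of_forall fun z => ?_)
  · exact ((measurable_rieszKernel.comp
      (measurable_fst.sub measurable_snd)).aestronglyMeasurable).mul (hG.1.comp_fst.mul hF.1.comp_snd)
  · have hk := rieszKernel_nonneg hα0 hαN (z.1 - z.2)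
    rw [norm_mul, Real.norm_of_nonneg hk, norm_mul, mul_assoc]
    refine mul_le_mul_of_nonneg_left (mul_le_mul ?_ ?_ (norm_nonneg _) (by positivity)) hk
    · exact le_add_of_nonneg_left (abs_nonneg _)
    · exact le_add_of_nonneg_right (abs_nonneg _)

theorem integrable_kernel_mul (hα0 : 0 < α) (hαN : α < N) {F G : Space N → ℝ}
    (hF : MemLp F (ENNReal.ofReal (2 * N / (N + α)))) (hG : MemLp G (ENNReal.ofReal (2 * N / (N + α))))
    {κ : Space N × Space N → ℝ} (hκ : AEStronglyMeasurable κ (volume.prod volume)) {C : ℝ}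
    (hC : ∀ᵐ z ∂(volume.prod volume), |κ z| ≤ C * rieszKernel α (z.1 - z.2)) :
    Integrable (fun z : Space N × Space N => κ z * (G z.1 * F z.2)) (volume.prod volume) := by
  refine (((integrable_rieszKernel_mul hα0 hαN hF hG).norm).const_mul C).mono'
    (hκ.mul (hG.1.comp_fst.mul hF.1.comp_snd)) ?_
  filter_upwards [hC] with z hz
  rw [norm_mul, norm_mul (rieszKernel α (z.1 - z.2)),
    Real.norm_of_nonneg (rieszKernel_nonneg hα0 hαN _), ← mul_assoc]
  exact mul_le_mul_of_nonneg_right hz (norm_nonneg _)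

theorem tendsto_integral_kernel_mul (hα0 : 0 < α) (hαN : α < N) {F G : Space N → ℝ}
    (hF : MemLp F (ENNReal.ofReal (2 * N / (N + α)))) (hG : MemLp G (ENNReal.ofReal (2 * N / (N + α))))
    {κ : ℕ → Space N × Space N → ℝ} (hκ : ∀ n, AEStronglyMeasurable (κ n) (volume.prod volume)) {C : ℝ}
    (hC : ∀ n, ∀ᵐ z ∂(volume.prod volume), |κ n z| ≤ C * rieszKernel α (z.1 - z.2))
    {κ' : Space N × Space N → ℝ}
    (hlim : ∀ᵐ z ∂(volume.prod volume), Tendsto (fun n => κ n z) atTop (𝓝 (κ' z))) :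
    Tendsto (fun n => ∫ z : Space N × Space N, κ n z * (G z.1 * F z.2) ∂(volume.prod volume)) atTop
      (𝓝 (∫ z : Space N × Space N, κ' z * (G z.1 * F z.2) ∂(volume.prod volume))) := by
  refine tendsto_integral_of_dominated_convergence
    (fun z => C * ‖rieszKernel α (z.1 - z.2) * (G z.1 * F z.2)‖)
    (fun n => (hκ n).mul (hG.1.comp_fst.mul hF.1.comp_snd))
    (((integrable_rieszKernel_mul hα0 hαN hF hG).norm).const_mul C) (fun n => ?_) ?_
  · filter_upwards [hC n] with z hz
    rw [norm_mul, norm_mul (rieszKernel α (z.1 - z.2)),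
      Real.norm_of_nonneg (rieszKernel_nonneg hα0 hαN _), ← mul_assoc]
    exact mul_le_mul_of_nonneg_right hz (norm_nonneg _)
  · filter_upwards [hlim] with z hz
    exact hz.mul_const _

theorem integral_rieszKernel_mul (hα0 : 0 < α) (hαN : α < N) {F G : Space N → ℝ}
    (hF : MemLp F (ENNReal.ofReal (2 * N / (N + α)))) (hG : MemLp G (ENNReal.ofReal (2 * N / (N + α)))) :
    ∫ z : Space N × Space N, rieszKernel α (z.1 - z.2) * (G z.1 * F z.2) ∂(volume.prod volume) =
      ∫ x, rieszPotential α F x * G x := by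
  rw [integral_prod _ (integrable_rieszKernel_mul hα0 hαN hF hG)]
  refine integral_congr_ae (Eventually.of_forall fun x => ?_)
  simp only
  rw [rieszPotential, ← integral_mul_const]
  exact integral_congr_ae (Eventually.of_forall fun y => by simp only; ring)

/-- At the origin the formal value of `rieszKernel` is zero by division by zero, so comparison with
the regularised kernel holds only off the diagonal. The diagonal is a null set. -/
theorem ae_prod_ne (hN : 0 < N) :
    ∀ᵐ z : Space N × Space N ∂(volume.prod volume), z.1 - z.2 ≠ 0 := by
  have : Nontrivial (Space N) := by
    apply Module.nontrivial_of_finrank_pos (R := ℝ)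
    rw [finrank_euclideanSpace_fin]
    omega
  have hm : MeasurableSet {z : Space N × Space N | ¬ z.1 - z.2 ≠ 0} := by
    simp only [not_not]
    exact (measurable_fst.sub measurable_snd) (measurableSet_singleton 0)
  rw [ae_iff, Measure.measure_prod_null hm]
  refine Eventually.of_forall fun x => ?_
  have : Prod.mk x ⁻¹' {z : Space N × Space N | ¬ z.1 - z.2 ≠ 0} = {x} := by
    ext y
    simp [sub_eq_zero, eq_comm]
  change volume (Prod.mk x ⁻¹' {z : Space N × Space N | ¬ z.1 - z.2 ≠ 0}) = 0
  rw [this]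
  simp

end Bilinear

/-! ### The dilation identity for the Riesz energy. -/

section RieszIdentity

variable {N : ℕ} {α : ℝ}

theorem MemLpLoc.memLp_radial {DF : Space N → Space N} {r : ℝ≥0∞} (hDF : MemLpLoc DF r)
    {χ : Space N → ℝ} (hχ : Continuous χ) (hc : HasCompactSupport χ) :
    MemLp (fun x => χ x * ⟪x, DF x⟫) r := by
  obtain ⟨C, hC⟩ := (hc.smul_right (f' := fun x : Space N => x)).exists_bound_of_continuous
    (hχ.smul continuous_id)
  set S := tsupport χ with hS
  have hSm : MeasurableSet S := (isClosed_tsupport χ).measurableSet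
  have h1 := hDF S hc
  have h2 : MemLp (fun x => χ x * ⟪x, DF x⟫) r (volume.restrict S) := by
    refine (h1.norm.const_mul C).mono' (hχ.aestronglyMeasurable.mul
      (continuous_id.aestronglyMeasurable.inner h1.1)) (Eventually.of_forall fun x => ?_)
    have e : χ x * ⟪x, DF x⟫ = ⟪χ x • x, DF x⟫ := by rw [inner_smul_left]; rfl
    rw [e]
    exact (norm_inner_le_norm _ _).trans (mul_le_mul_of_nonneg_right (hC x) (norm_nonneg _))
  rw [← memLp_indicator_iff_restrict hSm] at h2
  rwa [Set.indicator_eq_self.2 fun x hx => by_contra fun h => hx (by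
    simp [image_eq_zero_of_notMem_tsupport h])] at h2

/-- The divergence of `x ↦ χ(x) x`. -/
noncomputable def radialDiv (χ : Space N → ℝ) (x : Space N) : ℝ := N * χ x + ⟪x, ∇ χ x⟫

theorem continuous_radialDiv {χ : Space N → ℝ} (hχ : ContDiff ℝ ∞ χ) : Continuous (radialDiv χ) :=
  (continuous_const.mul hχ.continuous).add
    (continuous_id.inner (ContDiff.gradient_space hχ).continuous)

/-- The multiplier of the symmetrised, regularised kernel in the dilation identity. -/
noncomputable def dilationMultiplier (α δ : ℝ) (χ : Space N → ℝ) (z : Space N × Space N) : ℝ :=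
  (radialDiv χ z.1 + radialDiv χ z.2) / 2 -
    (N - α) / 2 * (⟪z.1 - z.2, χ z.1 • z.1 - χ z.2 • z.2⟫ / (‖z.1 - z.2‖ ^ 2 + δ))

theorem measurable_dilationMultiplier (δ : ℝ) {χ : Space N → ℝ} (hχ : ContDiff ℝ ∞ χ) :
    Measurable (dilationMultiplier α δ χ) := by
  have h1 := (continuous_radialDiv hχ).measurable
  have h2 := hχ.continuous.measurable
  unfold dilationMultiplier
  fun_prop

theorem abs_dilationMultiplier_le (hαN : α < N) {δ : ℝ} (hδ : 0 ≤ δ) {χ : Space N → ℝ} {B L : ℝ}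
    (hB : ∀ x, |radialDiv χ x| ≤ B) (hL : ∀ x y, ‖χ x • x - χ y • y‖ ≤ L * ‖x - y‖)
    {z : Space N × Space N} (hz : z.1 - z.2 ≠ 0) :
    |dilationMultiplier α δ χ z| ≤ B + (N - α) / 2 * L := by
  have hz2 : 0 < ‖z.1 - z.2‖ ^ 2 := by positivity
  have h1 : |⟪z.1 - z.2, χ z.1 • z.1 - χ z.2 • z.2⟫ / (‖z.1 - z.2‖ ^ 2 + δ)| ≤ L := by
    rw [abs_div, abs_of_pos (by positivity : 0 < ‖z.1 - z.2‖ ^ 2 + δ), div_le_iff₀ (by positivity)]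
    have hL0 : 0 ≤ L := by
      have := (norm_nonneg _).trans (hL z.1 z.2)
      exact nonneg_of_mul_nonneg_left this (norm_pos_iff.2 hz)
    calc |⟪z.1 - z.2, χ z.1 • z.1 - χ z.2 • z.2⟫| ≤ ‖z.1 - z.2‖ * (L * ‖z.1 - z.2‖) :=
          (abs_real_inner_le_norm _ _).trans
            (mul_le_mul_of_nonneg_left (hL _ _) (norm_nonneg _))
      _ = L * ‖z.1 - z.2‖ ^ 2 := by ring
      _ ≤ L * (‖z.1 - z.2‖ ^ 2 + δ) := by gcongr; linarith
  unfold dilationMultiplier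
  refine (abs_sub _ _).trans (add_le_add ?_ ?_)
  · rw [abs_div, abs_two]
    have := (abs_add_le (radialDiv χ z.1) (radialDiv χ z.2)).trans (add_le_add (hB _) (hB _))
    linarith
  · rw [abs_mul, abs_of_nonneg (by linarith)]
    exact mul_le_mul_of_nonneg_left h1 (by linarith)

variable {F : Space N → ℝ} {DF : Space N → Space N} {χ : Space N → ℝ}

theorem inner_gradient_regKernel_mul {δ : ℝ} (hδ : 0 < δ) (hχ : ContDiff ℝ ∞ χ) (x y : Space N) :
    N * (regKernel α δ (x - y) * χ x) + ⟪x, ∇ (fun x => regKernel α δ (x - y) * χ x) x⟫ =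
      regKernel α δ (x - y) *
        (radialDiv χ x - (N - α) * (⟪x - y, χ x • x⟫ / (‖x - y‖ ^ 2 + δ))) := by
  have hk : ContDiff ℝ ∞ fun x : Space N => regKernel α δ (x - y) :=
    (contDiff_regKernel hδ).comp (contDiff_id.sub contDiff_const)
  have e := gradient_mul (hχ.differentiable (by simp) x) (hk.differentiable (by simp) x)
  rw [e, inner_add_right, inner_smul_right, inner_smul_right, inner_gradient_regKernel hδ, radialDiv,
    inner_smul_right]
  ring

/-- For fixed `y` the regularised kernel times `χ` is a legitimate test function in `x`, so one may
integrate by parts. Averaging the result with its image under swapping `x` and `y` replaces `χ(x) x`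
by the difference `χ(x) x - χ(y) y`, which is what makes the multiplier bounded uniformly in `δ`. -/
theorem integral_regularized_dilation (hα0 : 0 < α) (hαN : α < N) {δ : ℝ} (hδ : 0 < δ)
    (hF : MemLp F (ENNReal.ofReal (2 * N / (N + α)))) (hFw : HasWeakGradient F DF)
    (hDF : MemLpLoc DF (ENNReal.ofReal (2 * N / (N + α)))) (hχ : ContDiff ℝ ∞ χ)
    (hc : HasCompactSupport χ) :
    ∫ z : Space N × Space N, regKernel α δ (z.1 - z.2) * ((χ z.1 * ⟪z.1, DF z.1⟫) * F z.2)
        ∂(volume.prod volume) =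
      -∫ z : Space N × Space N, (regKernel α δ (z.1 - z.2) * dilationMultiplier α δ χ z) *
        (F z.1 * F z.2) ∂(volume.prod volume) := by
  have hN : (0 : ℝ) < N := hα0.trans hαN
  have hG := hDF.memLp_radial hχ.continuous hc
  have hkc : Continuous fun z : Space N × Space N => regKernel α δ (z.1 - z.2) :=
    (contDiff_regKernel hδ).continuous.comp (continuous_fst.sub continuous_snd)
  have hkle : ∀ᵐ z : Space N × Space N ∂(volume.prod volume),
      |regKernel α δ (z.1 - z.2)| ≤ 1 * rieszKernel α (z.1 - z.2) := by
    filter_upwards [ae_prod_ne (Nat.cast_pos.1 hN)] with z hz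
    rw [abs_of_nonneg (regKernel_nonneg hα0 hαN hδ _), one_mul]
    exact regKernel_le hα0 hαN hδ hz
  set ρ : Space N × Space N → ℝ := fun z =>
    radialDiv χ z.1 - (N - α) * (⟪z.1 - z.2, χ z.1 • z.1⟫ / (‖z.1 - z.2‖ ^ 2 + δ)) with hρ
  have hρc : Continuous ρ := by
    have h1 := continuous_radialDiv hχ
    have h2 := hχ.continuous
    refine (h1.comp continuous_fst).sub (continuous_const.mul (Continuous.div ?_ ?_ ?_))
    · fun_prop
    · fun_prop
    · intro z; positivity
  obtain ⟨B, hB⟩ : ∃ B, ∀ x, ‖radialDiv χ x‖ ≤ B := by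
    refine HasCompactSupport.exists_bound_of_continuous (f := radialDiv χ) ?_ (continuous_radialDiv hχ)
    refine (hc.mul_left (f := fun _ => (N : ℝ))).add ?_
    refine HasCompactSupport.mono (HasCompactSupport.gradient hc) fun x hx h => hx ?_
    simp [h]
  obtain ⟨M, hM⟩ : ∃ M, ∀ x : Space N, ‖χ x • x‖ ≤ M :=
    (hc.smul_right (f' := fun x : Space N => x)).exists_bound_of_continuous
      (hχ.continuous.smul continuous_id)
  have hM0 : 0 ≤ M := (norm_nonneg _).trans (hM 0)
  have hratio : ∀ z : Space N, ‖z‖ / (‖z‖ ^ 2 + δ) ≤ 1 + δ⁻¹ := by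
    intro z
    rw [div_le_iff₀ (by positivity)]
    have e : (1 + δ⁻¹) * (‖z‖ ^ 2 + δ) = ‖z‖ ^ 2 + 1 + (δ + δ⁻¹ * ‖z‖ ^ 2) := by
      field_simp; ring
    rw [e]
    have : 0 ≤ δ + δ⁻¹ * ‖z‖ ^ 2 := by positivity
    nlinarith [sq_nonneg (‖z‖ - 1), sq_nonneg ‖z‖]
  -- This bound blows up as `δ → 0`, because the multiplier is not yet symmetrised. It serves only
  -- absolute convergence and Fubini at fixed `δ`.
  have hρb : ∀ z, |ρ z| ≤ B + (N - α) * (M * (1 + δ⁻¹)) := by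
    intro z
    refine (abs_sub _ _).trans (add_le_add (hB _) ?_)
    rw [abs_mul, abs_of_nonneg (by linarith : (0 : ℝ) ≤ N - α)]
    refine mul_le_mul_of_nonneg_left ?_ (by linarith)
    rw [abs_div, abs_of_pos (by positivity : 0 < ‖z.1 - z.2‖ ^ 2 + δ)]
    calc |⟪z.1 - z.2, χ z.1 • z.1⟫| / (‖z.1 - z.2‖ ^ 2 + δ)
        ≤ (‖z.1 - z.2‖ * M) / (‖z.1 - z.2‖ ^ 2 + δ) := by
          gcongr
          exact (abs_real_inner_le_norm _ _).trans (mul_le_mul_of_nonneg_left (hM _) (norm_nonneg _))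
      _ = M * (‖z.1 - z.2‖ / (‖z.1 - z.2‖ ^ 2 + δ)) := by ring
      _ ≤ _ := mul_le_mul_of_nonneg_left (hratio _) hM0
  have hκle : ∀ᵐ z : Space N × Space N ∂(volume.prod volume),
      |regKernel α δ (z.1 - z.2) * ρ z| ≤
        (B + (N - α) * (M * (1 + δ⁻¹))) * rieszKernel α (z.1 - z.2) := by
    filter_upwards [hkle] with z hz
    rw [abs_mul, mul_comm]
    rw [one_mul] at hz
    exact mul_le_mul (hρb z) hz (abs_nonneg _) ((abs_nonneg _).trans (hρb z))
  have iL := integrable_kernel_mul hα0 hαN hF hG hkc.aestronglyMeasurable hkle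
  have iR : Integrable (fun z : Space N × Space N => (regKernel α δ (z.1 - z.2) * ρ z) *
      (F z.1 * F z.2)) (volume.prod volume) :=
    integrable_kernel_mul hα0 hαN hF hF (hkc.mul hρc).aestronglyMeasurable hκle
  have step : ∫ z : Space N × Space N, regKernel α δ (z.1 - z.2) * ((χ z.1 * ⟪z.1, DF z.1⟫) * F z.2)
        ∂(volume.prod volume) =
      -∫ z : Space N × Space N, (regKernel α δ (z.1 - z.2) * ρ z) * (F z.1 * F z.2)
        ∂(volume.prod volume) := by
    rw [integral_prod_symm _ iL, integral_prod_symm _ iR, ← integral_neg]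
    refine integral_congr_ae (Eventually.of_forall fun y => ?_)
    have hk : ContDiff ℝ ∞ fun x : Space N => regKernel α δ (x - y) :=
      (contDiff_regKernel hδ).comp (contDiff_id.sub contDiff_const)
    have h := hFw.radial_test (hk.mul hχ) hc.mul_left
    simp only [inner_gradient_regKernel_mul hδ hχ] at h
    simp only
    have e1 : ∫ x, regKernel α δ (x - y) * (χ x * ⟪x, DF x⟫ * F y) =
        (∫ x, regKernel α δ (x - y) * χ x * ⟪x, DF x⟫) * F y := by
      rw [← integral_mul_const]
      exact integral_congr_ae (Eventually.of_forall fun x => by simp only; ring)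
    have e2 : ∫ x, regKernel α δ (x - y) * ρ (x, y) * (F x * F y) =
        (∫ x, F x * (regKernel α δ (x - y) * ρ (x, y))) * F y := by
      rw [← integral_mul_const]
      exact integral_congr_ae (Eventually.of_forall fun x => by simp only; ring)
    rw [e1, e2, h, neg_mul, neg_neg]
  rw [step]
  congr 1
  set R : Space N × Space N → ℝ := fun z =>
    (regKernel α δ (z.1 - z.2) * ρ z) * (F z.1 * F z.2) with hR
  have hswap : ∫ z, R z.swap ∂((volume : Measure (Space N)).prod (volume : Measure (Space N))) =
    ∫ z, R z ∂(volume.prod volume) := integral_prod_swap R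
  have iRs : Integrable (fun z => R z.swap) ((volume : Measure (Space N)).prod volume) := iR.swap
  have e3 : ∀ z : Space N × Space N, (regKernel α δ (z.1 - z.2) * dilationMultiplier α δ χ z) *
      (F z.1 * F z.2) = (1 / 2) * (R z + R z.swap) := by
    intro z
    have h1 : regKernel α δ (z.2 - z.1) = regKernel α δ (z.1 - z.2) := by
      rw [← neg_sub, regKernel_neg]
    have h2 : ‖z.2 - z.1‖ = ‖z.1 - z.2‖ := norm_sub_rev _ _
    have h3 : ⟪z.2 - z.1, χ z.2 • z.2⟫ = -⟪z.1 - z.2, χ z.2 • z.2⟫ := by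
      rw [← neg_sub, inner_neg_left]
    simp only [hR, hρ, Prod.fst_swap, Prod.snd_swap, dilationMultiplier, h1, h2, h3, inner_sub_right]
    ring
  simp only [e3]
  rw [integral_const_mul, integral_add iR iRs, hswap]
  ring

/-- The dilation identity for the Riesz energy, localised by a cutoff. -/
theorem integral_rieszPotential_dilation (hα0 : 0 < α) (hαN : α < N)
    (hF : MemLp F (ENNReal.ofReal (2 * N / (N + α)))) (hFw : HasWeakGradient F DF)
    (hDF : MemLpLoc DF (ENNReal.ofReal (2 * N / (N + α)))) (hχ : ContDiff ℝ ∞ χ)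
    (hc : HasCompactSupport χ) {B L : ℝ}
    (hB : ∀ x, |radialDiv χ x| ≤ B) (hL : ∀ x y, ‖χ x • x - χ y • y‖ ≤ L * ‖x - y‖) :
    ∫ x, rieszPotential α F x * (χ x * ⟪x, DF x⟫) =
      -∫ z : Space N × Space N, (rieszKernel α (z.1 - z.2) * dilationMultiplier α 0 χ z) *
        (F z.1 * F z.2) ∂(volume.prod volume) := by
  have hN : (0 : ℝ) < N := hα0.trans hαN
  have hG := hDF.memLp_radial hχ.continuous hc
  have hne := ae_prod_ne (Nat.cast_pos.1 hN)
  have hkm : ∀ n, Measurable fun z : Space N × Space N => regKernel α (truncSeq n) (z.1 - z.2) :=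
    fun n => ((contDiff_regKernel (truncSeq_pos n)).continuous.comp
      (continuous_fst.sub continuous_snd)).measurable
  rw [← integral_rieszKernel_mul hα0 hαN hF hG]
  have t1 := tendsto_integral_kernel_mul hα0 hαN hF hG (fun n => (hkm n).aestronglyMeasurable)
    (C := 1) (fun n => by
      filter_upwards [hne] with z hz
      rw [abs_of_nonneg (regKernel_nonneg hα0 hαN (truncSeq_pos n) _), one_mul]
      exact regKernel_le hα0 hαN (truncSeq_pos n) hz) (hne.mono fun z hz =>
      tendsto_regKernel (α := α) hz tendsto_truncSeq)
  -- After symmetrisation the Lipschitz constant `L` bounds the multiplier independently of the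
  -- regularisation, so dominated convergence reaches `δ = 0`.
  have t2 := tendsto_integral_kernel_mul hα0 hαN hF hF (fun n =>
    ((hkm n).mul (measurable_dilationMultiplier (α := α) (truncSeq n) hχ)).aestronglyMeasurable)
    (C := B + (N - α) / 2 * L) (fun n => by
      filter_upwards [hne] with z hz
      have h1 := abs_dilationMultiplier_le hαN (truncSeq_pos n).le hB hL hz
      rw [Pi.mul_apply, abs_mul, abs_of_nonneg (regKernel_nonneg hα0 hαN (truncSeq_pos n) _), mul_comm]
      exact mul_le_mul h1 (regKernel_le hα0 hαN (truncSeq_pos n) hz)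
        (regKernel_nonneg hα0 hαN (truncSeq_pos n) _) ((abs_nonneg _).trans h1))
    (κ' := fun z => rieszKernel α (z.1 - z.2) * dilationMultiplier α 0 χ z)
    (hne.mono fun z hz => by
      refine (tendsto_regKernel (α := α) hz tendsto_truncSeq).mul ?_
      unfold dilationMultiplier
      refine tendsto_const_nhds.sub (Tendsto.const_mul _ (Tendsto.div tendsto_const_nhds
        (tendsto_const_nhds.add tendsto_truncSeq) ?_))
      have : 0 < ‖z.1 - z.2‖ ^ 2 := by positivity
      rw [add_zero]
      exact this.ne')
  refine tendsto_nhds_unique t1 (t2.neg.congr fun n => ?_)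
  exact (integral_regularized_dilation hα0 hαN (truncSeq_pos n) hF hFw hDF hχ hc).symm

/-- The dilation derivative of the Riesz energy. -/
theorem tendsto_integral_rieszPotential_dilation (hα0 : 0 < α) (hαN : α < N)
    (hF : MemLp F (ENNReal.ofReal (2 * N / (N + α)))) (hFw : HasWeakGradient F DF)
    (hDF : MemLpLoc DF (ENNReal.ofReal (2 * N / (N + α)))) :
    Tendsto (fun n => ∫ x, rieszPotential α F x * (cutoff n x * ⟪x, DF x⟫)) atTop
      (𝓝 (-((N + α) / 2) * ∫ x, rieszPotential α F x * F x)) := by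
  have hN : (0 : ℝ) < N := hα0.trans hαN
  have hne := ae_prod_ne (Nat.cast_pos.1 hN)
  obtain ⟨C, hC0, hC⟩ := exists_cutoff_bound N
  have habs : ∀ (n : ℕ) (x : Space N), |cutoff n x| ≤ 1 := fun n x => by
    rw [abs_of_nonneg (cutoff_nonneg n x)]; exact cutoff_le_one n x
  have hB : ∀ (n : ℕ) (x : Space N), |radialDiv (cutoff n) x| ≤ N + C := fun n x => by
    refine (abs_add_le _ _).trans (add_le_add ?_ ((abs_real_inner_le_norm _ _).trans (hC n x).2.1))
    rw [abs_mul, abs_of_pos hN]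
    exact mul_le_of_le_one_right hN.le (habs n x)
  have hL : ∀ (n : ℕ) (x y : Space N), ‖cutoff n x • x - cutoff n y • y‖ ≤ (1 + C) * ‖x - y‖ :=
    fun n => norm_radial_sub_le (contDiff_cutoff n) (habs n) fun x => (hC n x).2.1
  have t := tendsto_integral_kernel_mul hα0 hαN hF hF
    (κ := fun n z => rieszKernel α (z.1 - z.2) * dilationMultiplier α 0 (cutoff n) z)
    (fun n => ((measurable_rieszKernel.comp (measurable_fst.sub measurable_snd)).mul
      (measurable_dilationMultiplier 0 (contDiff_cutoff n))).aestronglyMeasurable)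
    (C := (N + C) + (N - α) / 2 * (1 + C)) (fun n => by
      filter_upwards [hne] with z hz
      rw [abs_mul, abs_of_nonneg (rieszKernel_nonneg hα0 hαN _), mul_comm]
      exact mul_le_mul_of_nonneg_right (abs_dilationMultiplier_le hαN le_rfl (hB n) (hL n) hz)
        (rieszKernel_nonneg hα0 hαN _))
    (κ' := fun z => rieszKernel α (z.1 - z.2) * ((N + α) / 2)) (hne.mono fun z hz => by
      -- Once the cutoff is one near both points, both divergences equal `N` and the quotient equals
      -- one, so the multiplier is `N - (N - α)/2 = (N + α)/2`.
      refine tendsto_of_eventually_eq ?_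
      filter_upwards [eventually_cutoff_eq_one z.1, eventually_cutoff_eq_one z.2,
        eventually_gradient_cutoff_eq_zero z.1, eventually_gradient_cutoff_eq_zero z.2]
        with n h1 h2 h3 h4
      have hz2 : ‖z.1 - z.2‖ ^ 2 ≠ 0 := by positivity
      rw [dilationMultiplier, radialDiv, radialDiv, h1.self_of_nhds, h2.self_of_nhds,
        h3.self_of_nhds, h4.self_of_nhds, one_smul, one_smul, real_inner_self_eq_norm_sq,
        inner_zero_right, inner_zero_right, add_zero (‖z.1 - z.2‖ ^ 2), div_self hz2]
      ring)
  have e : -∫ z : Space N × Space N, (rieszKernel α (z.1 - z.2) * ((N + α) / 2)) * (F z.1 * F z.2)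
      ∂(volume.prod volume) = -((N + α) / 2) * ∫ x, rieszPotential α F x * F x := by
    rw [← integral_rieszKernel_mul hα0 hαN hF hF, neg_mul, ← integral_const_mul]
    congr 1
    exact integral_congr_ae (Eventually.of_forall fun z => by simp only; ring)
  rw [← e]
  refine t.neg.congr fun n => ?_
  exact (integral_rieszPotential_dilation hα0 hαN hF hFw hDF (contDiff_cutoff n)
    (hasCompactSupport_cutoff n) (hB n) (hL n)).symm

end RieszIdentity

/-! ### Limits of integrals against cutoffs and their gradients. -/

section CutoffLimits

variable {N : ℕ}

theorem tendsto_integral_cutoff_mul {g : Space N → ℝ} (hg : Integrable g) :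
    Tendsto (fun n => ∫ x, cutoff n x * g x) atTop (𝓝 (∫ x, g x)) := by
  refine tendsto_integral_of_dominated_convergence (fun x => ‖g x‖)
    (fun n => (contDiff_cutoff n).continuous.aestronglyMeasurable.mul hg.1) hg.norm
    (fun n => Eventually.of_forall fun x => ?_) (Eventually.of_forall fun x => ?_)
  · rw [norm_mul, Real.norm_of_nonneg (cutoff_nonneg n x)]
    exact mul_le_of_le_one_left (norm_nonneg _) (cutoff_le_one n x)
  · simpa using (tendsto_cutoff x).mul_const (g x)

/-- Integrands carried by the transition layers of the cutoffs do not contribute in the limit. -/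
theorem tendsto_integral_layer {a : ℕ → Space N → ℝ} {g : Space N → ℝ} (hg : Integrable g)
    (ha : ∀ n, AEStronglyMeasurable (a n)) (hag : ∀ n, ∀ᵐ x, ‖a n x‖ ≤ g x)
    (h0 : ∀ x, ∀ᶠ n in atTop, a n x = 0) : Tendsto (fun n => ∫ x, a n x) atTop (𝓝 0) := by
  have := tendsto_integral_of_dominated_convergence (f := fun _ : Space N => (0 : ℝ)) g ha hg hag
    (Eventually.of_forall fun x => tendsto_of_eventually_eq (h0 x))
  simpa using this

theorem integrable_mul_norm {a : Space N → ℝ} {b : Space N → Space N} (ha : MemLp a 2)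
    (hb : MemLp b 2) : Integrable fun x => |a x| * ‖b x‖ :=
  MemLp.integrable_mul (p := 2) (q := 2) ha.norm hb.norm

theorem integrable_norm_sq_space {V : Type*} [NormedAddCommGroup V] {b : Space N → V} (hb : MemLp b 2) :
    Integrable fun x => ‖b x‖ ^ 2 := by
  have := hb.norm.integrable_sq
  simpa using this

theorem tendsto_integral_gradient_cutoff {a : Space N → ℝ} {b : Space N → Space N} (ha : MemLp a 2)
    (hb : MemLp b 2) :
    Tendsto (fun n => ∫ x, a x * ⟪b x, ∇ (cutoff n) x⟫) atTop (𝓝 0) := by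
  obtain ⟨C, hC0, hC⟩ := exists_cutoff_bound N
  refine tendsto_integral_layer ((integrable_mul_norm ha hb).const_mul C) (fun n => ?_) (fun n => ?_)
    (fun x => ?_)
  · exact ha.1.mul (hb.1.inner
      (ContDiff.gradient_space (contDiff_cutoff n)).continuous.aestronglyMeasurable)
  · refine Eventually.of_forall fun x => ?_
    rw [norm_mul, Real.norm_eq_abs]
    calc |a x| * ‖⟪b x, ∇ (cutoff n) x⟫‖ ≤ |a x| * (‖b x‖ * C) := by
          refine mul_le_mul_of_nonneg_left ((norm_inner_le_norm _ _).trans ?_) (abs_nonneg _)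
          exact mul_le_mul_of_nonneg_left (hC n x).1 (norm_nonneg _)
      _ = _ := by ring
  · filter_upwards [eventually_gradient_cutoff_eq_zero x] with n hn
    rw [hn.self_of_nhds, inner_zero_right, mul_zero]

theorem tendsto_integral_radial_cutoff {g : Space N → ℝ} (hg : Integrable g) :
    Tendsto (fun n => ∫ x, ⟪x, ∇ (cutoff n) x⟫ * g x) atTop (𝓝 0) := by
  obtain ⟨C, hC0, hC⟩ := exists_cutoff_bound N
  refine tendsto_integral_layer (hg.norm.const_mul C) (fun n => ?_) (fun n => ?_) (fun x => ?_)
  · exact (continuous_id.aestronglyMeasurable.inner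
      (ContDiff.gradient_space (contDiff_cutoff n)).continuous.aestronglyMeasurable).mul hg.1
  · refine Eventually.of_forall fun x => ?_
    rw [norm_mul]
    exact mul_le_mul_of_nonneg_right ((norm_inner_le_norm _ _).trans (hC n x).2.1) (norm_nonneg _)
  · filter_upwards [eventually_gradient_cutoff_eq_zero x] with n hn
    rw [hn.self_of_nhds, inner_zero_right, zero_mul]

theorem memLp_mul_smooth {V : Type*} [NormedAddCommGroup V] [NormedSpace ℝ V] {g : Space N → V}
    {χ : Space N → ℝ} {p : ℝ≥0∞} (hg : MemLp g p) (hχ : Continuous χ) (hc : HasCompactSupport χ) :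
    MemLp (fun x => χ x • g x) p := by
  obtain ⟨C, hC⟩ := hc.exists_bound_of_continuous hχ
  refine (hg.norm.const_mul C).mono' (hχ.aestronglyMeasurable.smul hg.1)
    (Eventually.of_forall fun x => ?_)
  rw [norm_smul]
  exact mul_le_mul_of_nonneg_right (hC x) (norm_nonneg _)

theorem memLp_smul_smooth {V : Type*} [NormedAddCommGroup V] [NormedSpace ℝ V] {g : Space N → ℝ}
    {χ : Space N → V} {p : ℝ≥0∞} (hg : MemLp g p) (hχ : Continuous χ) (hc : HasCompactSupport χ) :
    MemLp (fun x => g x • χ x) p := by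
  obtain ⟨C, hC⟩ := hc.exists_bound_of_continuous hχ
  refine (hg.norm.const_mul C).mono' (hg.1.smul hχ.aestronglyMeasurable)
    (Eventually.of_forall fun x => ?_)
  rw [norm_smul, mul_comm]
  exact mul_le_mul_of_nonneg_right (hC x) (norm_nonneg _)

theorem memLp_gradient_mul_smooth {f χ : Space N → ℝ} {G : Space N → Space N} (hf : MemLp f 2)
    (hG : MemLp G 2) (hχ : ContDiff ℝ ∞ χ) (hc : HasCompactSupport χ) :
    MemLp (fun x => χ x • G x + f x • ∇ χ x) 2 :=
  (memLp_mul_smooth hG hχ.continuous hc).add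
    (memLp_smul_smooth hf (ContDiff.gradient_space hχ).continuous (HasCompactSupport.gradient hc))

theorem gradient_eq_zero_of_notMem {χ : Space N → ℝ} {x : Space N} (hx : x ∉ tsupport χ) :
    ∇ χ x = 0 := by
  have h : χ =ᶠ[𝓝 x] fun _ => 0 := notMem_tsupport_iff_eventuallyEq.1 hx
  exact gradient_eq_zero_of_eventuallyEq_const h

theorem MemLp.memLpLoc {V : Type*} [NormedAddCommGroup V] {g : Space N → V} {p : ℝ≥0∞}
    (hg : MemLp g p) : MemLpLoc g p := fun C _ => hg.restrict C

theorem integral_inner_gradient_mul_smooth {φ χ : Space N → ℝ} {Dφ Dψ : Space N → Space N}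
    (hφ : MemLp φ 2) (hDφ : MemLp Dφ 2) (hDψ : MemLp Dψ 2) (hχ : ContDiff ℝ ∞ χ)
    (hc : HasCompactSupport χ) :
    ∫ x, ⟪Dψ x, χ x • Dφ x + φ x • ∇ χ x⟫ =
      (∫ x, χ x * ⟪Dψ x, Dφ x⟫) + ∫ x, φ x * ⟪Dψ x, ∇ χ x⟫ := by
  have i1 : Integrable fun x => χ x * ⟪Dψ x, Dφ x⟫ := by
    have := integrable_inner_of_memLp (p := 2) (q := 2) hDψ (memLp_mul_smooth hDφ hχ.continuous hc)
    simpa only [inner_smul_right] using this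
  have i2 : Integrable fun x => φ x * ⟪Dψ x, ∇ χ x⟫ := by
    have := integrable_inner_of_memLp (p := 2) (q := 2) hDψ (memLp_smul_smooth hφ
      (ContDiff.gradient_space hχ).continuous (HasCompactSupport.gradient hc))
    simpa only [inner_smul_right] using this
  rw [← integral_add i1 i2]
  simp only [inner_add_right, inner_smul_right]

end CutoffLimits

/-! ### The Poisson equation: nonnegativity and energy identity. -/

section Poisson

variable {N : ℕ} {φ f : Space N → ℝ} {Dφ : Space N → Space N}

/-- A bounded smooth truncation of the negative part. -/
noncomputable def negTrunc (s : ℝ) : ℝ := if s < 0 then s ^ 2 / (1 + s ^ 2) else 0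

noncomputable def negTruncDeriv (s : ℝ) : ℝ := if s < 0 then 2 * s / (1 + s ^ 2) ^ 2 else 0

theorem negTrunc_eq (s : ℝ) : negTrunc s = (min s 0) ^ 2 / (1 + (min s 0) ^ 2) := by
  unfold negTrunc
  split_ifs with h
  · rw [min_eq_left h.le]
  · rw [min_eq_right (not_lt.1 h)]; simp

theorem negTruncDeriv_eq (s : ℝ) : negTruncDeriv s = 2 * min s 0 / (1 + (min s 0) ^ 2) ^ 2 := by
  unfold negTruncDeriv
  split_ifs with h
  · rw [min_eq_left h.le]
  · rw [min_eq_right (not_lt.1 h)]; simp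

theorem negTrunc_nonneg (s : ℝ) : 0 ≤ negTrunc s := by rw [negTrunc_eq]; positivity

theorem negTrunc_le_abs (s : ℝ) : negTrunc s ≤ |s| := by
  unfold negTrunc
  split_ifs with h
  · rw [div_le_iff₀ (by positivity), abs_of_neg h]
    nlinarith [sq_nonneg (s + 1), mul_nonneg (neg_nonneg.2 h.le) (sq_nonneg s)]
  · exact abs_nonneg _

theorem nonneg_of_negTrunc_eq_zero {s : ℝ} (h : negTrunc s = 0) : 0 ≤ s := by
  by_contra hs
  push Not at hs
  rw [negTrunc, if_pos hs] at h
  have : 0 < s ^ 2 := by nlinarith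
  have : 0 < s ^ 2 / (1 + s ^ 2) := by positivity
  linarith

theorem continuous_negTruncDeriv : Continuous negTruncDeriv := by
  have : negTruncDeriv = fun s => 2 * min s 0 / (1 + (min s 0) ^ 2) ^ 2 := funext negTruncDeriv_eq
  rw [this]
  exact Continuous.div (by fun_prop) (by fun_prop) fun s => by positivity

theorem negTruncDeriv_nonpos (s : ℝ) : negTruncDeriv s ≤ 0 := by
  rw [negTruncDeriv_eq]
  exact div_nonpos_of_nonpos_of_nonneg (by linarith [min_le_right s 0]) (by positivity)

theorem abs_negTruncDeriv_le (s : ℝ) : |negTruncDeriv s| ≤ 1 := by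
  rw [negTruncDeriv_eq, abs_div, abs_of_pos (by positivity : 0 < (1 + (min s 0) ^ 2) ^ 2),
    div_le_one (by positivity), abs_le]
  constructor <;> nlinarith [sq_nonneg (min s 0 + 1), sq_nonneg (min s 0 - 1),
    sq_nonneg (min s 0 ^ 2), sq_nonneg (min s 0)]

theorem hasDerivAt_negTrunc (s : ℝ) : HasDerivAt negTrunc (negTruncDeriv s) s := by
  have hm : ∀ x : ℝ, HasDerivAt (fun x : ℝ => x ^ 2 / (1 + x ^ 2)) (2 * x / (1 + x ^ 2) ^ 2) x := by
    intro x
    have h1 : HasDerivAt (fun x : ℝ => x ^ 2) (2 * x) x := by simpa using hasDerivAt_pow 2 x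
    refine (h1.div (h1.const_add 1) (by positivity)).congr_deriv ?_
    congr 1
    ring
  rcases lt_trichotomy s 0 with h | h | h
  · have e : negTrunc =ᶠ[𝓝 s] fun x : ℝ => x ^ 2 / (1 + x ^ 2) := by
      filter_upwards [gt_mem_nhds h] with x hx
      rw [negTrunc, if_pos hx]
    rw [negTruncDeriv, if_pos h]
    exact (hm s).congr_of_eventuallyEq e
  · subst h
    have hL : HasDerivWithinAt negTrunc 0 (Set.Iic 0) 0 := by
      have := (hm 0).hasDerivWithinAt (s := Set.Iic 0)
      simp only [mul_zero, zero_div] at this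
      refine this.congr (fun x hx => ?_) (by simp [negTrunc])
      rw [negTrunc_eq, min_eq_left hx]
    have hR : HasDerivWithinAt negTrunc 0 (Set.Ici 0) 0 := by
      refine (hasDerivWithinAt_const (0 : ℝ) (Set.Ici (0 : ℝ)) (0 : ℝ)).congr (fun x hx => ?_)
        (by simp [negTrunc])
      rw [negTrunc, if_neg (not_lt.2 hx)]
    have := hL.union hR
    rw [Set.Iic_union_Ici, hasDerivWithinAt_univ] at this
    simpa [negTruncDeriv] using this
  · have e : negTrunc =ᶠ[𝓝 s] fun _ => 0 := by
      filter_upwards [lt_mem_nhds h] with x hx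
      rw [negTrunc, if_neg (not_lt.2 hx.le)]
    rw [negTruncDeriv, if_neg (not_lt.2 h.le)]
    exact (hasDerivAt_const s (0 : ℝ)).congr_of_eventuallyEq e

/-- Finite energy supersolutions of the Laplace equation are nonnegative. -/
theorem IsDistribSol.nonneg (hN : 0 < N) (hw : HasWeakGradient φ Dφ) (hφ : MemLp φ 2) (hDφ : MemLp Dφ 2)
    (hf : LocallyIntegrable f) (hf0 : ∀ x, 0 ≤ f x) (hsol : IsDistribSol Dφ f) :
    ∀ᵐ x, 0 ≤ φ x := by
  have hβw := hw.comp hasDerivAt_negTrunc continuous_negTruncDeriv abs_negTruncDeriv_le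
  have hβm : MemLp (fun x => negTrunc (φ x)) 2 := hφ.norm.mono' hβw.1.aestronglyMeasurable
    (Eventually.of_forall fun x => by
      rw [Real.norm_of_nonneg (negTrunc_nonneg _)]; exact negTrunc_le_abs _)
  have hDβm : MemLp (fun x => negTruncDeriv (φ x) • Dφ x) 2 :=
    hDφ.norm.mono' hβw.2.1.aestronglyMeasurable (Eventually.of_forall fun x => by
      rw [norm_smul]
      exact mul_le_of_le_one_left (norm_nonneg _) (abs_negTruncDeriv_le _))
  -- The equation is tested with the cutoff times the truncated negative part of `φ`, which is
  -- nonnegative. Its derivative in `φ` is nonpositive, so in the limit the energy on `{φ < 0}` is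
  -- both nonnegative and nonpositive.
  have key : ∀ n, 0 ≤ (∫ x, cutoff n x * ⟪Dφ x, negTruncDeriv (φ x) • Dφ x⟫) +
      ∫ x, negTrunc (φ x) * ⟪Dφ x, ∇ (cutoff n) x⟫ := by
    intro n
    have hχ := contDiff_cutoff (N := N) n
    have hc := hasCompactSupport_cutoff (N := N) n
    have h := (hsol.test_nonneg (MemLp.memLpLoc hDφ) hf (Eventually.of_forall hf0) hc.isCompact
      (hβw.mul_smooth hχ) (memLp_gradient_mul_smooth hβm hDβm hχ hc)
      (Eventually.of_forall fun x => mul_nonneg (cutoff_nonneg n x) (negTrunc_nonneg _))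
      (fun x hx => by rw [image_eq_zero_of_notMem_tsupport hx, zero_mul])
      (fun x hx => by rw [image_eq_zero_of_notMem_tsupport hx, gradient_eq_zero_of_notMem hx,
        zero_smul, smul_zero, add_zero])).2
    rw [← integral_inner_gradient_mul_smooth hβm hDβm hDφ hχ hc, ← h]
    exact integral_nonneg fun x => mul_nonneg (hf0 x)
      (mul_nonneg (cutoff_nonneg n x) (negTrunc_nonneg _))
  have hint : Integrable fun x => ⟪Dφ x, negTruncDeriv (φ x) • Dφ x⟫ :=
    integrable_inner_of_memLp (p := 2) (q := 2) hDφ hDβm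
  have hle : ∀ x, ⟪Dφ x, negTruncDeriv (φ x) • Dφ x⟫ ≤ 0 := fun x => by
    rw [inner_smul_right]
    exact mul_nonpos_of_nonpos_of_nonneg (negTruncDeriv_nonpos _) real_inner_self_nonneg
  have hlim := ge_of_tendsto' ((tendsto_integral_cutoff_mul hint).add
    (tendsto_integral_gradient_cutoff hβm hDφ)) key
  rw [add_zero] at hlim
  have hz : (fun x => -⟪Dφ x, negTruncDeriv (φ x) • Dφ x⟫) =ᵐ[volume] 0 := by
    rw [← integral_eq_zero_iff_of_nonneg (fun x => neg_nonneg.2 (hle x)) hint.neg, integral_neg]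
    have := integral_nonpos (μ := volume) (f := fun x => ⟪Dφ x, negTruncDeriv (φ x) • Dφ x⟫) hle
    linarith
  have hG : (fun x => negTruncDeriv (φ x) • Dφ x) =ᵐ[volume] 0 := by
    filter_upwards [hz] with x hx
    simp only [Pi.zero_apply, neg_eq_zero, inner_smul_right, mul_eq_zero] at hx ⊢
    rcases hx with hx | hx
    · rw [hx, zero_smul]
    · rw [inner_self_eq_zero.1 hx, smul_zero]
  filter_upwards [hβw.ae_eq_zero hN hG hβm] with x hx
  exact nonneg_of_negTrunc_eq_zero hx

theorem IsDistribSol.integral_smooth_mul (hw : HasWeakGradient φ Dφ) (hφ : MemLp φ 2)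
    (hDφ : MemLp Dφ 2) (hf : LocallyIntegrable f) (hf0 : ∀ x, 0 ≤ f x) (hsol : IsDistribSol Dφ f)
    (hφ0 : ∀ᵐ x, 0 ≤ φ x) {χ : Space N → ℝ} (hχ : ContDiff ℝ ∞ χ) (hc : HasCompactSupport χ)
    (hχ0 : ∀ x, 0 ≤ χ x) :
    Integrable (fun x => χ x * (f x * φ x)) ∧ ∫ x, χ x * (f x * φ x) =
      (∫ x, χ x * ⟪Dφ x, Dφ x⟫) + ∫ x, φ x * ⟪Dφ x, ∇ χ x⟫ := by
  have h := hsol.test_nonneg (MemLp.memLpLoc hDφ) hf (Eventually.of_forall hf0) hc.isCompact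
      (hw.mul_smooth hχ) (memLp_gradient_mul_smooth hφ hDφ hχ hc)
      (hφ0.mono fun x hx => mul_nonneg (hχ0 x) hx)
      (fun x hx => by rw [image_eq_zero_of_notMem_tsupport hx, zero_mul])
      (fun x hx => by rw [image_eq_zero_of_notMem_tsupport hx, gradient_eq_zero_of_notMem hx,
        zero_smul, smul_zero, add_zero])
  rw [integral_inner_gradient_mul_smooth hφ hDφ hDφ hχ hc] at h
  simp only [mul_left_comm (f _)] at h
  exact h

/-- The energy identity of the Poisson equation. -/
theorem IsDistribSol.energy (hw : HasWeakGradient φ Dφ) (hφ : MemLp φ 2) (hDφ : MemLp Dφ 2)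
    (hf : LocallyIntegrable f) (hf0 : ∀ x, 0 ≤ f x) (hsol : IsDistribSol Dφ f)
    (hφ0 : ∀ᵐ x, 0 ≤ φ x) :
    Integrable (fun x => f x * φ x) ∧ ∫ x, f x * φ x = ∫ x, ⟪Dφ x, Dφ x⟫ := by
  have h := fun n => hsol.integral_smooth_mul hw hφ hDφ hf hf0 hφ0 (contDiff_cutoff n)
    (hasCompactSupport_cutoff n) (cutoff_nonneg n)
  have t := (tendsto_integral_cutoff_mul (integrable_inner_of_memLp (p := 2) (q := 2) hDφ hDφ)).add
    (tendsto_integral_gradient_cutoff hφ hDφ)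
  rw [add_zero] at t
  -- Integrability comes from the equation: the localised integrals converge, and they have
  -- nonnegative integrands.
  have hi : Integrable fun x => f x * φ x := by
    obtain ⟨C, hC⟩ := t.bddAbove_range
    refine integrable_of_tendsto_of_integral_le (fun n => (h n).1) (fun n => ?_) (C := C) (fun n => ?_)
      (Eventually.of_forall fun x => ?_)
    · filter_upwards [hφ0] with x hx
      exact mul_nonneg (cutoff_nonneg n x) (mul_nonneg (hf0 x) hx)
    · rw [(h n).2]; exact hC ⟨n, rfl⟩
    · simpa using (tendsto_cutoff x).mul_const (f x * φ x)
  exact ⟨hi, tendsto_nhds_unique (tendsto_integral_cutoff_mul hi) (t.congr fun n => (h n).2.symm)⟩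

end Poisson

/-! ### Regular solutions, their integrability, and the Nehari identity. -/

section Solutions

variable {N : ℕ} {α p q : ℝ} {K u φ : Space N → ℝ} {Du Dφ : Space N → Space N}

/-- The standing assumptions on the parameters. -/
structure Parameters (N : ℕ) (α p q : ℝ) (K : Space N → ℝ) : Prop where
  alpha_pos : 0 < α
  alpha_lt : α < N
  one_lt_p : 1 < p
  one_lt_q : 1 < q
  contDiff_K : ContDiff ℝ 1 K
  K_nonneg : ∀ x, 0 ≤ K x

/-- Weak solutions in the regularity class, with their weak gradients made explicit. -/
structure RegularSolution (α p q : ℝ) (K u φ : Space N → ℝ) (Du Dφ : Space N → Space N) : Prop where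
  params : Parameters N α p q K
  gradient_u : HasWeakGradient u Du
  gradient_phi : HasWeakGradient φ Dφ
  memLp_u : MemLp u 2
  memLp_Du : MemLp Du 2
  memLp_phi : MemLp φ 2
  memLp_Dphi : MemLp Dφ 2
  memLp_u_crit : MemLp u (ENNReal.ofReal (p * (2 * N / (N + α))))
  memLpLoc_Du_crit : MemLpLoc Du (ENNReal.ofReal (p * (2 * N / (N + α))))
  locallyIntegrable_source : LocallyIntegrable fun x => K x * |u x| ^ q
  poisson : IsDistribSol Dφ fun x => K x * |u x| ^ q
  choquard : ∀ η : Space N → ℝ, ContDiff ℝ ∞ η → HasCompactSupport η →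
    (∫ x, ⟪Du x, ∇ η x⟫) + (∫ x, u x * η x) + (∫ x, K x * φ x * oddPow q (u x) * η x) =
      ∫ x, rieszPotential α (fun y => |u y| ^ p) x * oddPow p (u x) * η x

theorem Parameters.dim_pos (P : Parameters N α p q K) : 0 < N :=
  Nat.cast_pos.1 (P.alpha_pos.trans P.alpha_lt)

/-- The nonlocal right-hand side `(I_α * |u|^p) |u|^(p-2) u`. -/
noncomputable def choquardTerm (α p : ℝ) (u : Space N → ℝ) (x : Space N) : ℝ :=
  rieszPotential α (fun y => |u y| ^ p) x * oddPow p (u x)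

theorem choquardTerm_mul_self (hp : 1 < p) (x : Space N) :
    choquardTerm α p u x * u x = rieszPotential α (fun y => |u y| ^ p) x * |u x| ^ p := by
  rw [choquardTerm, mul_assoc, oddPow_mul_self hp]

theorem Parameters.one_lt_crit (P : Parameters N α p q K) : 1 < p * (2 * N / (N + α) : ℝ) :=
  one_lt_mul_of_lt_of_le P.one_lt_p (hls_conjugate P.alpha_pos P.alpha_lt).lt.le

theorem MemLpLoc.mono_exponent {V : Type*} [NormedAddCommGroup V] {g : Space N → V} {a b : ℝ≥0∞}
    (hg : MemLpLoc g b) (hab : a ≤ b) : MemLpLoc g a := by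
  intro C hC
  have : IsFiniteMeasure (volume.restrict C) := ⟨by simpa using hC.measure_lt_top⟩
  exact (hg C hC).mono_exponent hab

namespace RegularSolution

theorem memLp_rpow (S : RegularSolution α p q K u φ Du Dφ) :
    MemLp (fun x => |u x| ^ p) (ENNReal.ofReal (2 * N / (N + α))) := by
  have hp0 : 0 < p := by linarith [S.params.one_lt_p]
  have := S.memLp_u_crit.norm_rpow_div (ENNReal.ofReal p)
  rw [ENNReal.toReal_ofReal hp0.le, ← ENNReal.ofReal_div_of_pos hp0,
    mul_div_cancel_left₀ _ hp0.ne'] at this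
  exact this

theorem memLp_potential (S : RegularSolution α p q K u φ Du Dφ) :
    MemLp (rieszPotential α fun y => |u y| ^ p) (ENNReal.ofReal (2 * N / (N - α))) :=
  (memLp_rieszPotential S.params.alpha_pos S.params.alpha_lt (fun x => by positivity)
    S.memLp_rpow).1

theorem memLpLoc_gradient_rpow (S : RegularSolution α p q K u φ Du Dφ) :
    MemLpLoc (fun x => (p * oddPow p (u x)) • Du x) (ENNReal.ofReal (2 * N / (N + α))) :=
  MemLpLoc.oddPow_smul S.params.one_lt_p (MemLp.memLpLoc S.memLp_u_crit) S.memLpLoc_Du_crit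

theorem gradient_rpow (S : RegularSolution α p q K u φ Du Dφ) :
    HasWeakGradient (fun x => |u x| ^ p) fun x => (p * oddPow p (u x)) • Du x := by
  have hle : ENNReal.ofReal p ≤ ENNReal.ofReal (p * (2 * N / (N + α))) :=
    ENNReal.ofReal_le_ofReal (le_mul_of_one_le_right (by linarith [S.params.one_lt_p])
      (hls_conjugate S.params.alpha_pos S.params.alpha_lt).lt.le)
  exact S.gradient_u.abs_rpow S.params.one_lt_p
    ((MemLp.memLpLoc S.memLp_u_crit).mono_exponent hle) (S.memLpLoc_Du_crit.mono_exponent hle)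

/-- Hölder's inequality with the potential in `L^(2N/(N - α))` and the odd power in `L^(s/(p - 1))`,
where `s = 2Np/(N + α)`: the reciprocals add up to `1 - 1/s`. The nonlocal term therefore pairs with
everything in the critical space of `u`. -/
theorem memLp_choquardTerm (S : RegularSolution α p q K u φ Du Dφ) :
    MemLp (choquardTerm α p u) (ENNReal.ofReal (p * (2 * N / (N + α) : ℝ)).conjExponent) := by
  have hp := S.params.one_lt_p
  set s : ℝ := p * (2 * N / (N + α)) with hs
  have hs1 : 1 < s := S.params.one_lt_crit
  have hconj := Real.HolderConjugate.conjExponent hs1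
  have hr := hls_conjugate S.params.alpha_pos S.params.alpha_lt
  have hodd : MemLp (fun x => oddPow p (u x)) (ENNReal.ofReal (s / (p - 1))) := by
    have h1 := S.memLp_u_crit.norm_rpow_div (ENNReal.ofReal (p - 1))
    rw [ENNReal.toReal_ofReal (by linarith), ← ENNReal.ofReal_div_of_pos (by linarith)] at h1
    refine h1.mono' ((continuous_oddPow hp).comp_aestronglyMeasurable S.memLp_u.1)
      (Eventually.of_forall fun x => ?_)
    rw [Real.norm_eq_abs, abs_oddPow hp, Real.norm_eq_abs]
  have hT : Real.HolderTriple (2 * N / (N - α) : ℝ) (s / (p - 1)) s.conjExponent := by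
    refine ⟨?_, hr.symm.pos, div_pos (by linarith) (by linarith)⟩
    have e1 := hr.inv_add_inv_eq_one
    have e2 := hconj.inv_add_inv_eq_one
    have e3 : (s / (p - 1))⁻¹ = (2 * N / (N + α) : ℝ)⁻¹ - s⁻¹ := by
      have hp0 : p ≠ 0 := by linarith
      have hr0 : (2 * N / (N + α) : ℝ) ≠ 0 := hr.pos.ne'
      rw [hs]
      generalize (2 * N / (N + α) : ℝ) = r at hr0
      field_simp
    rw [e3]
    linarith
  have := hT.ennrealOfReal
  exact MemLp.mul' hodd S.memLp_potential

theorem locallyIntegrable_choquardTerm (S : RegularSolution α p q K u φ Du Dφ) :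
    LocallyIntegrable (choquardTerm α p u) := by
  refine MemLpLoc.locallyIntegrable ?_ (MemLp.memLpLoc S.memLp_choquardTerm)
  rw [← ENNReal.ofReal_one]
  exact ENNReal.ofReal_le_ofReal (Real.HolderConjugate.conjExponent S.params.one_lt_crit).symm.lt.le

theorem source_nonneg (S : RegularSolution α p q K u φ Du Dφ) (x : Space N) :
    0 ≤ K x * |u x| ^ q := mul_nonneg (S.params.K_nonneg x) (by positivity)

theorem phi_nonneg (S : RegularSolution α p q K u φ Du Dφ) : ∀ᵐ x, 0 ≤ φ x :=
  S.poisson.nonneg S.params.dim_pos S.gradient_phi S.memLp_phi S.memLp_Dphi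
    S.locallyIntegrable_source S.source_nonneg

theorem coupling (S : RegularSolution α p q K u φ Du Dφ) :
    Integrable (fun x => K x * |u x| ^ q * φ x) ∧
      ∫ x, K x * |u x| ^ q * φ x = ∫ x, ⟪Dφ x, Dφ x⟫ :=
  S.poisson.energy S.gradient_phi S.memLp_phi S.memLp_Dphi S.locallyIntegrable_source
    S.source_nonneg S.phi_nonneg

theorem locallyIntegrable_u (S : RegularSolution α p q K u φ Du Dφ) : LocallyIntegrable u :=
  S.gradient_u.1

/-- Since `|u|^(q - 1) ≤ 1 + |u|^q`, the term is dominated by `K |φ|` plus the coupling density,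
which the energy identity shows to be integrable. -/
theorem locallyIntegrable_coupling (S : RegularSolution α p q K u φ Du Dφ) :
    LocallyIntegrable fun x => K x * φ x * oddPow q (u x) := by
  have hq := S.params.one_lt_q
  have hKc : Continuous K := S.params.contDiff_K.continuous
  have h1 : LocallyIntegrable fun x => K x * φ x := locallyIntegrable_iff.2 fun C hC =>
    (S.gradient_phi.1.integrableOn_isCompact hC).continuousOn_mul hKc.continuousOn hC
  have h1n : LocallyIntegrable fun x => ‖K x * φ x‖ := locallyIntegrable_iff.2 fun C hC =>
    (h1.integrableOn_isCompact hC).norm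
  refine (h1n.add S.coupling.1.norm.locallyIntegrable).mono
    ((hKc.aestronglyMeasurable.mul S.memLp_phi.1).mul
      ((continuous_oddPow hq).comp_aestronglyMeasurable S.memLp_u.1))
    (Eventually.of_forall fun x => ?_)
  have h2 : |u x| ^ (q - 1) ≤ 1 + |u x| ^ q := by
    rcases le_total |u x| 1 with h | h
    · exact (Real.rpow_le_one (abs_nonneg _) h (by linarith)).trans
        (le_add_of_nonneg_right (by positivity))
    · exact (Real.rpow_le_rpow_of_exponent_le h (by linarith)).trans
        (le_add_of_nonneg_left zero_le_one)
  have h3 : 0 ≤ |u x| ^ q := by positivity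
  simp only [Pi.add_apply, norm_mul, Real.norm_eq_abs, abs_oddPow hq, abs_of_nonneg h3]
  rw [abs_of_nonneg (by positivity : 0 ≤ |K x| * |φ x| + |K x| * |u x| ^ q * |φ x|)]
  calc |K x| * |φ x| * |u x| ^ (q - 1) ≤ |K x| * |φ x| * (1 + |u x| ^ q) := by gcongr
    _ = _ := by ring

theorem isDistribSol (S : RegularSolution α p q K u φ Du Dφ) :
    IsDistribSol Du fun x => (choquardTerm α p u x - u x) - K x * φ x * oddPow q (u x) := by
  intro η hη hc
  have h := S.choquard η hη hc
  have i1 : Integrable fun x => u x * η x :=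
    LocallyIntegrable.smul_test S.locallyIntegrable_u hη.continuous hc
  have i2 : Integrable fun x => K x * φ x * oddPow q (u x) * η x :=
    LocallyIntegrable.smul_test S.locallyIntegrable_coupling hη.continuous hc
  have i3 : Integrable fun x => choquardTerm α p u x * η x :=
    LocallyIntegrable.smul_test S.locallyIntegrable_choquardTerm hη.continuous hc
  simp only [sub_mul]
  have i31 : Integrable fun x => choquardTerm α p u x * η x - u x * η x := i3.sub i1
  rw [integral_sub i31 i2, integral_sub i3 i1]
  simp only [choquardTerm]
  linarith

/-- The pairing of the nonlocal term with functions of the critical Lebesgue space. -/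
theorem integrable_choquardTerm_mul (S : RegularSolution α p q K u φ Du Dφ) {w : Space N → ℝ}
    (hw : MemLp w (ENNReal.ofReal (p * (2 * N / (N + α))))) :
    Integrable fun x => choquardTerm α p u x * w x := by
  have := (Real.HolderConjugate.conjExponent S.params.one_lt_crit).symm.ennrealOfReal
  exact MemLp.integrable_mul S.memLp_choquardTerm hw

/-- Tested with `c χ u`, the coupling term is an integrable density, so the one-sided test applies
with `Θ` equal to it. The free sign of `c` turns the inequality into an equality. -/
theorem test_signed (S : RegularSolution α p q K u φ Du Dφ) {χ : Space N → ℝ}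
    (hχ : ContDiff ℝ ∞ χ) (hc : HasCompactSupport χ) (c : ℝ) :
    c * ∫ x, χ x * (choquardTerm α p u x * u x - u x ^ 2) ≤
      c * ((∫ x, χ x * ⟪Du x, Du x⟫) + (∫ x, u x * ⟪Du x, ∇ χ x⟫) +
        ∫ x, χ x * (K x * |u x| ^ q * φ x)) := by
  have hq := S.params.one_lt_q
  have i1 := LocallyIntegrable.test_smul S.coupling.1.locallyIntegrable hχ.continuous hc
  have i2 : Integrable fun x => χ x * (choquardTerm α p u x * u x - u x ^ 2) :=
    LocallyIntegrable.test_smul (((S.integrable_choquardTerm_mul S.memLp_u_crit).sub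
      S.memLp_u.integrable_sq).locallyIntegrable) hχ.continuous hc
  have hD := memLp_gradient_mul_smooth S.memLp_u S.memLp_Du hχ hc
  have e : ∀ x, (choquardTerm α p u x - u x) * (c * (χ x * u x)) =
      c * (χ x * (choquardTerm α p u x * u x - u x ^ 2)) := fun x => by ring
  have h := S.isDistribSol.test_le (MemLp.memLpLoc S.memLp_Du)
    (S.locallyIntegrable_choquardTerm.sub S.locallyIntegrable_u) S.locallyIntegrable_coupling
    hc.isCompact ((S.gradient_u.mul_smooth hχ).const_mul c) (hD.const_smul c)
    (Θ := fun x => c * (χ x * (K x * |u x| ^ q * φ x)))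
    (fun x hx => by rw [image_eq_zero_of_notMem_tsupport hx, zero_mul, mul_zero])
    (fun x hx => by simp [image_eq_zero_of_notMem_tsupport hx, gradient_eq_zero_of_notMem hx])
    (by simp only [e]; exact i2.const_mul c) (i1.const_mul c)
    (Eventually.of_forall fun x => le_of_eq (by rw [← oddPow_mul_self hq]; ring))
  simp only [e] at h
  rw [integral_const_mul, integral_const_mul] at h
  have e2 : ∫ x, ⟪Du x, (c • fun x => χ x • Du x + u x • ∇ χ x) x⟫ =
      c * ((∫ x, χ x * ⟪Du x, Du x⟫) + ∫ x, u x * ⟪Du x, ∇ χ x⟫) := by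
    rw [← integral_inner_gradient_mul_smooth S.memLp_u S.memLp_Du S.memLp_Du hχ hc,
      ← integral_const_mul]
    simp only [Pi.smul_apply, inner_smul_right _ _ c]
  have e3 : ∀ A B : ℝ, c * A + c * B = c * (A + B) := fun A B => (mul_add c A B).symm
  rw [← e3, ← e2]
  exact h

/-- The Nehari identity. -/
theorem nehari (S : RegularSolution α p q K u φ Du Dφ) :
    (∫ x, ⟪Du x, Du x⟫) + (∫ x, u x ^ 2) + ∫ x, ⟪Dφ x, Dφ x⟫ =
      ∫ x, rieszPotential α (fun y => |u y| ^ p) x * |u x| ^ p := by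
  have h : ∀ n : ℕ, ∫ x, cutoff n x * (choquardTerm α p u x * u x - u x ^ 2) =
      (∫ x, cutoff n x * ⟪Du x, Du x⟫) + (∫ x, u x * ⟪Du x, ∇ (cutoff n) x⟫) +
        ∫ x, cutoff n x * (K x * |u x| ^ q * φ x) := by
    intro n
    have h1 := S.test_signed (contDiff_cutoff n) (hasCompactSupport_cutoff n) 1
    have h2 := S.test_signed (contDiff_cutoff n) (hasCompactSupport_cutoff n) (-1)
    linarith
  have i1 := S.integrable_choquardTerm_mul S.memLp_u_crit
  have t1 := tendsto_integral_cutoff_mul (i1.sub S.memLp_u.integrable_sq)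
  have t2 := ((tendsto_integral_cutoff_mul (integrable_inner_of_memLp (p := 2) (q := 2)
    S.memLp_Du S.memLp_Du)).add (tendsto_integral_gradient_cutoff S.memLp_u S.memLp_Du)).add
    (tendsto_integral_cutoff_mul S.coupling.1)
  have h3 := tendsto_nhds_unique t1 (t2.congr fun n => (h n).symm)
  simp only [Pi.sub_apply] at h3
  rw [integral_sub i1 S.memLp_u.integrable_sq, S.coupling.2, add_zero] at h3
  simp only [choquardTerm_mul_self S.params.one_lt_p] at h3
  linarith

end RegularSolution

end Solutions

/-! ### The one-sided dilation inequality. -/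

section Dilations

variable {N : ℕ} {α p q γ t : ℝ} {K u φ χ : Space N → ℝ} {Du Dφ : Space N → Space N}

/-- The convex function `|s|^q / q` lies above its tangent at `a`; the proof is Young's inequality.
-/
theorem oddPow_mul_sub_le (hq : 1 < q) (a b : ℝ) :
    oddPow q a * (b - a) ≤ (1 / q) * (|b| ^ q - |a| ^ q) := by
  have hc := Real.HolderConjugate.conjExponent hq
  have h1 : oddPow q a * b ≤ |a| ^ (q - 1) * |b| := by
    refine (le_abs_self _).trans (le_of_eq ?_)
    rw [abs_mul, abs_oddPow hq]
  have h2 := Real.young_inequality_of_nonneg (by positivity : 0 ≤ |a| ^ (q - 1)) (abs_nonneg b) hc.symm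
  rw [← Real.rpow_mul (abs_nonneg a), hc.sub_one_mul_conj] at h2
  have h3 : q.conjExponent⁻¹ = 1 - q⁻¹ := by linarith [hc.inv_add_inv_eq_one]
  rw [div_eq_mul_inv, h3] at h2
  rw [mul_sub, oddPow_mul_self hq, one_div]
  have h4 : |b| ^ q / q = q⁻¹ * |b| ^ q := by rw [div_eq_mul_inv, mul_comm]
  rw [h4] at h2
  linarith

theorem hasDerivAt_dilate_weight (hK : ContDiff ℝ 1 K) (ht : 0 < t) (x : Space N) :
    HasDerivAt (fun t : ℝ => t ^ γ * K (t • x))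
      (t ^ (γ - 1) * (⟪t • x, ∇ K (t • x)⟫ + γ * K (t • x))) t := by
  have h1 : HasDerivAt (fun t : ℝ => t • x) x t := by simpa using (hasDerivAt_id t).smul_const x
  have h2 := ((hK.differentiable one_ne_zero) (t • x)).hasFDerivAt.comp_hasDerivAt t h1
  have h3 := (Real.hasDerivAt_rpow_const (p := γ) (Or.inl ht.ne')).mul h2
  refine h3.congr_deriv ?_
  rw [inner_gradient, map_smul, smul_eq_mul, comp_apply, Real.rpow_sub_one ht.ne']
  field_simp
  ring

/-- The sign condition says precisely that `t ↦ t^γ K(tx)` is nondecreasing along rays; the values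
at `1` and `t` are compared. -/
theorem le_rpow_mul_dilate (hK : ContDiff ℝ 1 K) (h : ∀ x, 0 ≤ ⟪x, ∇ K x⟫ + γ * K x)
    (ht : 1 ≤ t) (x : Space N) : K x ≤ t ^ γ * K (t • x) := by
  have hm : MonotoneOn (fun t : ℝ => t ^ γ * K (t • x)) (Set.Ioi 0) :=
    monotoneOn_of_deriv_nonneg (convex_Ioi 0)
      (fun s hs => (hasDerivAt_dilate_weight hK hs x).continuousAt.continuousWithinAt)
      (fun s hs => (hasDerivAt_dilate_weight hK (by simpa using hs) x).differentiableAt.differentiableWithinAt)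
      (fun s hs => by
        have hs0 : 0 < s := by simpa using hs
        rw [(hasDerivAt_dilate_weight hK hs0 x).deriv]
        exact mul_nonneg (by positivity) (h _))
  simpa using hm (Set.mem_Ioi.2 one_pos) (Set.mem_Ioi.2 (one_pos.trans_le ht)) ht

/-- With the opposite sign the same function is nonincreasing, so the same bound holds on the other
side of `t = 1`. -/
theorem le_rpow_mul_dilate' (hK : ContDiff ℝ 1 K) (h : ∀ x, ⟪x, ∇ K x⟫ + γ * K x ≤ 0)
    (ht0 : 0 < t) (ht : t ≤ 1) (x : Space N) : K x ≤ t ^ γ * K (t • x) := by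
  have hm : AntitoneOn (fun t : ℝ => t ^ γ * K (t • x)) (Set.Ioi 0) :=
    antitoneOn_of_deriv_nonpos (convex_Ioi 0)
      (fun s hs => (hasDerivAt_dilate_weight hK hs x).continuousAt.continuousWithinAt)
      (fun s hs => (hasDerivAt_dilate_weight hK (by simpa using hs) x).differentiableAt.differentiableWithinAt)
      (fun s hs => by
        have hs0 : 0 < s := by simpa using hs
        rw [(hasDerivAt_dilate_weight hK hs0 x).deriv]
        exact mul_nonpos_of_nonneg_of_nonpos (by positivity) (h _))
  simpa using hm (Set.mem_Ioi.2 ht0) (Set.mem_Ioi.2 one_pos) ht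

theorem integral_mul_comp_smul (χ g : Space N → ℝ) (ht : 0 < t) :
    ∫ x, χ x * g (t • x) = (t ^ N)⁻¹ * ∫ x, χ (t⁻¹ • x) * g x := by
  have h := integral_comp_smul_space (fun x => χ (t⁻¹ • x) * g x) ht
  simp only [smul_smul, inv_mul_cancel₀ ht.ne', one_smul] at h
  exact h

namespace RegularSolution

/-- Upper bound for the coupling energy of a dilated source. -/
theorem coupling_dilate_le (S : RegularSolution α p q K u φ Du Dφ) (hχ : ContDiff ℝ ∞ χ)
    (hc : HasCompactSupport χ) (hχ0 : ∀ x, 0 ≤ χ x) (ht : 0 < t) :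
    Integrable (fun x => χ x * φ x * (K (t • x) * |u (t • x)| ^ q)) ∧
    ∫ x, χ x * φ x * (K (t • x) * |u (t • x)| ^ q) ≤ (t ^ N)⁻¹ * (t⁻¹ *
      ((1 / 2) * (∫ x, χ (t⁻¹ • x) * ⟪Dφ x, Dφ x⟫) + (1 / 2) * (t ^ N * ∫ x, χ x * ⟪Dφ x, Dφ x⟫) +
        ∫ x, φ (t⁻¹ • x) * ⟪Dφ x, ∇ χ (t⁻¹ • x)⟫)) := by
  have hl : 0 < t⁻¹ := inv_pos.2 ht
  have hcl := tsupport_comp_smul_isCompact hc hl.ne'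
  have hχl : ContDiff ℝ ∞ fun x : Space N => χ (t⁻¹ • x) := hχ.comp (contDiff_const_smul _)
  have hφl := MemLp.comp_smul_space S.memLp_phi hl
  have hDφl := MemLp.comp_smul_space S.memLp_Dphi hl
  have hwl := S.gradient_phi.comp_smul hl
  have hφ0 : ∀ᵐ x, 0 ≤ φ (t⁻¹ • x) :=
    (quasiMeasurePreserving_smul_space hl).ae S.phi_nonneg
  have hv := hwl.mul_smooth hχl
  have hDv := memLp_gradient_mul_smooth hφl (hDφl.const_smul t⁻¹) hχl hcl
  -- After the change of variables by `t`, the source is undilated and the factor `χ φ` is dilated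
  -- by `t⁻¹`; the integral becomes the Poisson equation tested with that dilate.
  have h := S.poisson.test_nonneg (MemLp.memLpLoc S.memLp_Dphi) S.locallyIntegrable_source
    (Eventually.of_forall S.source_nonneg) hcl.isCompact hv hDv
    (hφ0.mono fun x hx => mul_nonneg (hχ0 _) hx)
    (fun x hx => by
      have h0 : χ (t⁻¹ • x) = 0 := image_eq_zero_of_notMem_tsupport (f := fun x => χ (t⁻¹ • x)) hx
      rw [h0, zero_mul])
    (fun x hx => by
      have h0 : χ (t⁻¹ • x) = 0 := image_eq_zero_of_notMem_tsupport (f := fun x => χ (t⁻¹ • x)) hx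
      rw [h0, gradient_eq_zero_of_notMem hx, zero_smul, smul_zero, add_zero])
  have hsplit := integral_inner_gradient_mul_smooth hφl (hDφl.const_smul t⁻¹) S.memLp_Dphi hχl hcl
  constructor
  · have h1 := h.1.comp_smul ht.ne'
    refine h1.congr (Eventually.of_forall fun x => ?_)
    simp only [smul_smul, inv_mul_cancel₀ ht.ne', one_smul]
    ring
  · have e0 : ∫ x, χ x * φ x * (K (t • x) * |u (t • x)| ^ q) =
        (t ^ N)⁻¹ * ∫ x, K x * |u x| ^ q * (χ (t⁻¹ • x) * φ (t⁻¹ • x)) := by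
      rw [integral_mul_comp_smul (fun x => χ x * φ x) (fun x => K x * |u x| ^ q) ht]
      congr 1
      exact integral_congr_ae (Eventually.of_forall fun x => by simp only; ring)
    rw [e0, h.2]
    refine mul_le_mul_of_nonneg_left ?_ (by positivity)
    have e1 : ∫ x, ⟪Dφ x, χ (t⁻¹ • x) • t⁻¹ • Dφ (t⁻¹ • x) + φ (t⁻¹ • x) •
        ∇ (fun x => χ (t⁻¹ • x)) x⟫ = (∫ x, χ (t⁻¹ • x) * ⟪Dφ x, t⁻¹ • Dφ (t⁻¹ • x)⟫) +
        ∫ x, φ (t⁻¹ • x) * ⟪Dφ x, ∇ (fun x => χ (t⁻¹ • x)) x⟫ := hsplit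
    rw [e1]
    have e2 : ∫ x, φ (t⁻¹ • x) * ⟪Dφ x, ∇ (fun x => χ (t⁻¹ • x)) x⟫ =
        t⁻¹ * ∫ x, φ (t⁻¹ • x) * ⟪Dφ x, ∇ χ (t⁻¹ • x)⟫ := by
      rw [← integral_const_mul]
      refine integral_congr_ae (Eventually.of_forall fun x => ?_)
      simp only [gradient_comp_smul, inner_smul_right]
      ring
    have j1 : Integrable fun x => χ (t⁻¹ • x) * ⟪Dφ x, Dφ x⟫ :=
      LocallyIntegrable.test_smul (integrable_inner_of_memLp (p := 2) (q := 2) S.memLp_Dphi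
        S.memLp_Dphi).locallyIntegrable hχl.continuous hcl
    have j2 : Integrable fun x => χ (t⁻¹ • x) * ⟪Dφ (t⁻¹ • x), Dφ (t⁻¹ • x)⟫ :=
      LocallyIntegrable.test_smul (integrable_inner_of_memLp (p := 2) (q := 2) hDφl
        hDφl).locallyIntegrable hχl.continuous hcl
    have j3 : Integrable fun x => χ (t⁻¹ • x) * ⟪Dφ x, Dφ (t⁻¹ • x)⟫ :=
      LocallyIntegrable.test_smul (integrable_inner_of_memLp (p := 2) (q := 2) S.memLp_Dphi
        hDφl).locallyIntegrable hχl.continuous hcl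
    have e3 : ∫ x, χ (t⁻¹ • x) * ⟪Dφ x, t⁻¹ • Dφ (t⁻¹ • x)⟫ =
        t⁻¹ * ∫ x, χ (t⁻¹ • x) * ⟪Dφ x, Dφ (t⁻¹ • x)⟫ := by
      rw [← integral_const_mul]
      refine integral_congr_ae (Eventually.of_forall fun x => ?_)
      simp only [inner_smul_right]
      ring
    have e4 : ∫ x, χ (t⁻¹ • x) * ⟪Dφ (t⁻¹ • x), Dφ (t⁻¹ • x)⟫ = t ^ N * ∫ x, χ x * ⟪Dφ x, Dφ x⟫ := by
      have := integral_comp_smul_space (fun x => χ x * ⟪Dφ x, Dφ x⟫) hl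
      rw [inv_pow, inv_inv, smul_eq_mul] at this
      exact this
    -- Cauchy's inequality decouples the field from its dilate. It is an equality at `t = 1`, so
    -- nothing is lost when the bound is compared there.
    have e5 : ∫ x, χ (t⁻¹ • x) * ⟪Dφ x, Dφ (t⁻¹ • x)⟫ ≤
        (1 / 2) * (∫ x, χ (t⁻¹ • x) * ⟪Dφ x, Dφ x⟫) +
          (1 / 2) * ∫ x, χ (t⁻¹ • x) * ⟪Dφ (t⁻¹ • x), Dφ (t⁻¹ • x)⟫ := by
      rw [← integral_const_mul, ← integral_const_mul, ← integral_add (j1.const_mul _) (j2.const_mul _)]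
      refine integral_mono j3 ((j1.const_mul _).add (j2.const_mul _)) fun x => ?_
      have h1 := real_inner_self_nonneg (x := Dφ x - Dφ (t⁻¹ • x))
      rw [real_inner_sub_sub_self] at h1
      have h2 := mul_nonneg (hχ0 (t⁻¹ • x)) h1
      simp only
      linarith
    rw [e2, e3, ← mul_add]
    refine mul_le_mul_of_nonneg_left ?_ hl.le
    rw [e4] at e5
    linarith

/-- The one-sided dilation inequality. -/
theorem dilation_inequality (S : RegularSolution α p q K u φ Du Dφ) (hχ : ContDiff ℝ ∞ χ)
    (hc : HasCompactSupport χ) (hχ0 : ∀ x, 0 ≤ χ x) (ht : 0 < t)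
    (hK : ∀ x, K x ≤ t ^ γ * K (t • x)) :
    (∫ x, χ x * choquardTerm α p u x * u (t • x)) - (∫ x, χ x * choquardTerm α p u x * u x) ≤
      (1 / 2) * ((∫ x, χ x * u (t • x) ^ 2) - ∫ x, χ x * u x ^ 2) +
      (1 / 2) * ((t ^ 2 * ∫ x, χ x * ⟪Du (t • x), Du (t • x)⟫) - ∫ x, χ x * ⟪Du x, Du x⟫) +
      ((∫ x, ⟪Du x, ∇ χ x⟫ * u (t • x)) - ∫ x, ⟪Du x, ∇ χ x⟫ * u x) +
      (1 / q) * ((t ^ γ * ∫ x, χ x * φ x * (K (t • x) * |u (t • x)| ^ q)) -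
        ∫ x, χ x * (K x * |u x| ^ q * φ x)) := by
  have hq := S.params.one_lt_q
  have hut := MemLp.comp_smul_space S.memLp_u ht
  have hDut := MemLp.comp_smul_space S.memLp_Du ht
  have hw := (S.gradient_u.comp_smul ht).sub S.gradient_u
  have hwm : MemLp (fun x => u (t • x) - u x) 2 := hut.sub S.memLp_u
  have hDwm : MemLp (fun x => t • Du (t • x) - Du x) 2 := (hDut.const_smul t).sub S.memLp_Du
  have test : ∀ {g : Space N → ℝ}, Integrable g → Integrable fun x => χ x * g x := fun hg =>
    LocallyIntegrable.test_smul hg.locallyIntegrable hχ.continuous hc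
  have inner2 : ∀ {a b : Space N → Space N}, MemLp a 2 → MemLp b 2 → Integrable fun x => ⟪a x, b x⟫ :=
    fun ha hb => integrable_inner_of_memLp (p := 2) (q := 2) ha hb
  have hgχ : MemLp (fun x => ⟪Du x, ∇ χ x⟫) 2 := by
    obtain ⟨C, hC⟩ := (HasCompactSupport.gradient hc).exists_bound_of_continuous
      (ContDiff.gradient_space hχ).continuous
    refine (S.memLp_Du.norm.mul_const C).mono' (S.memLp_Du.1.inner
      (ContDiff.gradient_space hχ).continuous.aestronglyMeasurable) (Eventually.of_forall fun x => ?_)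
    exact (norm_inner_le_norm _ _).trans (mul_le_mul_of_nonneg_left (hC x) (norm_nonneg _))
  have k1 : Integrable fun x => χ x * (choquardTerm α p u x * u (t • x)) :=
    test (S.integrable_choquardTerm_mul (MemLp.comp_smul_space S.memLp_u_crit ht))
  have k2 : Integrable fun x => χ x * (choquardTerm α p u x * u x) :=
    test (S.integrable_choquardTerm_mul S.memLp_u_crit)
  have k3 : Integrable fun x => χ x * u (t • x) ^ 2 := test hut.integrable_sq
  have k4 : Integrable fun x => χ x * u x ^ 2 := test S.memLp_u.integrable_sq
  have k5 : Integrable fun x => χ x * ⟪Du (t • x), Du (t • x)⟫ := test (inner2 hDut hDut)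
  have k6 : Integrable fun x => χ x * ⟪Du x, Du x⟫ := test (inner2 S.memLp_Du S.memLp_Du)
  have k7 : Integrable fun x => ⟪Du x, ∇ χ x⟫ * u (t • x) :=
    MemLp.integrable_mul (p := 2) (q := 2) hgχ hut
  have k8 : Integrable fun x => ⟪Du x, ∇ χ x⟫ * u x :=
    MemLp.integrable_mul (p := 2) (q := 2) hgχ S.memLp_u
  have k9 := (S.coupling_dilate_le hχ hc hχ0 ht).1
  have k10 : Integrable fun x => χ x * (K x * |u x| ^ q * φ x) := test S.coupling.1
  have k11 : Integrable fun x => χ x * (u x * u (t • x)) :=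
    test (MemLp.integrable_mul (p := 2) (q := 2) S.memLp_u hut)
  have k12 : Integrable fun x => χ x * ⟪Du x, t • Du (t • x) - Du x⟫ :=
    test (inner2 S.memLp_Du hDwm)
  have hF : ∀ x, (choquardTerm α p u x - u x) * (χ x * (u (t • x) - u x)) =
      (χ x * (choquardTerm α p u x * u (t • x)) - χ x * (choquardTerm α p u x * u x)) -
        (χ x * (u x * u (t • x)) - χ x * u x ^ 2) := fun x => by ring
  have hFi : Integrable fun x => (choquardTerm α p u x - u x) * (χ x * (u (t • x) - u x)) := by
    simp only [hF]
    exact (k1.sub k2).sub (k11.sub k4)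
  -- The test function `χ(x) (u(tx) - u(x))` is a finite difference version of `χ x · ∇u`. The
  -- coupling term is bounded by `Θ` through convexity of `|s|^q`, positivity of `φ`, and the
  -- comparison of `K` with its dilate.
  have h := S.isDistribSol.test_le (MemLp.memLpLoc S.memLp_Du)
    (S.locallyIntegrable_choquardTerm.sub S.locallyIntegrable_u) S.locallyIntegrable_coupling
    hc.isCompact (hw.mul_smooth hχ) (memLp_gradient_mul_smooth hwm hDwm hχ hc)
    (Θ := fun x => (1 / q) * (t ^ γ * (χ x * φ x * (K (t • x) * |u (t • x)| ^ q)) -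
      χ x * (K x * |u x| ^ q * φ x)))
    (fun x hx => by rw [image_eq_zero_of_notMem_tsupport hx, zero_mul])
    (fun x hx => by simp [image_eq_zero_of_notMem_tsupport hx, gradient_eq_zero_of_notMem hx])
    hFi (((k9.const_mul _).sub k10).const_mul _) (by
      filter_upwards [S.phi_nonneg] with x hx
      have h1 := oddPow_mul_sub_le hq (u x) (u (t • x))
      have hKx := S.params.K_nonneg x
      have h2 : 0 ≤ K x * φ x * χ x := mul_nonneg (mul_nonneg hKx hx) (hχ0 x)
      have h3 := mul_le_mul_of_nonneg_left h1 h2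
      have h4 : 0 ≤ χ x * φ x * |u (t • x)| ^ q :=
        mul_nonneg (mul_nonneg (hχ0 x) hx) (by positivity)
      have h5 := mul_le_mul_of_nonneg_left (mul_le_mul_of_nonneg_left (hK x) h4)
        (by positivity : 0 ≤ 1 / q)
      calc K x * φ x * oddPow q (u x) * (χ x * (u (t • x) - u x))
          = K x * φ x * χ x * (oddPow q (u x) * (u (t • x) - u x)) := by ring
        _ ≤ K x * φ x * χ x * ((1 / q) * (|u (t • x)| ^ q - |u x| ^ q)) := h3
        _ = (1 / q) * (χ x * φ x * |u (t • x)| ^ q * K x) -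
              (1 / q) * (χ x * (K x * |u x| ^ q * φ x)) := by ring
        _ ≤ (1 / q) * (χ x * φ x * |u (t • x)| ^ q * (t ^ γ * K (t • x))) -
              (1 / q) * (χ x * (K x * |u x| ^ q * φ x)) := by linarith
        _ = _ := by ring)
  rw [integral_inner_gradient_mul_smooth hwm hDwm S.memLp_Du hχ hc] at h
  simp only [hF] at h
  have k1' : Integrable fun x => χ x * (choquardTerm α p u x * u (t • x)) -
    χ x * (choquardTerm α p u x * u x) := k1.sub k2
  have k11' : Integrable fun x => χ x * (u x * u (t • x)) - χ x * u x ^ 2 := k11.sub k4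
  have k9' : Integrable fun x => t ^ γ * (χ x * φ x * (K (t • x) * |u (t • x)| ^ q)) := k9.const_mul _
  rw [integral_sub k1' k11', integral_sub k1 k2, integral_sub k11 k4, integral_const_mul,
    integral_sub k9' k10, integral_const_mul] at h
  have e1 : ∫ x, (u (t • x) - u x) * ⟪Du x, ∇ χ x⟫ =
      (∫ x, ⟪Du x, ∇ χ x⟫ * u (t • x)) - ∫ x, ⟪Du x, ∇ χ x⟫ * u x := by
    rw [← integral_sub k7 k8]
    exact integral_congr_ae (Eventually.of_forall fun x => by simp only; ring)
  -- Here `⟪a, b - a⟫ ≤ (|b|² - |a|²)/2` with `b = t Du(tx)`, the gradient of the dilate; `e3` does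
  -- the same for the zeroth order term.
  have e2 : ∫ x, χ x * ⟪Du x, t • Du (t • x) - Du x⟫ ≤
      (1 / 2) * ((t ^ 2 * ∫ x, χ x * ⟪Du (t • x), Du (t • x)⟫) - ∫ x, χ x * ⟪Du x, Du x⟫) := by
    rw [← integral_const_mul, ← integral_sub (k5.const_mul _) k6, ← integral_const_mul]
    refine integral_mono k12 (((k5.const_mul _).sub k6).const_mul _) fun x => ?_
    have h1 := real_inner_self_nonneg (x := t • Du (t • x) - Du x)
    rw [real_inner_sub_sub_self, real_inner_smul_left, real_inner_smul_right,
      real_inner_smul_left] at h1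
    have h2 := mul_nonneg (hχ0 x) h1
    simp only [inner_sub_right, inner_smul_right]
    rw [real_inner_comm (Du (t • x)) (Du x)]
    nlinarith [h2]
  have e3 : ∫ x, χ x * (u x * u (t • x)) ≤
      (1 / 2) * ((∫ x, χ x * u (t • x) ^ 2) + ∫ x, χ x * u x ^ 2) := by
    rw [← integral_add k3 k4, ← integral_const_mul]
    refine integral_mono k11 ((k3.add k4).const_mul _) fun x => ?_
    have h2 := mul_nonneg (hχ0 x) (sq_nonneg (u (t • x) - u x))
    simp only
    nlinarith [h2]
  simp only [mul_assoc] at h e1 e2 e3 ⊢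
  linarith

end RegularSolution

end Dilations

/-! ### The dilation gap as a function of one real variable. -/

section Calculus

/-- The right-hand side minus the left-hand side of the dilation inequality, as a function of the
dilation parameter. -/
noncomputable def dilationGap (N : ℕ) (q γ : ℝ) (a b c d e l : ℝ → ℝ) (t : ℝ) : ℝ :=
  (1 / 2) * ((t ^ N)⁻¹ * a t⁻¹ - a 1) + (1 / 2) * (t ^ 2 * ((t ^ N)⁻¹ * b t⁻¹) - b 1) +
    (d t - d 1) + (1 / q) * (t ^ γ * ((t ^ N)⁻¹ * (t⁻¹ * ((1 / 2) * c t⁻¹ +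
      (1 / 2) * (t ^ N * c 1) + e t⁻¹))) - (c 1 + e 1)) - (l t - l 1)

theorem dilationGap_one (N : ℕ) (q γ : ℝ) (a b c d e l : ℝ → ℝ) :
    dilationGap N q γ a b c d e l 1 = 0 := by
  simp only [dilationGap, one_pow, inv_one, one_mul, Real.one_rpow]
  ring

theorem hasDerivAt_dilationGap {N : ℕ} {q γ : ℝ} {a b c d e l : ℝ → ℝ} {a' b' c' d' e' l' : ℝ}
    (ha : HasDerivAt a a' 1) (hb : HasDerivAt b b' 1) (hc : HasDerivAt c c' 1)
    (hd : HasDerivAt d d' 1) (he : HasDerivAt e e' 1) (hl : HasDerivAt l l' 1) :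
    HasDerivAt (dilationGap N q γ a b c d e l)
      ((1 / 2) * (-N * a 1 - a') + (1 / 2) * ((2 - N) * b 1 - b') + d' +
        (1 / q) * ((γ - N - 1) * (c 1 + e 1) + (N / 2 * c 1 - c' / 2 - e')) - l') 1 := by
  have hinv : HasDerivAt (fun t : ℝ => t⁻¹) (-1) 1 := by simpa using hasDerivAt_inv (one_ne_zero' ℝ)
  have comp : ∀ {g : ℝ → ℝ} {g' : ℝ}, HasDerivAt g g' 1 → HasDerivAt (fun t => g t⁻¹) (-g') 1 := by
    intro g g' hg
    have h1 : HasDerivAt g g' (1 : ℝ)⁻¹ := by rwa [inv_one]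
    have h2 := h1.comp 1 hinv
    rw [mul_neg_one] at h2
    exact h2
  have hpow : HasDerivAt (fun t : ℝ => t ^ N) N 1 := by simpa using hasDerivAt_pow N (1 : ℝ)
  have hpinv : HasDerivAt (fun t : ℝ => (t ^ N)⁻¹) (-N) 1 := by
    have h2 : HasDerivAt (fun t : ℝ => (t ^ N)⁻¹) _ 1 := hpow.inv (by simp)
    simpa using h2
  have hsq : HasDerivAt (fun t : ℝ => t ^ 2) 2 1 := by simpa using hasDerivAt_pow 2 (1 : ℝ)
  have hγ : HasDerivAt (fun t : ℝ => t ^ γ) γ 1 := by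
    simpa using Real.hasDerivAt_rpow_const (x := 1) (p := γ) (Or.inl one_ne_zero)
  have t1 := ((hpinv.mul (comp ha)).sub_const (a 1)).const_mul (1 / 2)
  have t2 := ((hsq.mul (hpinv.mul (comp hb))).sub_const (b 1)).const_mul (1 / 2)
  have t3 := hd.sub_const (d 1)
  have t4 := ((hγ.mul (hpinv.mul (hinv.mul ((((comp hc).const_mul (1 / 2)).add
    ((hpow.mul_const (c 1)).const_mul (1 / 2))).add (comp he))))).sub_const (c 1 + e 1)).const_mul
    (1 / q)
  have t5 := hl.sub_const (l 1)
  have h := (((t1.add t2).add t3).add t4).sub t5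
  refine h.congr_deriv ?_
  simp only [one_pow, inv_one, Real.one_rpow, Pi.mul_apply, Pi.add_apply]
  ring

/-- The one-sided slopes at the zero `t = 1` are nonnegative. Only one side is available, because
the comparison of `K` with its dilates holds only there. -/
theorem deriv_nonneg_of_right {f : ℝ → ℝ} {f' : ℝ} (hf : HasDerivAt f f' 1) (h1 : f 1 = 0)
    (h : ∀ t, 1 < t → 0 ≤ f t) : 0 ≤ f' := by
  have h2 := (hasDerivWithinAt_iff_tendsto_slope' (s := Set.Ioi 1) (by simp)).1
    (hf.hasDerivWithinAt (s := Set.Ioi 1))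
  refine ge_of_tendsto h2 (eventually_mem_nhdsWithin.mono fun t ht => ?_)
  rw [slope_def_field, h1, sub_zero]
  exact div_nonneg (h t ht) (sub_nonneg.2 (le_of_lt ht))

theorem deriv_nonpos_of_left {f : ℝ → ℝ} {f' : ℝ} (hf : HasDerivAt f f' 1) (h1 : f 1 = 0)
    (h : ∀ t, 0 < t → t < 1 → 0 ≤ f t) : f' ≤ 0 := by
  have h2 := (hasDerivWithinAt_iff_tendsto_slope' (s := Set.Iio 1) (by simp)).1
    (hf.hasDerivWithinAt (s := Set.Iio 1))
  have h0 : ∀ᶠ t in 𝓝[<] (1 : ℝ), 0 < t := nhdsWithin_le_nhds (lt_mem_nhds one_pos)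
  refine le_of_tendsto h2 ((eventually_mem_nhdsWithin.and h0).mono fun t ht => ?_)
  rw [slope_def_field, h1, sub_zero]
  exact div_nonpos_of_nonneg_of_nonpos (h t ht.2 ht.1) (sub_nonpos.2 (le_of_lt ht.1))

end Calculus

/-! ### The derivative of the gap and its limit as the cutoffs exhaust space. -/

section Derivatives

variable {N : ℕ} {α p q γ : ℝ} {K u φ χ : Space N → ℝ} {Du Dφ : Space N → Space N}

/-- Differentiation of dilations when the dilated function has compact support. -/
theorem HasWeakGradient.hasDerivAt_dilate_of_support {w h : Space N → ℝ} {G : Space N → Space N}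
    (hw : HasWeakGradient w G) (hwq : MemLp w 2) (hGq : MemLp G 2) (hh : MemLp h 2) {R : ℝ}
    (hwR : ∀ x, R < ‖x‖ → w x = 0) (hGR : ∀ x, R < ‖x‖ → G x = 0) :
    HasDerivAt (fun t : ℝ => ∫ x, h x * w (t • x)) (∫ x, h x * ⟪x, G x⟫) 1 := by
  -- For `t > 1/2` the dilate of `w` vanishes outside this ball, so `h` may be cut off to it, which
  -- supplies the compact support required by `hasDerivAt_dilate_memLp`.
  set B : Set (Space N) := Metric.closedBall 0 (2 * |R|) with hB
  have hBm : MeasurableSet B := Metric.isClosed_closedBall.measurableSet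
  have hk : MemLp (B.indicator h) 2 := hh.indicator hBm
  have hkc : HasCompactSupport (B.indicator h) :=
    HasCompactSupport.intro (isCompact_closedBall 0 (2 * |R|)) fun x hx =>
      Set.indicator_of_notMem hx _
  have hd := hw.hasDerivAt_dilate_memLp (p := 2) (q := 2) (by norm_num) (by norm_num)
    (MemLp.memLpLoc hwq) (MemLp.memLpLoc hGq) hk hkc
  have e1 : ∫ x, B.indicator h x * ⟪x, G x⟫ = ∫ x, h x * ⟪x, G x⟫ := by
    refine integral_congr_ae (Eventually.of_forall fun x => ?_)
    by_cases hx : x ∈ B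
    · simp only [Set.indicator_of_mem hx]
    · have : R < ‖x‖ := by
        simp only [hB, mem_closedBall_zero_iff, not_le] at hx
        linarith [le_abs_self R, abs_nonneg R]
      simp only [hGR x this, inner_zero_right, mul_zero]
  rw [e1] at hd
  refine hd.congr_of_eventuallyEq ?_
  filter_upwards [lt_mem_nhds (show (1 / 2 : ℝ) < 1 by norm_num)] with t ht
  refine integral_congr_ae (Eventually.of_forall fun x => ?_)
  by_cases hx : x ∈ B
  · simp only [Set.indicator_of_mem hx]
  · have : R < ‖t • x‖ := by
      simp only [hB, mem_closedBall_zero_iff, not_le] at hx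
      rw [norm_smul, Real.norm_of_nonneg (by linarith)]
      nlinarith [le_abs_self R, abs_nonneg R, norm_nonneg x]
    simp only [hwR _ this, mul_zero]

theorem contDiff_gradient_coord (hχ : ContDiff ℝ ∞ χ) (i : Fin N) : ContDiff ℝ ∞ fun y => ∇ χ y i :=
  (contDiff_euclidean.1 (ContDiff.gradient_space hχ)) i

theorem hasCompactSupport_gradient_coord (hc : HasCompactSupport χ) (i : Fin N) :
    HasCompactSupport fun y => ∇ χ y i :=
  (HasCompactSupport.gradient hc).comp_left (g := fun v : Space N => v i) rfl

theorem memLp_coord {b : Space N → Space N} {p : ℝ≥0∞} (hb : MemLp b p) (i : Fin N) :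
    MemLp (fun x => b x i) p :=
  hb.norm.mono' ((EuclideanSpace.proj i : Space N →L[ℝ] ℝ).continuous.comp_aestronglyMeasurable hb.1)
    (Eventually.of_forall fun _ => PiLp.norm_apply_le _ _)

/-- The derivative of the transition layer term in the coupling energy. -/
theorem hasDerivAt_layer (hw : HasWeakGradient φ Dφ) (hφ : MemLp φ 2) (hDφ : MemLp Dφ 2)
    (hχ : ContDiff ℝ ∞ χ) (hc : HasCompactSupport χ) :
    HasDerivAt (fun s : ℝ => ∫ x, φ (s • x) * ⟪Dφ x, ∇ χ (s • x)⟫)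
      (∑ i, ∫ x, Dφ x i * ⟪x, ∇ χ x i • Dφ x + φ x • ∇ (fun y => ∇ χ y i) x⟫) 1 := by
  obtain ⟨R, hR⟩ := hc.isCompact.isBounded.subset_closedBall (0 : Space N)
  have hout : ∀ x, R < ‖x‖ → x ∉ tsupport χ := fun x hx h => by
    have := hR h
    rw [mem_closedBall_zero_iff] at this
    linarith
  have hg0 : ∀ x, R < ‖x‖ → ∇ χ x = 0 := fun x hx => gradient_eq_zero_of_notMem (hout x hx)
  have hg1 : ∀ i x, R < ‖x‖ → ∇ (fun y => ∇ χ y i) x = 0 := fun i x hx => by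
    refine gradient_eq_zero_of_eventuallyEq_const (c := 0) ?_
    filter_upwards [(isOpen_lt continuous_const continuous_norm).mem_nhds hx] with y hy
    rw [hg0 y hy]; rfl
  -- Written in coordinates, the dilated factors combine into the scalar functions `∂ᵢχ φ`, which
  -- are compactly supported Sobolev functions paired with the fixed components of `Dφ`.
  have hwi : ∀ i, MemLp (fun x => ∇ χ x i * φ x) 2 := fun i =>
    memLp_mul_smooth hφ (contDiff_gradient_coord hχ i).continuous (hasCompactSupport_gradient_coord hc i)
  have hder := fun i => (hw.mul_smooth (contDiff_gradient_coord hχ i)).hasDerivAt_dilate_of_support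
    (hwi i) (memLp_gradient_mul_smooth hφ hDφ (contDiff_gradient_coord hχ i)
      (hasCompactSupport_gradient_coord hc i)) (memLp_coord hDφ i) (R := R)
    (fun x hx => by rw [hg0 x hx]; simp) (fun x hx => by rw [hg0 x hx, hg1 i x hx]; simp)
  have hsum := HasDerivAt.fun_sum (u := Finset.univ) fun i _ => hder i
  refine hsum.congr_of_eventuallyEq ?_
  filter_upwards [lt_mem_nhds (show (0 : ℝ) < 1 by norm_num)] with t ht
  have hi : ∀ i, Integrable fun x => Dφ x i * (∇ χ (t • x) i * φ (t • x)) := fun i =>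
    MemLp.integrable_mul (p := 2) (q := 2) (memLp_coord hDφ i) (MemLp.comp_smul_space (hwi i) ht)
  rw [← integral_finsetSum _ fun i _ => hi i]
  refine integral_congr_ae (Eventually.of_forall fun x => ?_)
  simp only [inner_eq_sum, Finset.mul_sum]
  exact Finset.sum_congr rfl fun i _ => by ring

/-- The products of `|x|` with first and second derivatives of the cutoffs are uniformly bounded, so
the integrands are dominated by multiples of `|Dφ|²` and `|φ| |Dφ|`, and they vanish eventually at
each point. -/
theorem tendsto_layer_derivative (hφ : MemLp φ 2) (hDφ : MemLp Dφ 2) :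
    Tendsto (fun n => ∑ i, ∫ x, Dφ x i * ⟪x, ∇ (cutoff n) x i • Dφ x +
      φ x • ∇ (fun y => ∇ (cutoff n) y i) x⟫) atTop (𝓝 0) := by
  obtain ⟨C, hC0, hC⟩ := exists_cutoff_bound N
  have : Tendsto (fun n => ∑ i, ∫ x, Dφ x i * ⟪x, ∇ (cutoff n) x i • Dφ x +
      φ x • ∇ (fun y => ∇ (cutoff n) y i) x⟫) atTop (𝓝 (∑ i : Fin N, 0)) := by
    refine tendsto_finsetSum _ fun i _ => ?_
    refine tendsto_integral_layer (((integrable_norm_sq_space hDφ).const_mul C).add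
      ((integrable_mul_norm hφ hDφ).const_mul C)) (fun n => ?_) (fun n => ?_) (fun x => ?_)
    · have hχ := contDiff_cutoff (N := N) n
      refine (memLp_coord hDφ i).1.mul (continuous_id.aestronglyMeasurable.inner ?_)
      exact ((contDiff_gradient_coord hχ i).continuous.aestronglyMeasurable.smul hDφ.1).add
        (hφ.1.smul (ContDiff.gradient_space
          (contDiff_gradient_coord hχ i)).continuous.aestronglyMeasurable)
    · refine Eventually.of_forall fun x => ?_
      have h1 : ‖Dφ x i‖ ≤ ‖Dφ x‖ := PiLp.norm_apply_le _ _
      have h2 : ‖∇ (cutoff n) x i‖ ≤ ‖∇ (cutoff n) x‖ := PiLp.norm_apply_le _ _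
      have h3 : ‖⟪x, ∇ (cutoff n) x i • Dφ x + φ x • ∇ (fun y => ∇ (cutoff n) y i) x⟫‖ ≤
          C * ‖Dφ x‖ + C * |φ x| := by
        refine (norm_inner_le_norm _ _).trans ?_
        calc ‖x‖ * ‖∇ (cutoff n) x i • Dφ x + φ x • ∇ (fun y => ∇ (cutoff n) y i) x‖
            ≤ ‖x‖ * (‖∇ (cutoff n) x i‖ * ‖Dφ x‖ + |φ x| * ‖∇ (fun y => ∇ (cutoff n) y i) x‖) := by
              refine mul_le_mul_of_nonneg_left ((norm_add_le _ _).trans ?_) (norm_nonneg _)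
              rw [norm_smul, norm_smul, Real.norm_eq_abs (φ x)]
          _ ≤ ‖x‖ * (‖∇ (cutoff n) x‖ * ‖Dφ x‖ + |φ x| * ‖∇ (fun y => ∇ (cutoff n) y i) x‖) := by
              gcongr
          _ = (‖x‖ * ‖∇ (cutoff n) x‖) * ‖Dφ x‖ +
                (‖x‖ * ‖∇ (fun y => ∇ (cutoff n) y i) x‖) * |φ x| := by ring
          _ ≤ C * ‖Dφ x‖ + C * |φ x| := by
              gcongr
              · exact (hC n x).2.1
              · exact (hC n x).2.2 i
      rw [norm_mul]
      calc ‖Dφ x i‖ * _ ≤ ‖Dφ x‖ * (C * ‖Dφ x‖ + C * |φ x|) := by gcongr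
        _ = C * ‖Dφ x‖ ^ 2 + C * (|φ x| * ‖Dφ x‖) := by ring
    · filter_upwards [eventually_gradient_cutoff_eq_zero x] with n hn
      have h1 : ∇ (fun y => ∇ (cutoff n) y i) x = 0 := by
        refine gradient_eq_zero_of_eventuallyEq_const (c := 0) ?_
        filter_upwards [hn] with y hy
        rw [hy]; rfl
      rw [h1, hn.self_of_nhds]
      simp
  simpa using this

theorem memLp_inner_gradient {p : ℝ≥0∞} (hDu : MemLp Du p) (hχ : ContDiff ℝ ∞ χ)
    (hc : HasCompactSupport χ) : MemLp (fun x => ⟪Du x, ∇ χ x⟫) p := by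
  obtain ⟨C, hC⟩ := (HasCompactSupport.gradient hc).exists_bound_of_continuous
    (ContDiff.gradient_space hχ).continuous
  refine (hDu.norm.mul_const C).mono' (hDu.1.inner
    (ContDiff.gradient_space hχ).continuous.aestronglyMeasurable) (Eventually.of_forall fun x => ?_)
  exact (norm_inner_le_norm _ _).trans (mul_le_mul_of_nonneg_left (hC x) (norm_nonneg _))

theorem tendsto_gradient_pair (hDu : MemLp Du 2) :
    Tendsto (fun n => ∫ x, ⟪Du x, ∇ (cutoff n) x⟫ * ⟪x, Du x⟫) atTop (𝓝 0) := by
  obtain ⟨C, hC0, hC⟩ := exists_cutoff_bound N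
  refine tendsto_integral_layer ((integrable_norm_sq_space hDu).const_mul C) (fun n => ?_)
    (fun n => Eventually.of_forall fun x => ?_) (fun x => ?_)
  · exact (hDu.1.inner (ContDiff.gradient_space
      (contDiff_cutoff n)).continuous.aestronglyMeasurable).mul
      (continuous_id.aestronglyMeasurable.inner hDu.1)
  · rw [norm_mul]
    calc ‖⟪Du x, ∇ (cutoff n) x⟫‖ * ‖⟪x, Du x⟫‖
        ≤ (‖Du x‖ * ‖∇ (cutoff n) x‖) * (‖x‖ * ‖Du x‖) :=
          mul_le_mul (norm_inner_le_norm _ _) (norm_inner_le_norm _ _) (norm_nonneg _) (by positivity)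
      _ = (‖x‖ * ‖∇ (cutoff n) x‖) * ‖Du x‖ ^ 2 := by ring
      _ ≤ C * ‖Du x‖ ^ 2 := by gcongr; exact (hC n x).2.1
  · filter_upwards [eventually_gradient_cutoff_eq_zero x] with n hn
    rw [hn.self_of_nhds, inner_zero_right, zero_mul]

namespace RegularSolution

/-- The dilation gap of a solution for a given cutoff. -/
noncomputable def gap (α p q γ : ℝ) (u φ χ : Space N → ℝ) (Du Dφ : Space N → Space N) : ℝ → ℝ :=
  dilationGap N q γ (fun s => ∫ x, χ (s • x) * u x ^ 2) (fun s => ∫ x, χ (s • x) * ⟪Du x, Du x⟫)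
    (fun s => ∫ x, χ (s • x) * ⟪Dφ x, Dφ x⟫) (fun t => ∫ x, ⟪Du x, ∇ χ x⟫ * u (t • x))
    (fun s => ∫ x, φ (s • x) * ⟪Dφ x, ∇ χ (s • x)⟫)
    (fun t => ∫ x, χ x * choquardTerm α p u x * u (t • x))

/-- The coupling energy of the dilated source is replaced by its upper bound, and the undilated one
by its exact value from the Poisson equation. The two expressions agree at `t = 1`, so the gap still
vanishes there. -/
theorem gap_nonneg (S : RegularSolution α p q K u φ Du Dφ) (hχ : ContDiff ℝ ∞ χ)
    (hc : HasCompactSupport χ) (hχ0 : ∀ x, 0 ≤ χ x) {t : ℝ} (ht : 0 < t)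
    (hK : ∀ x, K x ≤ t ^ γ * K (t • x)) : 0 ≤ gap α p q γ u φ χ Du Dφ t := by
  have hq := S.params.one_lt_q
  have h1 := S.dilation_inequality hχ hc hχ0 ht hK
  have h2 := (S.coupling_dilate_le hχ hc hχ0 ht).2
  have h3 := (S.poisson.integral_smooth_mul S.gradient_phi S.memLp_phi S.memLp_Dphi
    S.locallyIntegrable_source S.source_nonneg S.phi_nonneg hχ hc hχ0).2
  rw [h3, integral_mul_comp_smul χ (fun x => u x ^ 2) ht,
    integral_mul_comp_smul χ (fun x => ⟪Du x, Du x⟫) ht] at h1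
  have h4 := mul_le_mul_of_nonneg_left (mul_le_mul_of_nonneg_left h2
    (by positivity : 0 ≤ t ^ γ)) (by positivity : 0 ≤ 1 / q)
  simp only [gap, dilationGap, one_smul]
  linarith

theorem hasDerivAt_gap (S : RegularSolution α p q K u φ Du Dφ) (hχ : ContDiff ℝ ∞ χ)
    (hc : HasCompactSupport χ) :
    HasDerivAt (gap α p q γ u φ χ Du Dφ)
      ((1 / 2) * (-N * (∫ x, χ x * u x ^ 2) - ∫ x, ⟪x, ∇ χ x⟫ * u x ^ 2) +
        (1 / 2) * ((2 - N) * (∫ x, χ x * ⟪Du x, Du x⟫) - ∫ x, ⟪x, ∇ χ x⟫ * ⟪Du x, Du x⟫) +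
        (∫ x, ⟪Du x, ∇ χ x⟫ * ⟪x, Du x⟫) +
        (1 / q) * ((γ - N - 1) * ((∫ x, χ x * ⟪Dφ x, Dφ x⟫) + ∫ x, φ x * ⟪Dφ x, ∇ χ x⟫) +
          (N / 2 * (∫ x, χ x * ⟪Dφ x, Dφ x⟫) - (∫ x, ⟪x, ∇ χ x⟫ * ⟪Dφ x, Dφ x⟫) / 2 -
            ∑ i, ∫ x, Dφ x i * ⟪x, ∇ χ x i • Dφ x + φ x • ∇ (fun y => ∇ χ y i) x⟫)) -
        ∫ x, χ x * choquardTerm α p u x * ⟪x, Du x⟫) 1 := by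
  have hχ1 : ContDiff ℝ 1 χ := hχ.of_le (by simp)
  have hconj := (Real.HolderConjugate.conjExponent S.params.one_lt_crit).symm
  have := hconj.ennrealOfReal
  have hl := S.gradient_u.hasDerivAt_dilate_memLp
    (p := ENNReal.ofReal (p * (2 * N / (N + α) : ℝ)).conjExponent)
    (q := ENNReal.ofReal (p * (2 * N / (N + α))))
    (by rw [← ENNReal.ofReal_one]; exact ENNReal.ofReal_le_ofReal hconj.lt.le) ENNReal.ofReal_ne_top
    (MemLp.memLpLoc S.memLp_u_crit) S.memLpLoc_Du_crit
    (memLp_mul_smooth S.memLp_choquardTerm hχ.continuous hc) hc.smul_right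
  have hd := S.gradient_u.hasDerivAt_dilate_memLp (p := 2) (q := 2) (by norm_num) (by norm_num)
    (MemLp.memLpLoc S.memLp_u) (MemLp.memLpLoc S.memLp_Du) (memLp_inner_gradient S.memLp_Du hχ hc)
    (HasCompactSupport.mono (HasCompactSupport.gradient hc) fun _ hx h => hx (by simp [h]))
  have h := hasDerivAt_dilationGap (N := N) (q := q) (γ := γ)
    (hasDerivAt_integral_dilate hχ1 hc S.memLp_u.integrable_sq.locallyIntegrable)
    (hasDerivAt_integral_dilate hχ1 hc (integrable_inner_of_memLp (p := 2) (q := 2) S.memLp_Du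
      S.memLp_Du).locallyIntegrable)
    (hasDerivAt_integral_dilate hχ1 hc (integrable_inner_of_memLp (p := 2) (q := 2) S.memLp_Dphi
      S.memLp_Dphi).locallyIntegrable) hd
    (hasDerivAt_layer S.gradient_phi S.memLp_phi S.memLp_Dphi hχ hc) hl
  simp only [one_smul, smul_eq_mul] at h
  exact h

/-- The dilation identity is applied to `|u|^p`, whose gradient is `p |u|^(p-2) u Du`; dividing by
`p` gives the constant. -/
theorem tendsto_choquard_dilation (S : RegularSolution α p q K u φ Du Dφ) :
    Tendsto (fun n => ∫ x, cutoff n x * choquardTerm α p u x * ⟪x, Du x⟫) atTop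
      (𝓝 (-((N + α) / (2 * p)) * ∫ x, rieszPotential α (fun y => |u y| ^ p) x * |u x| ^ p)) := by
  have hp0 : p ≠ 0 := by linarith [S.params.one_lt_p]
  have h := (tendsto_integral_rieszPotential_dilation S.params.alpha_pos S.params.alpha_lt
    S.memLp_rpow S.gradient_rpow S.memLpLoc_gradient_rpow).const_mul p⁻¹
  have e : p⁻¹ * (-((N + α) / 2) * ∫ x, rieszPotential α (fun y => |u y| ^ p) x * |u x| ^ p) =
      -((N + α) / (2 * p)) * ∫ x, rieszPotential α (fun y => |u y| ^ p) x * |u x| ^ p := by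
    field_simp
  rw [← e]
  refine h.congr fun n => ?_
  rw [← integral_const_mul]
  refine integral_congr_ae (Eventually.of_forall fun x => ?_)
  simp only [inner_smul_right, choquardTerm]
  field_simp

/-- The limit of the derivatives of the dilation gaps. -/
theorem tendsto_gap_derivative (S : RegularSolution α p q K u φ Du Dφ) (γ : ℝ) :
    ∃ d : ℕ → ℝ, (∀ n, HasDerivAt (gap α p q γ u φ (cutoff n) Du Dφ) (d n) 1) ∧
      Tendsto d atTop (𝓝 ((N + α) / (2 * p) *
        (∫ x, rieszPotential α (fun y => |u y| ^ p) x * |u x| ^ p) -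
        N / 2 * (∫ x, u x ^ 2) - (N - 2) / 2 * (∫ x, ⟪Du x, Du x⟫) -
        (N + 2 - 2 * γ) / (2 * q) * ∫ x, ⟪Dφ x, Dφ x⟫)) := by
  refine ⟨_, fun n => S.hasDerivAt_gap (contDiff_cutoff n) (hasCompactSupport_cutoff n), ?_⟩
  have hq0 : q ≠ 0 := by linarith [S.params.one_lt_q]
  have i1 := S.memLp_u.integrable_sq
  have i2 := integrable_inner_of_memLp (p := 2) (q := 2) S.memLp_Du S.memLp_Du
  have i3 := integrable_inner_of_memLp (p := 2) (q := 2) S.memLp_Dphi S.memLp_Dphi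
  have t3 := tendsto_integral_cutoff_mul i3
  have t := ((((((tendsto_integral_cutoff_mul i1).const_mul (-(N : ℝ))).sub
    (tendsto_integral_radial_cutoff i1)).const_mul (1 / 2)).add
    ((((tendsto_integral_cutoff_mul i2).const_mul (2 - (N : ℝ))).sub
    (tendsto_integral_radial_cutoff i2)).const_mul (1 / 2))).add
    (tendsto_gradient_pair S.memLp_Du)).add
    ((((t3.add (tendsto_integral_gradient_cutoff S.memLp_phi S.memLp_Dphi)).const_mul
      (γ - N - 1)).add (((t3.const_mul (N / 2 : ℝ)).sub
      ((tendsto_integral_radial_cutoff i3).div_const 2)).sub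
      (tendsto_layer_derivative S.memLp_phi S.memLp_Dphi))).const_mul (1 / q))
  have h := t.sub S.tendsto_choquard_dilation
  have hp0 : p ≠ 0 := by linarith [S.params.one_lt_p]
  -- Terms with derivatives of the cutoff disappear. The coefficient of `∫ |Dφ|²` is `(γ - N - 1 +
  -- N/2)/q = -(N + 2 - 2γ)/(2q)`.
  convert h using 2
  field_simp
  ring

end RegularSolution

end Derivatives

/-! ### Pohozaev inequalities and vanishing of solutions. -/

section Nonexistence

variable {N : ℕ} {α p q γ : ℝ} {K u φ : Space N → ℝ} {Du Dφ : Space N → Space N}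

theorem ae_eq_zero_of_integral_inner_self {b : Space N → Space N} (hb : MemLp b 2)
    (h : ∫ x, ⟪b x, b x⟫ ≤ 0) : b =ᵐ[volume] 0 := by
  have h0 : ∫ x, ⟪b x, b x⟫ = 0 := le_antisymm h (integral_nonneg fun x => real_inner_self_nonneg)
  have := (integral_eq_zero_iff_of_nonneg (fun x => real_inner_self_nonneg)
    (integrable_inner_of_memLp (p := 2) (q := 2) hb hb)).1 h0
  filter_upwards [this] with x hx
  exact inner_self_eq_zero.1 hx

namespace RegularSolution

/-- The Pohozaev inequality for weights satisfying `x · ∇K + γ K ≥ 0`. -/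
theorem pohozaev_le (S : RegularSolution α p q K u φ Du Dφ)
    (hK : ∀ x, 0 ≤ ⟪x, ∇ K x⟫ + γ * K x) :
    0 ≤ (N + α) / (2 * p) * (∫ x, rieszPotential α (fun y => |u y| ^ p) x * |u x| ^ p) -
        N / 2 * (∫ x, u x ^ 2) - (N - 2) / 2 * (∫ x, ⟪Du x, Du x⟫) -
        (N + 2 - 2 * γ) / (2 * q) * ∫ x, ⟪Dφ x, Dφ x⟫ := by
  obtain ⟨d, hd, hlim⟩ := S.tendsto_gap_derivative γ
  refine ge_of_tendsto' hlim fun n => deriv_nonneg_of_right (hd n) (dilationGap_one _ _ _ _ _ _ _ _ _)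
    fun t ht => S.gap_nonneg (contDiff_cutoff n) (hasCompactSupport_cutoff n) (cutoff_nonneg n)
      (one_pos.trans ht) fun x => le_rpow_mul_dilate S.params.contDiff_K hK ht.le x

/-- The Pohozaev inequality for weights satisfying `x · ∇K + γ K ≤ 0`. -/
theorem le_pohozaev (S : RegularSolution α p q K u φ Du Dφ)
    (hK : ∀ x, ⟪x, ∇ K x⟫ + γ * K x ≤ 0) :
    (N + α) / (2 * p) * (∫ x, rieszPotential α (fun y => |u y| ^ p) x * |u x| ^ p) -
        N / 2 * (∫ x, u x ^ 2) - (N - 2) / 2 * (∫ x, ⟪Du x, Du x⟫) -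
        (N + 2 - 2 * γ) / (2 * q) * (∫ x, ⟪Dφ x, Dφ x⟫) ≤ 0 := by
  obtain ⟨d, hd, hlim⟩ := S.tendsto_gap_derivative γ
  refine le_of_tendsto' hlim fun n => deriv_nonpos_of_left (hd n) (dilationGap_one _ _ _ _ _ _ _ _ _)
    fun t ht0 ht1 => S.gap_nonneg (contDiff_cutoff n) (hasCompactSupport_cutoff n) (cutoff_nonneg n)
      ht0 fun x => le_rpow_mul_dilate' S.params.contDiff_K hK ht0 ht1.le x

/-- Substituting the Nehari identity into the Pohozaev inequality, the coefficients of `∫ |Du|²` and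
`∫ |Dφ|²` are nonpositive, and that of `∫ u²` is at most `(N - 2)/2 - N/2 = -1`. Hence `∫ u² = 0`.
-/
theorem u_eq_zero_of_le (S : RegularSolution α p q K u φ Du Dφ) (hN : 3 ≤ N)
    (hK : ∀ x, 0 ≤ ⟪x, ∇ K x⟫ + γ * K x) (hp : (N + α) / (N - 2) ≤ p)
    (hpq : (N + α) / p ≤ (N + 2 - 2 * γ) / q) : u =ᵐ[volume] 0 := by
  have hp0 : 0 < p := by linarith [S.params.one_lt_p]
  have hN3 : (3 : ℝ) ≤ N := by exact_mod_cast hN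
  have h := S.pohozaev_le hK
  rw [← S.nehari] at h
  have hA : 0 ≤ ∫ x, ⟪Du x, Du x⟫ := integral_nonneg fun x => real_inner_self_nonneg
  have hB : 0 ≤ ∫ x, u x ^ 2 := integral_nonneg fun x => sq_nonneg _
  have hP : 0 ≤ ∫ x, ⟪Dφ x, Dφ x⟫ := integral_nonneg fun x => real_inner_self_nonneg
  have h1 : (N + α) / (2 * p) ≤ (N - 2) / 2 := by
    rw [div_le_iff₀ (by linarith)] at hp
    rw [div_le_div_iff₀ (by linarith) two_pos]
    linarith
  have h2 : (N + α) / (2 * p) ≤ (N + 2 - 2 * γ) / (2 * q) := by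
    rw [mul_comm 2 p, mul_comm 2 q, ← div_div, ← div_div]
    linarith
  have h3 := mul_le_mul_of_nonneg_right h1 hA
  have h4 := mul_le_mul_of_nonneg_right h1 hB
  have h5 := mul_le_mul_of_nonneg_right h2 hP
  have hB0 : ∫ x, u x ^ 2 = 0 := by linarith
  have := (integral_eq_zero_iff_of_nonneg (fun x => sq_nonneg (u x)) S.memLp_u.integrable_sq).1 hB0
  filter_upwards [this] with x hx
  exact pow_eq_zero_iff two_ne_zero |>.1 hx

/-- Now the coefficients of `∫ u²` and `∫ |Dφ|²` are nonnegative and that of `∫ |Du|²` is at least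
`N/2 - (N - 2)/2 = 1`. Only the gradient is forced to vanish, and square integrability then rules
out nonzero constants. -/
theorem u_eq_zero_of_ge (S : RegularSolution α p q K u φ Du Dφ)
    (hK : ∀ x, ⟪x, ∇ K x⟫ + γ * K x ≤ 0) (hp : p ≤ (N + α) / N)
    (hpq : (N + 2 - 2 * γ) / q ≤ (N + α) / p) : u =ᵐ[volume] 0 := by
  have hp0 : 0 < p := by linarith [S.params.one_lt_p]
  have hN0 : (0 : ℝ) < N := Nat.cast_pos.2 S.params.dim_pos
  have h := S.le_pohozaev hK
  rw [← S.nehari] at h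
  have hA : 0 ≤ ∫ x, ⟪Du x, Du x⟫ := integral_nonneg fun x => real_inner_self_nonneg
  have hB : 0 ≤ ∫ x, u x ^ 2 := integral_nonneg fun x => sq_nonneg _
  have hP : 0 ≤ ∫ x, ⟪Dφ x, Dφ x⟫ := integral_nonneg fun x => real_inner_self_nonneg
  have h1 : (N : ℝ) / 2 ≤ (N + α) / (2 * p) := by
    rw [le_div_iff₀ hN0] at hp
    rw [div_le_div_iff₀ two_pos (by linarith)]
    linarith
  have h2 : (N + 2 - 2 * γ) / (2 * q) ≤ (N + α) / (2 * p) := by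
    rw [mul_comm 2 p, mul_comm 2 q, ← div_div, ← div_div]
    linarith
  have h3 := mul_le_mul_of_nonneg_right h1 hA
  have h4 := mul_le_mul_of_nonneg_right h1 hB
  have h5 := mul_le_mul_of_nonneg_right h2 hP
  exact S.gradient_u.ae_eq_zero S.params.dim_pos
    (ae_eq_zero_of_integral_inner_self S.memLp_Du (by linarith)) S.memLp_u

theorem phi_eq_zero (S : RegularSolution α p q K u φ Du Dφ) (hu : u =ᵐ[volume] 0) :
    φ =ᵐ[volume] 0 := by
  have hq := S.params.one_lt_q
  have h0 : ∫ x, K x * |u x| ^ q * φ x = 0 := by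
    refine integral_eq_zero_of_ae ?_
    filter_upwards [hu] with x hx
    simp [hx, Real.zero_rpow (by linarith : q ≠ 0)]
  rw [S.coupling.2] at h0
  exact S.gradient_phi.ae_eq_zero S.params.dim_pos
    (ae_eq_zero_of_integral_inner_self S.memLp_Dphi h0.le) S.memLp_phi

end RegularSolution

theorem MemLpLoc.congr_ae {V : Type*} [NormedAddCommGroup V] {f g : Space N → V} {p : ℝ≥0∞}
    (hf : MemLpLoc f p) (h : f =ᵐ[volume] g) : MemLpLoc g p := fun C hC =>
  (memLp_congr_ae (ae_restrict_of_ae h)).1 (hf C hC)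

/-- The weak gradients in the equation and those in the regularity class come from separate
existential statements; uniqueness identifies them almost everywhere. For `N ≥ 2` the exponent
`2N/(N + 2)` is at least one, so the source is locally integrable. -/
theorem exists_regularSolution (P : Parameters N α p q K) (hN : 2 ≤ N)
    (hw : IsWeakSolution α p q K u φ) (hr : IsRegular α p q K u φ) :
    ∃ Du Dφ, RegularSolution α p q K u φ Du Dφ := by
  obtain ⟨Du, Dφ, hDu, hDφ, heq⟩ := hw
  obtain ⟨⟨hu, G, hG, hG2⟩, hus, ⟨hφ, H, hH, hH2⟩, hsrc, Du', hDu', -, hDuloc⟩ := hr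
  have hs : 2 * N * p / (N + α) = p * (2 * N / (N + α)) := by ring
  rw [hs] at hus hDuloc
  have hN2 : (2 : ℝ) ≤ N := by exact_mod_cast hN
  refine ⟨Du, Dφ, P, hDu, hDφ, hu, (memLp_congr_ae (hG.unique hDu)).1 hG2, hφ,
    (memLp_congr_ae (hH.unique hDφ)).1 hH2, hus, hDuloc.congr_ae (hDu'.unique hDu), ?_,
    fun η hη hc => (heq η hη hc).2, fun η hη hc => (heq η hη hc).1⟩
  refine MemLpLoc.locallyIntegrable ?_ (MemLp.memLpLoc hsrc)
  rw [← ENNReal.ofReal_one]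
  refine ENNReal.ofReal_le_ofReal ?_
  rw [le_div_iff₀ (by linarith)]
  linarith

theorem hasWeakGradient_zero (hu : u =ᵐ[volume] 0) : HasWeakGradient u 0 := by
  have h := hasWeakGradient_of_contDiff (w := fun _ : Space N => (0 : ℝ)) contDiff_const
  exact h.congr hu.symm (Eventually.of_forall fun x => gradient_eq_zero_of_eventuallyEq_const
    (c := 0) (Eventually.of_forall fun _ => rfl))

theorem isWeakSolution_of_ae_eq_zero (hu : u =ᵐ[volume] 0) (hφ : φ =ᵐ[volume] 0) (hq : q ≠ 0) :
    IsWeakSolution α p q K u φ := by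
  have z : ∀ {f : Space N → ℝ}, (∀ x, u x = 0 → φ x = 0 → f x = 0) → ∫ x, f x = 0 := fun hf =>
    integral_eq_zero_of_ae (by filter_upwards [hu, hφ] with x h1 h2 using hf x h1 h2)
  refine ⟨0, 0, hasWeakGradient_zero hu, hasWeakGradient_zero hφ, fun η hη hc => ⟨?_, ?_⟩⟩
  · rw [z fun x _ _ => by simp, z fun x h _ => by rw [h, zero_mul],
      z fun x h _ => by rw [h, mul_zero, mul_zero, zero_mul],
      z fun x h _ => by rw [h, mul_zero, mul_zero, zero_mul], add_zero, add_zero]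
  · rw [z fun x _ _ => by simp, z fun x h _ => by
      rw [h, abs_zero, Real.zero_rpow hq, mul_zero, zero_mul]]

theorem isRegular_of_ae_eq_zero (hu : u =ᵐ[volume] 0) (hφ : φ =ᵐ[volume] 0) (hq : q ≠ 0) :
    IsRegular α p q K u φ := by
  have m0 : ∀ {V : Type} [NormedAddCommGroup V] {f : Space N → V} (s : ℝ≥0∞), f =ᵐ[volume] 0 →
      MemLp f s := fun s h => (memLp_congr_ae h).2 MemLp.zero
  have hz : ∀ {V : Type} [NormedAddCommGroup V] (s : ℝ≥0∞), MemLpLoc (0 : Space N → V) s :=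
    fun s => MemLp.memLpLoc (m0 s EventuallyEq.rfl)
  refine ⟨⟨m0 _ hu, 0, hasWeakGradient_zero hu, m0 _ EventuallyEq.rfl⟩, m0 _ hu,
    ⟨m0 _ hφ, 0, hasWeakGradient_zero hφ, m0 _ EventuallyEq.rfl⟩, m0 _ ?_, 0,
    hasWeakGradient_zero hu, fun i => ⟨hz 2, 0, hasWeakGradient_zero EventuallyEq.rfl, hz 2⟩, hz _⟩
  filter_upwards [hu] with x hx
  simp [hx, Real.zero_rpow hq]

end Nonexistence

end ChoquardSP

theorem theorem2p1 (N : ℕ) (hN : 3 ≤ N) (α p q : ℝ) (hα0 : 0 < α) (hαN : α < N)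
    (hp : 1 < p) (hq : 1 < q) (K : EuclideanSpace ℝ (Fin N) → ℝ)
    (hK : ContDiff ℝ 1 K) (hK0 : ∀ x, 0 ≤ K x)
    (h : (∃ γ : ℝ, γ < (N + 2) / 2 ∧ (∀ x, 0 ≤ ⟪x, ∇ K x⟫ + γ * K x) ∧
            (N + α) / (N - 2) ≤ p ∧ (N + α) / p ≤ (N + 2 - 2 * γ) / q) ∨
         (∃ γ : ℝ, (∀ x, ⟪x, ∇ K x⟫ + γ * K x ≤ 0) ∧
            p ≤ (N + α) / N ∧ (N + 2 - 2 * γ) / q ≤ (N + α) / p))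
    (u φ : EuclideanSpace ℝ (Fin N) → ℝ) :
    (ChoquardSP.IsWeakSolution α p q K u φ ∧ ChoquardSP.IsRegular α p q K u φ) ↔
      (u =ᵐ[volume] 0 ∧ φ =ᵐ[volume] 0) := by
  have hq0 : q ≠ 0 := by linarith
  constructor
  · rintro ⟨hw, hr⟩
    obtain ⟨Du, Dφ, S⟩ := ChoquardSP.exists_regularSolution ⟨hα0, hαN, hp, hq, hK, hK0⟩
      (by omega) hw hr
    have hu : u =ᵐ[volume] 0 := by
      rcases h with ⟨γ, -, h1, h2, h3⟩ | ⟨γ, h1, h2, h3⟩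
      · exact S.u_eq_zero_of_le hN h1 h2 h3
      · exact S.u_eq_zero_of_ge h1 h2 h3
    exact ⟨hu, S.phi_eq_zero hu⟩
  -- Conversely, pairs vanishing almost everywhere do solve the system and lie in the regularity
  -- class, so the uniqueness is not vacuous.
  · rintro ⟨hu, hφ⟩
    exact ⟨ChoquardSP.isWeakSolution_of_ae_eq_zero hu hφ hq0,
      ChoquardSP.isRegular_of_ae_eq_zero hu hφ hq0⟩
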